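/- **Conventions.** Let $\mathcal C$ be an autonomous (rigid) category: a monoidal category in which every object $X$ has a chosen left dual ${}^\vee X$, with $\mathrm{ev}_X\colon{}^\vee X\otimes X\to\mathbb 1$ and $\mathrm{coev}_X\colon\mathbb 1\to X\otimes{}^\vee X$, and a chosen right dual $X^\vee$, with $\widetilde{\mathrm{ev}}_X\colon X\otimes X^\vee\to\mathbb 1$ and $\widetilde{\mathrm{coev}}_X\colon\mathbb 1\to X^\vee\otimes X$. Associativity and unit isomorphisms of $\mathcal C$ are suppressed. A *bimonad* on $\mathcal C$ is a monad $(T,\mu,\eta)$ whose functor $T$ is comonoidal, with $T_2(X,Y)\colon T(X\otimes Y)\to T(X)\otimes T(Y)$ and $T_0\colon T(\mathbb 1)\to\mathbb 1$, such that $\mu$ and $\eta$ are comonoidal natural transformations. Put $T_3(X,Y,Z)=(\mathrm{id}_{T(X)}\otimes T_2(Y,Z))\,T_2(X,Y\otimes Z)$. A *left antipode* of $T$ is a natural transformation $s^l_X\colon T({}^\vee T(X))\to{}^\vee X$ with $$T_0T\bigl(\mathrm{ev}_X({}^\vee\eta_X\otimes\mathrm{id}_X)\bigr)=\mathrm{ev}_{T(X)}\bigl(s^l_{T(X)}T({}^\vee\mu_X)\otimes\mathrm{id}_{T(X)}\bigr)T_2({}^\vee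 T(X),X),$$ $$(\eta_X\otimes\mathrm{id}_{{}^\vee X})\,\mathrm{coev}_X\,T_0=(\mu_X\otimes s^l_X)\,T_2(T(X),{}^\vee T(X))\,T(\mathrm{coev}_{T(X)}),$$ and a *right antipode* is a natural transformation $s^r_X\colon T(T(X)^\vee)\to X^\vee$ with $$T_0T\bigl(\widetilde{\mathrm{ev}}_X(\mathrm{id}_X\otimes\eta_X^\vee)\bigr)=\widetilde{\mathrm{ev}}_{T(X)}\bigl(\mathrm{id}_{T(X)}\otimes s^r_{T(X)}T(\mu_X^\vee)\bigr)T_2(X,T(X)^\vee),$$ $$(\mathrm{id}_{X^\vee}\otimes\eta_X)\,\widetilde{\mathrm{coev}}_X\,T_0=(s^r_X\otimes\mu_X)\,T_2(T(X)^\vee,T(X))\,T(\widetilde{\mathrm{coev}}_{T(X)}).$$ Antipodes are unique if they exist. A *Hopf monad* on $\mathcal C$ is a bimonad which has a left and a right antipode. An *R-matrix* for a Hopf monad $(T,\mu,\eta)$ is a natural transformation $R_{X,Y}\colon X\otimes Y\to T(Y)\otimes T(X)$ such that for all objects $X,Y,Z$ $$(\mu_Y\otimes\mu_X)R_{T(X),T(Y)}T_2(X,Y)=(\mu_Y\otimes\mu_X)T_2(T(Y),T(X))T(R_{X,Y}),$$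 $$(\mathrm{id}_{T(Z)}\otimes T_2(X,Y))R_{X\otimes Y,Z}=(\mu_Z\otimes\mathrm{id}_{T(X)\otimes T(Y)})(R_{X,T(Z)}\otimes\mathrm{id}_{T(Y)})(\mathrm{id}_X\otimes R_{Y,Z}),$$ $$(T_2(Y,Z)\otimes\mathrm{id}_{T(X)})R_{X,Y\otimes Z}=(\mathrm{id}_{T(Y)\otimes T(Z)}\otimes\mu_X)(\mathrm{id}_{T(Y)}\otimes R_{T(X),Z})(R_{X,Y}\otimes\mathrm{id}_Z),$$ $$(\mathrm{id}_{T(X)}\otimes T_0)R_{\mathbb 1,X}=\eta_X=(T_0\otimes\mathrm{id}_{T(X)})R_{X,\mathbb 1}.$$ A *quasitriangular Hopf monad* is a Hopf monad equipped with an R-matrix. **The double.** Let $T$ be a *centralizable* Hopf monad on $\mathcal C$, i.e. one having a *centralizer* $(Z_T,\partial)$: an endofunctor $Z_T$ of $\mathcal C$ with a natural transformation $\partial_{X,Y}\colon X\otimes Y\to T(Y)\otimes Z_T(X)$ such that for all objects $X,W$ and every family $\xi_Y\colon X\otimes Y\to T(Y)\otimes W$ natural in $Y$ there is a unique $r\colon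 Z_T(X)\to W$ with $\xi_Y=(\mathrm{id}_{T(Y)}\otimes r)\partial_{X,Y}$ for all $Y$. Fix such a centralizer. The following structure maps on $Z_T$ are well defined by the stated equations (holding for all objects $Y,Y_1,Y_2$): * $m_X\colon Z_T^2(X)\to Z_T(X)$, by $(\mathrm{id}\otimes m_X)(\mathrm{id}_{T(Y_1)}\otimes\partial_{Z_T(X),Y_2})(\partial_{X,Y_1}\otimes\mathrm{id}_{Y_2})=(T_2(Y_1,Y_2)\otimes\mathrm{id})\,\partial_{X,Y_1\otimes Y_2}$; * $u_X=(T_0\otimes\mathrm{id}_{Z_T(X)})\,\partial_{X,\mathbb 1}\colon X\to Z_T(X)$; * $(Z_T)_2(X_1,X_2)\colon Z_T(X_1\otimes X_2)\to Z_T(X_1)\otimes Z_T(X_2)$, by $(\mathrm{id}_{T(Y)}\otimes (Z_T)_2(X_1,X_2))\,\partial_{X_1\otimes X_2,Y}=(\mu_Y\otimes\mathrm{id})(\partial_{X_1,T(Y)}\otimes\mathrm{id})(\mathrm{id}_{X_1}\otimes\partial_{X_2,Y})$; * $(Z_T)_0\colon Z_T(\mathbb 1)\to\mathbb 1$, by $(\mathrm{id}_{T(Y)}\otimes(Z_T)_0)\,\partial_{\mathbb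 1,Y}=\eta_Y$. Put $i_{X,Y}=(\mathrm{ev}_{T(Y)}\otimes\mathrm{id}_{Z_T(X)})(\mathrm{id}_{{}^\vee T(Y)}\otimes\partial_{X,Y})\colon{}^\vee T(Y)\otimes X\otimes Y\to Z_T(X)$. Then $i_{X,-}$ and $T(i_{X,-})$ are universal dinatural transformations, and the *canonical distributive law* $\Omega\colon TZ_T\to Z_TT$ is well defined by $$\Omega_X\,T(i_{X,Y})=i_{T(X),T(Y)}\bigl({}^\vee\mu_Y\,s^l_{T(Y)}\,T({}^\vee\mu_Y)\otimes\mathrm{id}_{T(X)\otimes T(Y)}\bigr)T_3({}^\vee T(Y),X,Y).$$ Let $D_T=Z_T\circ_\Omega T$ be the endofunctor $Z_TT$ with product $p_X=m_{T(X)}Z_T^2(\mu_X)Z_T(\Omega_{T(X)})$, unit $e_X=u_{T(X)}\eta_X$, and comonoidal structure $(D_T)_2(X,Y)=(Z_T)_2(T(X),T(Y))\,Z_T(T_2(X,Y))$, $(D_T)_0=(Z_T)_0\,Z_T(T_0)$. **Theorem.** Let $T$ be a centralizable Hopf monad on an autonomous category $\mathcal C$, with centralizer $(Z_T,\partial)$.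 Then $D_T$ is a Hopf monad on $\mathcal C$, and the family $$R_{X,Y}=\bigl(u_{T(Y)}\otimes Z_T(\eta_X)\bigr)\,\partial_{X,Y}\colon X\otimes Y\to D_T(Y)\otimes D_T(X)$$ is an R-matrix for $D_T$. Thus $(D_T,R)$ is a quasitriangular Hopf monad, the *double* of $T$. -/

import Mathlib

open CategoryTheory MonoidalCategory

universe v u

section Structures

variable {C : Type u} [Category.{v} C] [MonoidalCategory C]

/-! All monoidal categories are arbitrary (associators and unitors are written out), so the strict
case is included. -/

/-- The structure maps `μ`, `η`, `T₂`, `T₀` of a bimonad on the endofunctor `T` (data only; the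
laws are in `BimonadData.IsBimonad`). -/
structure BimonadData (T : C ⥤ C) where
  mul : ∀ X : C, T.obj (T.obj X) ⟶ T.obj X
  unit : ∀ X : C, X ⟶ T.obj X
  comul : ∀ X Y : C, T.obj (X ⊗ Y) ⟶ T.obj X ⊗ T.obj Y
  counit : T.obj (𝟙_ C) ⟶ 𝟙_ C

namespace BimonadData

variable {T : C ⥤ C} (B : BimonadData T)

/-- `T` with the given structure maps is a bimonad: `(T, μ, η)` is a monad, `(T, T₂, T₀)` is a
comonoidal functor, and `μ`, `η` are comonoidal natural transformations. -/
structure IsBimonad : Prop where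
  mul_naturality : ∀ {X Y : C} (f : X ⟶ Y),
    T.map (T.map f) ≫ B.mul Y = B.mul X ≫ T.map f
  unit_naturality : ∀ {X Y : C} (f : X ⟶ Y), f ≫ B.unit Y = B.unit X ≫ T.map f
  comul_naturality : ∀ {X X' Y Y' : C} (f : X ⟶ X') (g : Y ⟶ Y'),
    T.map (f ⊗ₘ g) ≫ B.comul X' Y' = B.comul X Y ≫ (T.map f ⊗ₘ T.map g)
  mul_assoc : ∀ X : C, T.map (B.mul X) ≫ B.mul X = B.mul (T.obj X) ≫ B.mul X
  unit_mul : ∀ X : C, B.unit (T.obj X) ≫ B.mul X = 𝟙 (T.obj X)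
  map_unit_mul : ∀ X : C, T.map (B.unit X) ≫ B.mul X = 𝟙 (T.obj X)
  coassoc : ∀ X Y Z : C,
    B.comul (X ⊗ Y) Z ≫ (B.comul X Y ▷ T.obj Z) ≫ (α_ (T.obj X) (T.obj Y) (T.obj Z)).hom =
      T.map (α_ X Y Z).hom ≫ B.comul X (Y ⊗ Z) ≫ (T.obj X ◁ B.comul Y Z)
  counit_comul : ∀ X : C,
    B.comul (𝟙_ C) X ≫ (B.counit ▷ T.obj X) ≫ (λ_ (T.obj X)).hom = T.map (λ_ X).hom
  comul_counit : ∀ X : C,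
    B.comul X (𝟙_ C) ≫ (T.obj X ◁ B.counit) ≫ (ρ_ (T.obj X)).hom = T.map (ρ_ X).hom
  mul_comul : ∀ X Y : C,
    B.mul (X ⊗ Y) ≫ B.comul X Y =
      T.map (B.comul X Y) ≫ B.comul (T.obj X) (T.obj Y) ≫ (B.mul X ⊗ₘ B.mul Y)
  mul_counit : B.mul (𝟙_ C) ≫ B.counit = T.map B.counit ≫ B.counit
  unit_comul : ∀ X Y : C, B.unit (X ⊗ Y) ≫ B.comul X Y = B.unit X ⊗ₘ B.unit Y
  unit_counit : B.unit (𝟙_ C) ≫ B.counit = 𝟙 (𝟙_ C)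

/-- Left antipode. In Mathlib `Xᘁ` comes with `ε_ X Xᘁ : Xᘁ ⊗ X ⟶ 𝟙_ C` and
`η_ X Xᘁ : 𝟙_ C ⟶ X ⊗ Xᘁ`, and `fᘁ` is the transpose of `f`; this is the dual usually called the
left dual `ᵛX` in the theory of Hopf monads. -/
structure IsLeftAntipode [RightRigidCategory C]
    (s : ∀ X : C, T.obj ((T.obj X)ᘁ) ⟶ Xᘁ) : Prop where
  naturality : ∀ {X Y : C} (f : X ⟶ Y), T.map ((T.map f)ᘁ) ≫ s X = s Y ≫ fᘁ
  evaluation : ∀ X : C,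
    T.map (((B.unit X)ᘁ ▷ X) ≫ ε_ X (Xᘁ)) ≫ B.counit =
      B.comul ((T.obj X)ᘁ) X ≫
        ((T.map ((B.mul X)ᘁ) ≫ s (T.obj X)) ▷ T.obj X) ≫ ε_ (T.obj X) ((T.obj X)ᘁ)
  coevaluation : ∀ X : C,
    B.counit ≫ η_ X (Xᘁ) ≫ (B.unit X ▷ Xᘁ) =
      T.map (η_ (T.obj X) ((T.obj X)ᘁ)) ≫ B.comul (T.obj X) ((T.obj X)ᘁ) ≫ (B.mul X ⊗ₘ s X)

/-- Right antipode. In Mathlib `ᘁX` comes with `ε_ ᘁX X : X ⊗ ᘁX ⟶ 𝟙_ C` and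
`η_ ᘁX X : 𝟙_ C ⟶ ᘁX ⊗ X`; this is the dual usually called the right dual `Xᵛ` in the theory of
Hopf monads. -/
structure IsRightAntipode [LeftRigidCategory C]
    (s : ∀ X : C, T.obj (ᘁ(T.obj X)) ⟶ ᘁX) : Prop where
  naturality : ∀ {X Y : C} (f : X ⟶ Y), T.map (ᘁ(T.map f)) ≫ s X = s Y ≫ (ᘁf)
  evaluation : ∀ X : C,
    T.map ((X ◁ (ᘁ(B.unit X))) ≫ ε_ (ᘁX) X) ≫ B.counit =
      B.comul X (ᘁ(T.obj X)) ≫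
        (T.obj X ◁ (T.map (ᘁ(B.mul X)) ≫ s (T.obj X))) ≫ ε_ (ᘁ(T.obj X)) (T.obj X)
  coevaluation : ∀ X : C,
    B.counit ≫ η_ (ᘁX) X ≫ ((ᘁX) ◁ B.unit X) =
      T.map (η_ (ᘁ(T.obj X)) (T.obj X)) ≫ B.comul (ᘁ(T.obj X)) (T.obj X) ≫ (s X ⊗ₘ B.mul X)

/-- A Hopf monad on an autonomous (rigid) category: a bimonad which has a left antipode and a right
antipode. -/
structure IsHopfMonad [RigidCategory C] : Prop where
  isBimonad : B.IsBimonad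
  exists_leftAntipode : ∃ s : ∀ X : C, T.obj ((T.obj X)ᘁ) ⟶ Xᘁ, B.IsLeftAntipode s
  exists_rightAntipode : ∃ s : ∀ X : C, T.obj (ᘁ(T.obj X)) ⟶ ᘁX, B.IsRightAntipode s

/-- `R` is an R-matrix for `T`: a natural family `R_{X,Y} : X ⊗ Y ⟶ T(Y) ⊗ T(X)` satisfying the
usual axioms. -/
structure IsRMatrix (R : ∀ X Y : C, X ⊗ Y ⟶ T.obj Y ⊗ T.obj X) : Prop where
  naturality : ∀ {X X' Y Y' : C} (f : X ⟶ X') (g : Y ⟶ Y'),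
    (f ⊗ₘ g) ≫ R X' Y' = R X Y ≫ (T.map g ⊗ₘ T.map f)
  linear : ∀ X Y : C,
    B.comul X Y ≫ R (T.obj X) (T.obj Y) ≫ (B.mul Y ⊗ₘ B.mul X) =
      T.map (R X Y) ≫ B.comul (T.obj Y) (T.obj X) ≫ (B.mul Y ⊗ₘ B.mul X)
  tensor_left : ∀ X Y Z : C,
    R (X ⊗ Y) Z ≫ (T.obj Z ◁ B.comul X Y) =
      (α_ X Y Z).hom ≫ (X ◁ R Y Z) ≫ (α_ X (T.obj Z) (T.obj Y)).inv ≫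
        (R X (T.obj Z) ▷ T.obj Y) ≫ (α_ (T.obj (T.obj Z)) (T.obj X) (T.obj Y)).hom ≫
        (B.mul Z ▷ (T.obj X ⊗ T.obj Y))
  tensor_right : ∀ X Y Z : C,
    R X (Y ⊗ Z) ≫ (B.comul Y Z ▷ T.obj X) =
      (α_ X Y Z).inv ≫ (R X Y ▷ Z) ≫ (α_ (T.obj Y) (T.obj X) Z).hom ≫
        (T.obj Y ◁ R (T.obj X) Z) ≫ (α_ (T.obj Y) (T.obj Z) (T.obj (T.obj X))).inv ≫
        ((T.obj Y ⊗ T.obj Z) ◁ B.mul X)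
  unit_left : ∀ X : C,
    (λ_ X).inv ≫ R (𝟙_ C) X ≫ (T.obj X ◁ B.counit) ≫ (ρ_ (T.obj X)).hom = B.unit X
  unit_right : ∀ X : C,
    (ρ_ X).inv ≫ R X (𝟙_ C) ≫ (B.counit ▷ T.obj X) ≫ (λ_ (T.obj X)).hom = B.unit X

end BimonadData
end Structures

/-! Helper facts: a Hopf monad has a right adjoint. They are used only to see that the image under
`T` of a universal dinatural transformation is universal, so that the canonical distributive law is
well defined. -/

section Mates
variable {C : Type u} [Category.{v} C] [MonoidalCategory C]

/-- `f` and `k` are in duality with respect to two exact pairings. -/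
def IsMate {M N M' N' : C} [ExactPairing M N] [ExactPairing M' N'] (f : M ⟶ M') (k : N' ⟶ N) :
    Prop :=
  k ▷ M ≫ ε_ M N = N' ◁ f ≫ ε_ M' N'

theorem isMate_comp {M N M' N' M'' N'' : C} [ExactPairing M N] [ExactPairing M' N']
    [ExactPairing M'' N''] {f : M ⟶ M'} {k : N' ⟶ N} {f' : M' ⟶ M''} {k' : N'' ⟶ N'}
    (h : IsMate f k) (h' : IsMate f' k') : IsMate (f ≫ f') (k' ≫ k) := by
  unfold IsMate at *
  rw [comp_whiskerRight, Category.assoc, h, ← whisker_exchange_assoc, h']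
  simp

theorem isMate_down {M N M' N' : C} [ExactPairing M N] [ExactPairing M' N'] {f : M ⟶ M'}
    {k : N' ⟶ N} (h : IsMate f k) :
    N' ◁ η_ M N ≫ (α_ _ _ _).inv ≫ (N' ◁ f ≫ ε_ M' N') ▷ N = (ρ_ N').hom ≫ k ≫ (λ_ N).inv := by
  rw [← h]
  calc _ = 𝟙 _ ⊗≫ (N' ◁ η_ M N ≫ k ▷ (M ⊗ N)) ⊗≫ ε_ M N ▷ N := by monoidal
    _ = 𝟙 _ ⊗≫ k ⊗≫ (N ◁ η_ M N ⊗≫ ε_ M N ▷ N) := by rw [whisker_exchange]; monoidal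
    _ = _ := by rw [ExactPairing.coevaluation_evaluation'']; monoidal

theorem isMate_up {M N M' N' : C} [ExactPairing M N] [ExactPairing M' N'] {f : M ⟶ M'}
    {k : N' ⟶ N} (h : IsMate f k) :
    η_ M' N' ▷ M ≫ (α_ _ _ _).hom ≫ M' ◁ (k ▷ M ≫ ε_ M N) = (λ_ M).hom ≫ f ≫ (ρ_ M').inv := by
  rw [h]
  calc _ = 𝟙 _ ⊗≫ (η_ M' N' ▷ M ≫ (M' ⊗ N') ◁ f) ⊗≫ M' ◁ ε_ M' N' := by monoidal
    _ = 𝟙 _ ⊗≫ f ⊗≫ (η_ M' N' ▷ M' ⊗≫ M' ◁ ε_ M' N') := by rw [← whisker_exchange]; monoidal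
    _ = _ := by rw [ExactPairing.evaluation_coevaluation'']; monoidal

theorem isMate_ext_left {M N M' N' : C} [ExactPairing M N] [ExactPairing M' N'] {f f' : M ⟶ M'}
    {k : N' ⟶ N} (h : IsMate f k) (h' : IsMate f' k) : f = f' := by
  have := (isMate_up h).symm.trans (isMate_up h')
  simpa using this

theorem isMate_ext_right {M N M' N' : C} [ExactPairing M N] [ExactPairing M' N'] {f : M ⟶ M'}
    {k k' : N' ⟶ N} (h : IsMate f k) (h' : IsMate f k') : k = k' := by
  have := (isMate_down h).symm.trans (isMate_down h')
  simpa using this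

theorem exists_isMate_left {M N M' N' : C} [ExactPairing M N] [ExactPairing M' N'] (k : N' ⟶ N) :
    ∃ f : M ⟶ M', IsMate f k := by
  refine ⟨(λ_ M).inv ≫ η_ M' N' ▷ M ≫ (α_ _ _ _).hom ≫ M' ◁ (k ▷ M ≫ ε_ M N) ≫ (ρ_ M').hom, ?_⟩
  unfold IsMate
  symm
  calc _ = 𝟙 _ ⊗≫ N' ◁ η_ M' N' ▷ M ⊗≫ ((N' ⊗ M') ◁ (k ▷ M ≫ ε_ M N) ≫ ε_ M' N' ▷ 𝟙_ C)
            ⊗≫ 𝟙 _ := by monoidal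
    _ = 𝟙 _ ⊗≫ (N' ◁ η_ M' N' ⊗≫ ε_ M' N' ▷ N') ▷ M ⊗≫ (k ▷ M ≫ ε_ M N) ⊗≫ 𝟙 _ := by
      rw [whisker_exchange]; monoidal
    _ = _ := by rw [ExactPairing.coevaluation_evaluation'']; monoidal

theorem exists_isMate_right {M N M' N' : C} [ExactPairing M N] [ExactPairing M' N'] (f : M ⟶ M') :
    ∃ k : N' ⟶ N, IsMate f k := by
  refine ⟨(ρ_ N').inv ≫ N' ◁ η_ M N ≫ (α_ _ _ _).inv ≫ (N' ◁ f ≫ ε_ M' N') ▷ N ≫ (λ_ N).hom, ?_⟩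
  unfold IsMate
  calc _ = 𝟙 _ ⊗≫ N' ◁ η_ M N ▷ M ⊗≫ ((N' ◁ f ≫ ε_ M' N') ▷ (N ⊗ M) ≫ 𝟙_ C ◁ ε_ M N)
            ⊗≫ 𝟙 _ := by monoidal
    _ = 𝟙 _ ⊗≫ N' ◁ (η_ M N ▷ M ⊗≫ M ◁ ε_ M N) ⊗≫ (N' ◁ f ≫ ε_ M' N') ⊗≫ 𝟙 _ := by
      rw [← whisker_exchange]; monoidal
    _ = _ := by rw [ExactPairing.evaluation_coevaluation'']; monoidal

open Functor.OplaxMonoidal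

variable (G : C ⥤ C) [G.OplaxMonoidal]

/-- The evaluation of the pairing is linear for the actions `r`, `t`. -/
def EvLin {M N : C} [ExactPairing M N] (r : G.obj M ⟶ M) (t : G.obj N ⟶ N) : Prop :=
  G.map (ε_ M N) ≫ η G = δ G N M ≫ (t ⊗ₘ r) ≫ ε_ M N

/-- The coevaluation of the pairing is linear for the actions `r`, `t`. -/
def CoevLin {M N : C} [ExactPairing M N] (r : G.obj M ⟶ M) (t : G.obj N ⟶ N) : Prop :=
  η G ≫ η_ M N = G.map (η_ M N) ≫ δ G M N ≫ (r ⊗ₘ t)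

variable {G}

theorem mate_linear_right {M N M' N' : C} [ExactPairing M N] [ExactPairing M' N'] {f : M ⟶ M'}
    {k : N' ⟶ N} (h : IsMate f k) {r : G.obj M ⟶ M} {t : G.obj N ⟶ N} {r' : G.obj M' ⟶ M'}
    {t' : G.obj N' ⟶ N'} (hc : CoevLin G r t) (he : EvLin G r' t') (hf : G.map f ≫ r' = r ≫ f) :
    G.map k ≫ t = t' ≫ k := by
  have h1 : G.map ((ρ_ N').inv ≫ N' ◁ η_ M N) ≫ δ G N' (M ⊗ N) ≫ G.obj N' ◁ δ G M N ≫
      (t' ⊗ₘ (r ⊗ₘ t)) ≫ (α_ _ _ _).inv ≫ (N' ◁ f ≫ ε_ M' N') ▷ N ≫ (λ_ N).hom = t' ≫ k := by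
    calc _ = G.map (ρ_ N').inv ≫ (G.map (N' ◁ η_ M N) ≫ δ G N' (M ⊗ N)) ≫ G.obj N' ◁ δ G M N ≫
      (G.obj N' ◁ (r ⊗ₘ t)) ≫ t' ▷ _ ≫ (α_ _ _ _).inv ≫ (N' ◁ f ≫ ε_ M' N') ▷ N ≫ (λ_ N).hom := by
          rw [MonoidalCategory.tensorHom_def' t', G.map_comp]; simp only [Category.assoc]
      _ = G.map (ρ_ N').inv ≫ δ G N' (𝟙_ C) ≫ G.obj N' ◁ (G.map (η_ M N) ≫ δ G M N ≫ (r ⊗ₘ t)) ≫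
         t' ▷ _ ≫ (α_ _ _ _).inv ≫ (N' ◁ f ≫ ε_ M' N') ▷ N ≫ (λ_ N).hom := by
          rw [← δ_natural_right]; simp only [Category.assoc, whiskerLeft_comp]
      _ = (ρ_ _).inv ≫ G.obj N' ◁ η_ M N ≫
         t' ▷ _ ≫ (α_ _ _ _).inv ≫ (N' ◁ f ≫ ε_ M' N') ▷ N ≫ (λ_ N).hom := by
          rw [← hc, right_unitality]; simp only [Category.assoc, whiskerLeft_comp]
      _ = (ρ_ _).inv ≫ t' ▷ _ ≫ (N' ◁ η_ M N ≫ (α_ _ _ _).inv ≫ (N' ◁ f ≫ ε_ M' N') ▷ N) ≫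
          (λ_ N).hom := by rw [whisker_exchange_assoc]; simp only [Category.assoc]
      _ = _ := by rw [isMate_down h]; simp
  rw [← h1]
  have h2 : δ G N' (M ⊗ N) ≫ G.obj N' ◁ δ G M N ≫
      (t' ⊗ₘ (r ⊗ₘ t)) ≫ (α_ _ _ _).inv ≫ (N' ◁ f ≫ ε_ M' N') ▷ N ≫ (λ_ N).hom =
      G.map ((α_ _ _ _).inv ≫ (N' ◁ f ≫ ε_ M' N') ▷ N ≫ (λ_ N).hom) ≫ t := by
    calc _ = (δ G N' (M ⊗ N) ≫ G.obj N' ◁ δ G M N ≫ (α_ _ _ _).inv) ≫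
        ((t' ⊗ₘ (r ≫ f)) ≫ ε_ M' N') ▷ G.obj N ≫ (𝟙_ C) ◁ t ≫ (λ_ N).hom := by
          rw [associator_inv_naturality_assoc, MonoidalCategory.tensorHom_def (t' ⊗ₘ r) t]
          simp only [Category.assoc]
          rw [whisker_exchange_assoc, ← comp_whiskerRight_assoc]
          simp [MonoidalCategory.tensorHom_def]
      _ = G.map (α_ _ _ _).inv ≫ δ G (N' ⊗ M) N ≫ (δ G N' M ≫
        ((t' ⊗ₘ (r ≫ f)) ≫ ε_ M' N')) ▷ G.obj N ≫ (λ_ _).hom ≫ t := by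
          rw [associativity_inv]; simp
      _ = G.map (α_ _ _ _).inv ≫ δ G (N' ⊗ M) N ≫ (G.map (N' ◁ f ≫ ε_ M' N') ≫ η G) ▷ G.obj N
            ≫ (λ_ _).hom ≫ t := by
          rw [← hf, G.map_comp, Category.assoc (G.map (N' ◁ f)), he, ← δ_natural_right_assoc]
          simp [MonoidalCategory.tensorHom_def']
      _ = _ := by
          simp only [comp_whiskerRight, G.map_comp, Category.assoc]
          simp
  rw [h2, ← Category.assoc, ← G.map_comp]
  congr 2
  have := isMate_down h
  simp only [comp_whiskerRight, Category.assoc] at this ⊢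
  rw [reassoc_of% this]; simp

theorem mate_linear_left {M N M' N' : C} [ExactPairing M N] [ExactPairing M' N'] {f : M ⟶ M'}
    {k : N' ⟶ N} (h : IsMate f k) {r : G.obj M ⟶ M} {t : G.obj N ⟶ N} {r' : G.obj M' ⟶ M'}
    {t' : G.obj N' ⟶ N'} (he : EvLin G r t) (hc : CoevLin G r' t') (hk : G.map k ≫ t = t' ≫ k) :
    G.map f ≫ r' = r ≫ f := by
  have h1 : G.map ((λ_ M).inv ≫ η_ M' N' ▷ M) ≫ δ G (M' ⊗ N') M ≫ δ G M' N' ▷ G.obj M ≫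
      ((r' ⊗ₘ t') ⊗ₘ r) ≫ (α_ _ _ _).hom ≫ M' ◁ (k ▷ M ≫ ε_ M N) ≫ (ρ_ M').hom = r ≫ f := by
    calc _ = G.map (λ_ M).inv ≫ (G.map (η_ M' N' ▷ M) ≫ δ G (M' ⊗ N') M) ≫ δ G M' N' ▷ G.obj M ≫
      ((r' ⊗ₘ t') ▷ G.obj M) ≫ _ ◁ r ≫ (α_ _ _ _).hom ≫ M' ◁ (k ▷ M ≫ ε_ M N) ≫ (ρ_ M').hom := by
          rw [MonoidalCategory.tensorHom_def _ r, G.map_comp]; simp only [Category.assoc]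
      _ = G.map (λ_ M).inv ≫ δ G (𝟙_ C) M ≫ (G.map (η_ M' N') ≫ δ G M' N' ≫ (r' ⊗ₘ t')) ▷ G.obj M ≫
         _ ◁ r ≫ (α_ _ _ _).hom ≫ M' ◁ (k ▷ M ≫ ε_ M N) ≫ (ρ_ M').hom := by
          rw [← δ_natural_left]; simp only [Category.assoc, comp_whiskerRight]
      _ = (λ_ _).inv ≫ η_ M' N' ▷ G.obj M ≫
         _ ◁ r ≫ (α_ _ _ _).hom ≫ M' ◁ (k ▷ M ≫ ε_ M N) ≫ (ρ_ M').hom := by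
          rw [← hc, left_unitality]; simp only [Category.assoc, comp_whiskerRight]
      _ = (λ_ _).inv ≫ _ ◁ r ≫ (η_ M' N' ▷ M ≫ (α_ _ _ _).hom ≫ M' ◁ (k ▷ M ≫ ε_ M N)) ≫
          (ρ_ M').hom := by rw [← whisker_exchange_assoc]; simp only [Category.assoc]
      _ = _ := by rw [isMate_up h]; simp
  rw [← h1]
  have h2 : δ G (M' ⊗ N') M ≫ δ G M' N' ▷ G.obj M ≫
      ((r' ⊗ₘ t') ⊗ₘ r) ≫ (α_ _ _ _).hom ≫ M' ◁ (k ▷ M ≫ ε_ M N) ≫ (ρ_ M').hom =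
      G.map ((α_ _ _ _).hom ≫ M' ◁ (k ▷ M ≫ ε_ M N) ≫ (ρ_ M').hom) ≫ r' := by
    calc _ = (δ G (M' ⊗ N') M ≫ δ G M' N' ▷ G.obj M ≫ (α_ _ _ _).hom) ≫
        G.obj M' ◁ (((t' ≫ k) ⊗ₘ r) ≫ ε_ M N) ≫ r' ▷ (𝟙_ C) ≫ (ρ_ M').hom := by
          rw [associator_naturality_assoc, MonoidalCategory.tensorHom_def' r' (t' ⊗ₘ r)]
          simp only [Category.assoc]
          rw [← whisker_exchange_assoc, ← whiskerLeft_comp_assoc]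
          simp [MonoidalCategory.tensorHom_def']
      _ = G.map (α_ _ _ _).hom ≫ δ G M' (N' ⊗ M) ≫ G.obj M' ◁ (δ G N' M ≫
        (((t' ≫ k) ⊗ₘ r) ≫ ε_ M N)) ≫ (ρ_ _).hom ≫ r' := by
          rw [associativity]; simp
      _ = G.map (α_ _ _ _).hom ≫ δ G M' (N' ⊗ M) ≫ G.obj M' ◁ (G.map (k ▷ M ≫ ε_ M N) ≫ η G)
            ≫ (ρ_ _).hom ≫ r' := by
          rw [← hk, G.map_comp, Category.assoc (G.map (k ▷ M)), he, ← δ_natural_left_assoc]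
          simp [MonoidalCategory.tensorHom_def]
      _ = _ := by
          simp only [whiskerLeft_comp, G.map_comp, Category.assoc]
          simp
  rw [h2, ← Category.assoc, ← G.map_comp]
  congr 2
  have := isMate_up h
  simp only [whiskerLeft_comp, Category.assoc] at this ⊢
  rw [reassoc_of% this]; simp

end Mates

section Action
variable {C : Type u} [Category.{v} C] [MonoidalCategory C] {T : C ⥤ C} {B : BimonadData T}

open Functor.OplaxMonoidal

/-- The underlying functor of a bimonad is comonoidal. -/
@[reducible] def BimonadData.IsBimonad.oplax (h : B.IsBimonad) : T.OplaxMonoidal where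
  η := B.counit
  δ := B.comul
  δ_natural_left f X := by simpa using (h.comul_naturality f (𝟙 X)).symm
  δ_natural_right X f := by simpa using (h.comul_naturality (𝟙 X) f).symm
  oplax_associativity := h.coassoc
  oplax_left_unitality X := by
    rw [← cancel_mono (λ_ (T.obj X)).hom]
    simp [h.counit_comul, ← T.map_comp]
  oplax_right_unitality X := by
    rw [← cancel_mono (ρ_ (T.obj X)).hom]
    simp [h.comul_counit, ← T.map_comp]

/-- `(M, r)` is a module over the monad `T`. -/
structure BimonadData.IsAction (B : BimonadData T) {M : C} (r : T.obj M ⟶ M) : Prop where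
  assoc : T.map r ≫ r = B.mul M ≫ r
  unit : B.unit M ≫ r = 𝟙 M

theorem BimonadData.IsBimonad.free (h : B.IsBimonad) (X : C) : B.IsAction (B.mul X) :=
  ⟨h.mul_assoc X, h.unit_mul X⟩

theorem evLin_comp [T.OplaxMonoidal] {M N : C} [ExactPairing M N] {r : T.obj M ⟶ M}
    {t : T.obj N ⟶ N} (he : EvLin T r t) : EvLin (T ⋙ T) (T.map r ≫ r) (T.map t ≫ t) := by
  unfold EvLin at *
  simp only [comp_η, comp_δ, Functor.comp_map, Category.assoc]
  rw [← T.map_comp_assoc, he, ← tensorHom_comp_tensorHom]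
  simp only [T.map_comp, Category.assoc]
  rw [he, δ_natural_assoc]

theorem coevLin_comp [T.OplaxMonoidal] {M N : C} [ExactPairing M N] {r : T.obj M ⟶ M}
    {t : T.obj N ⟶ N} (hc : CoevLin T r t) : CoevLin (T ⋙ T) (T.map r ≫ r) (T.map t ≫ t) := by
  unfold CoevLin at *
  simp only [comp_η, comp_δ, Functor.comp_map, Category.assoc]
  rw [hc, ← T.map_comp_assoc, hc, ← tensorHom_comp_tensorHom]
  simp only [T.map_comp, Category.assoc]
  rw [δ_natural_assoc]

theorem evLin_mul (h : B.IsBimonad) {M N : C} [ExactPairing M N] {r : T.obj M ⟶ M}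
    {t : T.obj N ⟶ N} (he : @EvLin _ _ _ T h.oplax _ _ _ r t) :
    letI := h.oplax; EvLin (T ⋙ T) (B.mul M ≫ r) (B.mul N ≫ t) := by
  let _ := h.oplax
  unfold EvLin at *
  have e1 : T.map (δ T N M) ≫ δ T (T.obj N) (T.obj M) ≫ (B.mul N ⊗ₘ B.mul M) =
      B.mul (N ⊗ M) ≫ δ T N M := (h.mul_comul N M).symm
  have e2 : T.map (η T) ≫ η T = B.mul (𝟙_ C) ≫ η T := h.mul_counit.symm
  simp only [comp_η, comp_δ, Functor.comp_map, Category.assoc]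
  rw [e2, reassoc_of% (h.mul_naturality (ε_ M N)), he, ← tensorHom_comp_tensorHom]
  simp only [Category.assoc]
  rw [reassoc_of% e1]

theorem coevLin_mul (h : B.IsBimonad) {M N : C} [ExactPairing M N] {r : T.obj M ⟶ M}
    {t : T.obj N ⟶ N} (hc : @CoevLin _ _ _ T h.oplax _ _ _ r t) :
    letI := h.oplax; CoevLin (T ⋙ T) (B.mul M ≫ r) (B.mul N ≫ t) := by
  let _ := h.oplax
  unfold CoevLin at *
  have e1 : T.map (δ T M N) ≫ δ T (T.obj M) (T.obj N) ≫ (B.mul M ⊗ₘ B.mul N) =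
      B.mul (M ⊗ N) ≫ δ T M N := (h.mul_comul M N).symm
  have e2 : T.map (η T) ≫ η T = B.mul (𝟙_ C) ≫ η T := h.mul_counit.symm
  simp only [comp_η, comp_δ, Functor.comp_map, Category.assoc]
  rw [reassoc_of% e2, hc, ← tensorHom_comp_tensorHom]
  rw [reassoc_of% e1, reassoc_of% (h.mul_naturality (η_ M N))]

theorem evLin_unit (h : B.IsBimonad) {M N : C} [ExactPairing M N] {r : T.obj M ⟶ M}
    {t : T.obj N ⟶ N} (he : @EvLin _ _ _ T h.oplax _ _ _ r t) :
    EvLin (𝟭 C) (B.unit M ≫ r) (B.unit N ≫ t) := by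
  let _ := h.oplax
  unfold EvLin at *
  have e1 : B.unit (N ⊗ M) ≫ δ T N M = (B.unit N ⊗ₘ B.unit M) := h.unit_comul N M
  have e2 : B.unit (𝟙_ C) ≫ η T = 𝟙 _ := h.unit_counit
  simp only [id_η, id_δ, Functor.id_map, Functor.id_obj]
  rw [← tensorHom_comp_tensorHom, ← e1]
  simp only [Category.assoc]
  rw [← he, ← reassoc_of% (h.unit_naturality (ε_ M N)), e2]; simp

theorem coevLin_unit (h : B.IsBimonad) {M N : C} [ExactPairing M N] {r : T.obj M ⟶ M}
    {t : T.obj N ⟶ N} (hc : @CoevLin _ _ _ T h.oplax _ _ _ r t) :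
    CoevLin (𝟭 C) (B.unit M ≫ r) (B.unit N ≫ t) := by
  let _ := h.oplax
  unfold CoevLin at *
  have e1 : B.unit (M ⊗ N) ≫ δ T M N = (B.unit M ⊗ₘ B.unit N) := h.unit_comul M N
  have e2 : B.unit (𝟙_ C) ≫ η T = 𝟙 _ := h.unit_counit
  simp only [id_η, id_δ, Functor.id_map, Functor.id_obj]
  rw [← tensorHom_comp_tensorHom, ← e1]
  simp only [Category.assoc, Category.id_comp]
  rw [reassoc_of% (h.unit_naturality (η_ M N)), ← hc, reassoc_of% e2]

theorem evLin_id {M N : C} [ExactPairing M N] :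
    EvLin (𝟭 C) (𝟙 M) (𝟙 N) := by simp [EvLin]

theorem coevLin_id {M N : C} [ExactPairing M N] :
    CoevLin (𝟭 C) (𝟙 M) (𝟙 N) := by simp [CoevLin]

theorem isMate_id {M N : C} [ExactPairing M N] : IsMate (𝟙 M) (𝟙 N) := by simp [IsMate]

theorem isAction_right (h : B.IsBimonad) {M N : C} [ExactPairing M N] {r : T.obj M ⟶ M}
    {t : T.obj N ⟶ N} (hr : B.IsAction r) (he : @EvLin _ _ _ T h.oplax _ _ _ r t)
    (hc : @CoevLin _ _ _ T h.oplax _ _ _ r t) : B.IsAction t := by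
  let _ := h.oplax
  constructor
  · have := mate_linear_right isMate_id (coevLin_comp hc) (evLin_mul h he) (by simp [hr.assoc])
    simpa using this
  · have := mate_linear_right isMate_id (coevLin_unit h hc) evLin_id (by simp [hr.unit])
    simpa using this

theorem isAction_left (h : B.IsBimonad) {M N : C} [ExactPairing M N] {r : T.obj M ⟶ M}
    {t : T.obj N ⟶ N} (hr : B.IsAction t) (he : @EvLin _ _ _ T h.oplax _ _ _ r t)
    (hc : @CoevLin _ _ _ T h.oplax _ _ _ r t) : B.IsAction r := by
  let _ := h.oplax
  constructor
  · have := mate_linear_left isMate_id (evLin_mul h he) (coevLin_comp hc) (by simp [hr.assoc])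
    simpa using this
  · have := mate_linear_left isMate_id (evLin_unit h he) coevLin_id (by simp [hr.unit])
    simpa using this.symm

theorem rightMate_comp [RightRigidCategory C] {X Y Z : C} (f : X ⟶ Y) (g : Y ⟶ Z) :
    (f ≫ g)ᘁ = gᘁ ≫ fᘁ := CategoryTheory.comp_rightAdjointMate

theorem leftMate_comp [LeftRigidCategory C] {X Y Z : C} (f : X ⟶ Y) (g : Y ⟶ Z) :
    (ᘁ(f ≫ g)) = (ᘁg) ≫ (ᘁf) := CategoryTheory.comp_leftAdjointMate

theorem isMate_right [RightRigidCategory C] {X Y : C} (f : X ⟶ Y) : IsMate f (fᘁ) :=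
  rightAdjointMate_comp_evaluation f

theorem isMate_left [LeftRigidCategory C] {X Y : C} (f : X ⟶ Y) :
    IsMate (M := ᘁY) (N := Y) (M' := ᘁX) (N' := X) (ᘁf) f :=
  (leftAdjointMate_comp_evaluation f).symm

theorem evLin_leftAntipode [RightRigidCategory C] (h : B.IsBimonad)
    {s : ∀ X : C, T.obj ((T.obj X)ᘁ) ⟶ Xᘁ} (hs : B.IsLeftAntipode s) {M : C} {r : T.obj M ⟶ M}
    (hr : B.IsAction r) : @EvLin _ _ _ T h.oplax M (Mᘁ) _ r (T.map (rᘁ) ≫ s M) := by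
  let _ := h.oplax
  change T.map (ε_ M (Mᘁ)) ≫ B.counit =
    B.comul (Mᘁ) M ≫ ((T.map (rᘁ) ≫ s M) ⊗ₘ r) ≫ ε_ M (Mᘁ)
  have e := congrArg (fun x => T.map (rᘁ ▷ M) ≫ x) (hs.evaluation M)
  have e1 : rᘁ ≫ (B.unit M)ᘁ = 𝟙 _ := by rw [← rightMate_comp, hr.unit, rightAdjointMate_id]
  have e2 := h.comul_naturality (rᘁ) (𝟙 M)
  simp only [tensorHom_id, T.map_id] at e2
  have e3 : T.map (rᘁ) ≫ T.map ((B.mul M)ᘁ) ≫ s (T.obj M) = T.map (rᘁ) ≫ s M ≫ rᘁ := by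
    rw [← hs.naturality, ← T.map_comp_assoc, ← T.map_comp_assoc, ← rightMate_comp,
      ← rightMate_comp, hr.assoc]
  rw [← T.map_comp_assoc, ← comp_whiskerRight_assoc, e1, reassoc_of% e2,
    ← comp_whiskerRight_assoc, e3] at e
  simp only [id_whiskerRight, Category.id_comp] at e
  rw [e, ← Category.assoc (T.map (rᘁ)), comp_whiskerRight, Category.assoc,
    rightAdjointMate_comp_evaluation]
  simp [MonoidalCategory.tensorHom_def]

theorem coevLin_leftAntipode [RightRigidCategory C] (h : B.IsBimonad)
    {s : ∀ X : C, T.obj ((T.obj X)ᘁ) ⟶ Xᘁ} (hs : B.IsLeftAntipode s) {M : C} {r : T.obj M ⟶ M}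
    (hr : B.IsAction r) : @CoevLin _ _ _ T h.oplax M (Mᘁ) _ r (T.map (rᘁ) ≫ s M) := by
  let _ := h.oplax
  change B.counit ≫ η_ M (Mᘁ) =
    T.map (η_ M (Mᘁ)) ≫ B.comul M (Mᘁ) ≫ (r ⊗ₘ (T.map (rᘁ) ≫ s M))
  have e := congrArg (fun x => x ≫ (r ▷ Mᘁ)) (hs.coevaluation M)
  simp only [Category.assoc] at e
  rw [← comp_whiskerRight, hr.unit, id_whiskerRight, Category.comp_id, ← tensorHom_id,
    tensorHom_comp_tensorHom, Category.comp_id, ← hr.assoc] at e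
  have e2 := h.comul_naturality r (𝟙 ((T.obj M)ᘁ))
  have e3 := h.comul_naturality (𝟙 M) (rᘁ)
  simp only [T.map_id] at e2 e3
  rw [e, ← Category.id_comp (s M), ← tensorHom_comp_tensorHom, ← reassoc_of% e2,
    ← T.map_comp_assoc, tensorHom_id, ← coevaluation_comp_rightAdjointMate, T.map_comp_assoc,
    ← id_tensorHom, reassoc_of% e3, tensorHom_comp_tensorHom]
  simp

theorem evLin_rightAntipode [LeftRigidCategory C] (h : B.IsBimonad)
    {s : ∀ X : C, T.obj (ᘁ(T.obj X)) ⟶ ᘁX} (hs : B.IsRightAntipode s) {N : C} {t : T.obj N ⟶ N}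
    (ht : B.IsAction t) : @EvLin _ _ _ T h.oplax (ᘁN) N _ (T.map (ᘁt) ≫ s N) t := by
  let _ := h.oplax
  change T.map (ε_ (ᘁN) N) ≫ B.counit =
    B.comul N (ᘁN) ≫ (t ⊗ₘ (T.map (ᘁt) ≫ s N)) ≫ ε_ (ᘁN) N
  have e := congrArg (fun x => T.map (N ◁ (ᘁt)) ≫ x) (hs.evaluation N)
  have e1 : (ᘁt) ≫ (ᘁ(B.unit N)) = 𝟙 _ := by rw [← leftMate_comp, ht.unit, leftAdjointMate_id]
  have e2 := h.comul_naturality (𝟙 N) (ᘁt)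
  simp only [id_tensorHom, T.map_id] at e2
  have e3 : T.map (ᘁt) ≫ T.map (ᘁ(B.mul N)) ≫ s (T.obj N) = T.map (ᘁt) ≫ s N ≫ (ᘁt) := by
    rw [← hs.naturality, ← T.map_comp_assoc, ← T.map_comp_assoc, ← leftMate_comp,
      ← leftMate_comp, ht.assoc]
  rw [← T.map_comp_assoc, ← whiskerLeft_comp_assoc, e1, reassoc_of% e2,
    ← whiskerLeft_comp_assoc, e3] at e
  simp only [whiskerLeft_id, Category.id_comp] at e
  rw [e, ← Category.assoc (T.map (ᘁt)), whiskerLeft_comp, Category.assoc,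
    leftAdjointMate_comp_evaluation]
  simp [MonoidalCategory.tensorHom_def']

theorem coevLin_rightAntipode [LeftRigidCategory C] (h : B.IsBimonad)
    {s : ∀ X : C, T.obj (ᘁ(T.obj X)) ⟶ ᘁX} (hs : B.IsRightAntipode s) {N : C} {t : T.obj N ⟶ N}
    (ht : B.IsAction t) : @CoevLin _ _ _ T h.oplax (ᘁN) N _ (T.map (ᘁt) ≫ s N) t := by
  let _ := h.oplax
  change B.counit ≫ η_ (ᘁN) N =
    T.map (η_ (ᘁN) N) ≫ B.comul (ᘁN) N ≫ ((T.map (ᘁt) ≫ s N) ⊗ₘ t)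
  have e := congrArg (fun x => x ≫ ((ᘁN) ◁ t)) (hs.coevaluation N)
  simp only [Category.assoc] at e
  rw [← whiskerLeft_comp, ht.unit, whiskerLeft_id, Category.comp_id, ← id_tensorHom,
    tensorHom_comp_tensorHom, Category.comp_id, ← ht.assoc] at e
  have e2 := h.comul_naturality (𝟙 (ᘁ(T.obj N))) t
  have e3 := h.comul_naturality (ᘁt) (𝟙 N)
  simp only [T.map_id] at e2 e3
  rw [e, ← Category.id_comp (s N), ← tensorHom_comp_tensorHom, ← reassoc_of% e2,
    ← T.map_comp_assoc, id_tensorHom, ← coevaluation_comp_leftAdjointMate, T.map_comp_assoc,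
    ← tensorHom_id, reassoc_of% e3, tensorHom_comp_tensorHom]
  simp

end Action

section Adjoint
variable {C : Type u} [Category.{v} C] [MonoidalCategory C] [RigidCategory C]
  {T : C ⥤ C} {B : BimonadData T}

theorem existsUnique_rightAntipode (h : B.IsBimonad)
    {sl : ∀ X : C, T.obj ((T.obj X)ᘁ) ⟶ Xᘁ} (hsl : B.IsLeftAntipode sl)
    {sr : ∀ X : C, T.obj (ᘁ(T.obj X)) ⟶ ᘁX} (hsr : B.IsRightAntipode sr)
    {X A : C} (f : T.obj X ⟶ ᘁA) : ∃! g : X ⟶ ᘁ(T.obj A), T.map g ≫ sr A = f := by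
  let _ := h.oplax
  -- the actions on the duals of the free modules on `X` and `A`
  set t : T.obj ((T.obj X)ᘁ) ⟶ (T.obj X)ᘁ := T.map ((B.mul X)ᘁ) ≫ sl (T.obj X) with ht
  set r : T.obj (ᘁ(T.obj A)) ⟶ ᘁ(T.obj A) := T.map (ᘁ(B.mul A)) ≫ sr (T.obj A) with hr
  have te := evLin_leftAntipode h hsl (h.free X)
  have tc := coevLin_leftAntipode h hsl (h.free X)
  have re := evLin_rightAntipode h hsr (h.free A)
  have rc := coevLin_rightAntipode h hsr (h.free A)
  have ta : B.IsAction t := isAction_right h (h.free X) te tc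
  have ra : B.IsAction r := isAction_left h (h.free A) re rc
  have r1 : r ≫ (ᘁ(B.unit A)) = sr A := by
    rw [hr, Category.assoc, ← hsr.naturality, ← T.map_comp_assoc, ← leftMate_comp,
      h.map_unit_mul, leftAdjointMate_id]; simp
  have key (g : X ⟶ ᘁ(T.obj A)) : T.map g ≫ sr A = (T.map g ≫ r) ≫ (ᘁ(B.unit A)) := by
    rw [Category.assoc, r1]
  have lin (g : X ⟶ ᘁ(T.obj A)) : T.map (T.map g ≫ r) ≫ r = B.mul X ≫ T.map g ≫ r := by
    rw [T.map_comp, Category.assoc, ra.assoc, reassoc_of% (h.mul_naturality g)]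
  have un (g : X ⟶ ᘁ(T.obj A)) : B.unit X ≫ T.map g ≫ r = g := by
    rw [← reassoc_of% (h.unit_naturality g), ra.unit, Category.comp_id]
  obtain ⟨k₀, hk₀⟩ := exists_isMate_right (M := T.obj X) (N := (T.obj X)ᘁ) (M' := ᘁA) (N' := A) f
  obtain ⟨l, hl⟩ := exists_isMate_left (M := T.obj X) (N := (T.obj X)ᘁ) (M' := ᘁ(T.obj A))
    (N' := T.obj A) (T.map k₀ ≫ t)
  have hA : IsMate (M := ᘁ(T.obj A)) (N := T.obj A) (M' := ᘁA) (N' := A) (ᘁ(B.unit A))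
    (B.unit A) := isMate_left (B.unit A)
  have klin : T.map (T.map k₀ ≫ t) ≫ t = B.mul A ≫ T.map k₀ ≫ t := by
    rw [T.map_comp, Category.assoc, ta.assoc, reassoc_of% (h.mul_naturality k₀)]
  have llin : T.map l ≫ r = B.mul X ≫ l := mate_linear_left hl te rc klin
  refine ⟨B.unit X ≫ l, ?_, ?_⟩
  · change T.map (B.unit X ≫ l) ≫ sr A = f
    rw [key, T.map_comp, Category.assoc (T.map (B.unit X)), llin,
      reassoc_of% (h.map_unit_mul X)]
    have h1 := isMate_comp hl hA
    rw [← reassoc_of% (h.unit_naturality k₀), ta.unit, Category.comp_id] at h1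
    exact isMate_ext_left h1 hk₀
  · intro g hg
    obtain ⟨k, hk⟩ := exists_isMate_right (M := T.obj X) (N := (T.obj X)ᘁ) (M' := ᘁ(T.obj A))
      (N' := T.obj A) (T.map g ≫ r)
    have h1 := isMate_comp hk hA
    rw [← key, hg] at h1
    have h2 : B.unit A ≫ k = k₀ := isMate_ext_right h1 hk₀
    have h3 : T.map k ≫ t = B.mul A ≫ k := mate_linear_right hk tc re (lin g)
    have h4 : k = T.map k₀ ≫ t := by
      rw [← h2, T.map_comp, Category.assoc, h3, reassoc_of% (h.map_unit_mul A)]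
    rw [← h4] at hl
    rw [isMate_ext_left hl hk, un]

/-- A Hopf monad has a right adjoint (pointwise form). -/
theorem BimonadData.IsHopfMonad.exists_universal (h : B.IsHopfMonad) (W : C) :
    ∃ (R : C) (e : T.obj R ⟶ W), ∀ (X : C) (f : T.obj X ⟶ W), ∃! g : X ⟶ R, T.map g ≫ e = f := by
  obtain ⟨hb, ⟨sl, hsl⟩, sr, hsr⟩ := h
  have key (A : C) (_ : ExactPairing W A) : ∃ (R : C) (e : T.obj R ⟶ W),
      ∀ (X : C) (f : T.obj X ⟶ W), ∃! g : X ⟶ R, T.map g ≫ e = f := by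
    let i : (ᘁA) ≅ W := leftDualIso (Y := A) inferInstance inferInstance
    refine ⟨ᘁ(T.obj A), sr A ≫ i.hom, fun X f => ?_⟩
    obtain ⟨g, hg, hu⟩ := existsUnique_rightAntipode hb hsl hsr (f ≫ i.inv)
    simp only at hg hu
    refine ⟨g, ?_, fun g' hg' => hu g' ?_⟩
    · simp [reassoc_of% hg]
    · simp [← hg']
  exact key (Wᘁ) inferInstance

end Adjoint

section Centralizer
variable {C : Type u} [Category.{v} C] [MonoidalCategory C]

/-- A centralizer of the endofunctor `T`: an endofunctor `Z_T` (the field `functor`) and a natural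
transformation `∂_{X,Y} : X ⊗ Y ⟶ T(Y) ⊗ Z_T(X)` (the field `hb`) such that every natural family
`X ⊗ Y ⟶ T(Y) ⊗ W` factors uniquely through `∂_{X,-}`. -/
structure Centralizer (T : C ⥤ C) where
  functor : C ⥤ C
  hb : ∀ X Y : C, X ⊗ Y ⟶ T.obj Y ⊗ functor.obj X
  hb_naturality : ∀ {X X' Y Y' : C} (f : X ⟶ X') (g : Y ⟶ Y'),
    (f ⊗ₘ g) ≫ hb X' Y' = hb X Y ≫ (T.map g ⊗ₘ functor.map f)
  existsUnique_desc : ∀ (X W : C) (ξ : ∀ Y : C, X ⊗ Y ⟶ T.obj Y ⊗ W),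
    (∀ {Y Y' : C} (g : Y ⟶ Y'), (X ◁ g) ≫ ξ Y' = ξ Y ≫ (T.map g ▷ W)) →
      ∃! r : functor.obj X ⟶ W, ∀ Y : C, hb X Y ≫ (T.obj Y ◁ r) = ξ Y

namespace Centralizer

variable {T : C ⥤ C} (Z : Centralizer T)

theorem hb_naturality_right (X : C) {Y Y' : C} (g : Y ⟶ Y') :
    (X ◁ g) ≫ Z.hb X Y' = Z.hb X Y ≫ (T.map g ▷ Z.functor.obj X) := by
  simpa using Z.hb_naturality (𝟙 X) g

/-- The twofold iterate `∂²_{X,Y₁,Y₂} : X ⊗ Y₁ ⊗ Y₂ ⟶ T(Y₁) ⊗ T(Y₂) ⊗ Z_T²(X)`. -/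
def hb₂ (X Y₁ Y₂ : C) : X ⊗ (Y₁ ⊗ Y₂) ⟶ T.obj Y₁ ⊗ (T.obj Y₂ ⊗ Z.functor.obj (Z.functor.obj X)) :=
  (α_ X Y₁ Y₂).inv ≫ (Z.hb X Y₁ ▷ Y₂) ≫ (α_ (T.obj Y₁) (Z.functor.obj X) Y₂).hom ≫
    (T.obj Y₁ ◁ Z.hb (Z.functor.obj X) Y₂)

theorem existsUnique_desc_tensor [RightRigidCategory C] (X A V : C)
    (ξ : ∀ Y : C, (X ⊗ Y) ⊗ A ⟶ T.obj Y ⊗ V)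
    (hξ : ∀ {Y Y' : C} (g : Y ⟶ Y'), ((X ◁ g) ▷ A) ≫ ξ Y' = ξ Y ≫ (T.map g ▷ V)) :
    ∃! r : Z.functor.obj X ⊗ A ⟶ V, ∀ Y : C,
      (Z.hb X Y ▷ A) ≫ (α_ _ _ _).hom ≫ (T.obj Y ◁ r) = ξ Y := by
  have conv (Y : C) (r : Z.functor.obj X ⊗ A ⟶ V) :
      tensorRightHomEquiv (X ⊗ Y) A Aᘁ (T.obj Y ⊗ V)
        ((Z.hb X Y ▷ A) ≫ (α_ _ _ _).hom ≫ (T.obj Y ◁ r)) ≫ (α_ _ _ _).hom =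
      Z.hb X Y ≫ (T.obj Y ◁ tensorRightHomEquiv (Z.functor.obj X) A Aᘁ V r) := by
    simp only [tensorRightHomEquiv, Equiv.coe_fn_mk]
    calc _ = 𝟙 _ ⊗≫ ((X ⊗ Y) ◁ η_ A Aᘁ ≫ Z.hb X Y ▷ (A ⊗ Aᘁ)) ⊗≫ (T.obj Y ◁ r ▷ Aᘁ) := by monoidal
      _ = _ := by rw [whisker_exchange]; monoidal
  obtain ⟨r, hr, hu⟩ := Z.existsUnique_desc X (V ⊗ Aᘁ)
    (fun Y => tensorRightHomEquiv (X ⊗ Y) A Aᘁ (T.obj Y ⊗ V) (ξ Y) ≫ (α_ _ _ _).hom) (by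
      intro Y Y' g
      have h1 : tensorRightHomEquiv (X ⊗ Y) A Aᘁ _ (((X ◁ g) ▷ A) ≫ ξ Y') =
          (X ◁ g) ≫ tensorRightHomEquiv (X ⊗ Y') A Aᘁ _ (ξ Y') := by
        apply (tensorRightHomEquiv (X ⊗ Y) A Aᘁ _).symm.injective
        rw [tensorRightHomEquiv_symm_naturality]; simp
      rw [← Category.assoc, ← h1, hξ, tensorRightHomEquiv_naturality]
      simp)
  refine ⟨(tensorRightHomEquiv (Z.functor.obj X) A Aᘁ V).symm r, fun Y => ?_, fun r' hr' => ?_⟩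
  · apply (tensorRightHomEquiv (X ⊗ Y) A Aᘁ (T.obj Y ⊗ V)).injective
    rw [← cancel_mono (α_ _ _ _).hom, conv, Equiv.apply_symm_apply, hr]
  · rw [Equiv.eq_symm_apply]
    refine hu _ fun Y => ?_
    rw [← conv, hr']

theorem existsUnique_desc₂ [RightRigidCategory C] (X W : C)
    (ξ : ∀ Y₁ Y₂ : C, X ⊗ (Y₁ ⊗ Y₂) ⟶ T.obj Y₁ ⊗ (T.obj Y₂ ⊗ W))
    (hξ : ∀ {Y₁ Y₁' Y₂ Y₂' : C} (g₁ : Y₁ ⟶ Y₁') (g₂ : Y₂ ⟶ Y₂'),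
      (X ◁ (g₁ ⊗ₘ g₂)) ≫ ξ Y₁' Y₂' = ξ Y₁ Y₂ ≫ (T.map g₁ ⊗ₘ (T.map g₂ ▷ W))) :
    ∃! r : Z.functor.obj (Z.functor.obj X) ⟶ W, ∀ Y₁ Y₂ : C,
      Z.hb₂ X Y₁ Y₂ ≫ (T.obj Y₁ ◁ (T.obj Y₂ ◁ r)) = ξ Y₁ Y₂ := by
  have step (Y₂ : C) := Z.existsUnique_desc_tensor X Y₂ (T.obj Y₂ ⊗ W)
    (fun Y₁ => (α_ X Y₁ Y₂).hom ≫ ξ Y₁ Y₂) (by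
      intro Y Y' g
      have := hξ g (𝟙 Y₂)
      simp only [tensorHom_id, T.map_id, id_whiskerRight] at this
      simp only [whisker_assoc, Category.assoc, Iso.inv_hom_id_assoc, this])
  choose p hp hpu using fun Y₂ => (step Y₂)
  simp only at hp hpu
  obtain ⟨r, hr, hu⟩ := Z.existsUnique_desc (Z.functor.obj X) W p (by
    intro Y Y' g
    refine (Z.existsUnique_desc_tensor X Y (T.obj Y' ⊗ W)
      (fun Y₁ => (α_ X Y₁ Y).hom ≫ (X ◁ (Y₁ ◁ g)) ≫ ξ Y₁ Y') ?_).unique ?_ ?_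
    · intro Y₁ Y₁' f
      have h1 := hξ f (𝟙 Y')
      have h2 := hξ (𝟙 Y₁) g
      simp only [tensorHom_id, T.map_id, id_whiskerRight] at h1
      simp only [Category.assoc, ← h1]
      simp only [← whiskerLeft_comp_assoc, whisker_exchange]
      simp
    · intro Y₁
      have h1 := hp Y' Y₁
      rw [whiskerLeft_comp, ← associator_naturality_right_assoc, ← whisker_exchange_assoc, h1]
      simp
    · intro Y₁
      have h1 := hp Y Y₁
      have h2 := hξ (𝟙 Y₁) g
      simp only [id_tensorHom, T.map_id] at h2
      rw [h2, whiskerLeft_comp, reassoc_of% h1])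
  refine ⟨r, fun Y₁ Y₂ => ?_, fun r' hr' => hu r' fun Y₂ => ?_⟩
  · simp only [hb₂, Category.assoc, ← whiskerLeft_comp, hr, hp]
    simp
  · refine hpu Y₂ _ fun Y₁ => ?_
    rw [← hr']
    simp [hb₂]

section Maps
variable (B : BimonadData T)

theorem existsUnique_mul [RightRigidCategory C] (hB : B.IsBimonad) (X : C) :
    ∃! m : Z.functor.obj (Z.functor.obj X) ⟶ Z.functor.obj X, ∀ Y₁ Y₂ : C,
      Z.hb₂ X Y₁ Y₂ ≫ (T.obj Y₁ ◁ (T.obj Y₂ ◁ m)) =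
        Z.hb X (Y₁ ⊗ Y₂) ≫ (B.comul Y₁ Y₂ ▷ Z.functor.obj X) ≫ (α_ _ _ _).hom := by
  refine Z.existsUnique_desc₂ X (Z.functor.obj X) _ ?_
  intro Y₁ Y₁' Y₂ Y₂' g₁ g₂
  rw [reassoc_of% (Z.hb_naturality_right X (g₁ ⊗ₘ g₂)), ← comp_whiskerRight_assoc,
    hB.comul_naturality, comp_whiskerRight_assoc, ← tensorHom_id (T.map g₁ ⊗ₘ T.map g₂),
    associator_naturality, tensorHom_id]
  simp only [Category.assoc]

theorem existsUnique_comul (hB : B.IsBimonad) (X₁ X₂ : C) :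
    ∃! d : Z.functor.obj (X₁ ⊗ X₂) ⟶ Z.functor.obj X₁ ⊗ Z.functor.obj X₂, ∀ Y : C,
      Z.hb (X₁ ⊗ X₂) Y ≫ (T.obj Y ◁ d) =
        (α_ X₁ X₂ Y).hom ≫ (X₁ ◁ Z.hb X₂ Y) ≫ (α_ X₁ (T.obj Y) (Z.functor.obj X₂)).inv ≫
          (Z.hb X₁ (T.obj Y) ▷ Z.functor.obj X₂) ≫
          ((B.mul Y ▷ Z.functor.obj X₁) ▷ Z.functor.obj X₂) ≫
          (α_ (T.obj Y) (Z.functor.obj X₁) (Z.functor.obj X₂)).hom := by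
  refine Z.existsUnique_desc (X₁ ⊗ X₂) _ _ ?_
  intro Y Y' g
  rw [associator_naturality_right_assoc, ← whiskerLeft_comp_assoc, Z.hb_naturality_right,
    whiskerLeft_comp_assoc, associator_inv_naturality_middle_assoc, ← comp_whiskerRight_assoc,
    Z.hb_naturality_right, comp_whiskerRight_assoc, ← comp_whiskerRight_assoc (T.map (T.map g) ▷ _),
    ← comp_whiskerRight, hB.mul_naturality]
  simp

theorem existsUnique_counit (hB : B.IsBimonad) :
    ∃! e : Z.functor.obj (𝟙_ C) ⟶ 𝟙_ C, ∀ Y : C,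
      Z.hb (𝟙_ C) Y ≫ (T.obj Y ◁ e) = (λ_ Y).hom ≫ B.unit Y ≫ (ρ_ (T.obj Y)).inv := by
  refine Z.existsUnique_desc (𝟙_ C) _ _ ?_
  intro Y Y' g
  simp [reassoc_of% (hB.unit_naturality g)]

end Maps

/-- The structure maps `m`, `u`, `(Z_T)₂`, `(Z_T)₀` of the centralizer of a bimonad, defined by
* `(id ⊗ m) ∂² = (T₂ ⊗ id) ∂_{X, Y₁ ⊗ Y₂}`,
* `u = (T₀ ⊗ id) ∂_{X, 𝟙}`,
* `(id ⊗ (Z_T)₂) ∂_{X₁ ⊗ X₂, Y} = (μ ⊗ id) (∂_{X₁, T(Y)} ⊗ id) (id ⊗ ∂_{X₂, Y})`,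
* `(id ⊗ (Z_T)₀) ∂_{𝟙, Y} = η`.

The existence and uniqueness of `m`, `(Z_T)₂`, `(Z_T)₀` are the three preceding facts. -/
noncomputable def bimonadData [RightRigidCategory C] {B : BimonadData T} (hB : B.IsBimonad) :
    BimonadData Z.functor where
  mul X := (Z.existsUnique_mul B hB X).choose
  unit X := (ρ_ X).inv ≫ Z.hb X (𝟙_ C) ≫ (B.counit ▷ Z.functor.obj X) ≫ (λ_ (Z.functor.obj X)).hom
  comul X₁ X₂ := (Z.existsUnique_comul B hB X₁ X₂).choose
  counit := (Z.existsUnique_counit B hB).choose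

/-- The universal dinatural transformation `i_{X,Y} : ᵛT(Y) ⊗ X ⊗ Y ⟶ Z_T(X)`, obtained from `∂` by
duality: `i = (ev ⊗ id) (id ⊗ ∂)`. -/
def coendι [RightRigidCategory C] (X Y : C) : (T.obj Y)ᘁ ⊗ (X ⊗ Y) ⟶ Z.functor.obj X :=
  ((T.obj Y)ᘁ ◁ Z.hb X Y) ≫ (α_ _ _ _).inv ≫ (ε_ (T.obj Y) ((T.obj Y)ᘁ) ▷ Z.functor.obj X) ≫
    (λ_ (Z.functor.obj X)).hom

theorem coendι_eq [RightRigidCategory C] (X Y : C) :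
    Z.coendι X Y =
      (tensorLeftHomEquiv (X ⊗ Y) (T.obj Y) ((T.obj Y)ᘁ) (Z.functor.obj X)).symm (Z.hb X Y) := rfl

theorem coendι_dinatural [RightRigidCategory C] (X : C) {Y Y' : C} (g : Y ⟶ Y') :
    ((T.map g)ᘁ ▷ (X ⊗ Y)) ≫ Z.coendι X Y = ((T.obj Y')ᘁ ◁ (X ◁ g)) ≫ Z.coendι X Y' := by
  unfold coendι
  rw [← whiskerLeft_comp_assoc, Z.hb_naturality_right, ← whisker_exchange_assoc,
    associator_inv_naturality_left_assoc, ← comp_whiskerRight_assoc,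
    rightAdjointMate_comp_evaluation]
  simp

theorem tensorLeftHomEquiv_symm_whiskerRight [RightRigidCategory C] {A V V' W : C}
    (w : A ⟶ V ⊗ W) (f : V ⟶ V') :
    (tensorLeftHomEquiv A V' (V'ᘁ) W).symm (w ≫ (f ▷ W)) =
      (fᘁ ▷ A) ≫ (tensorLeftHomEquiv A V (Vᘁ) W).symm w := by
  simp only [tensorLeftHomEquiv, Equiv.coe_fn_symm_mk]
  rw [← whisker_exchange_assoc, associator_inv_naturality_left_assoc, ← comp_whiskerRight_assoc,
    rightAdjointMate_comp_evaluation]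
  simp

/-- `i_{X,-}` is a universal dinatural transformation. -/
theorem existsUnique_coendDesc [RightRigidCategory C] (X W : C)
    (j : ∀ Y : C, (T.obj Y)ᘁ ⊗ (X ⊗ Y) ⟶ W)
    (hj : ∀ {Y Y' : C} (g : Y ⟶ Y'),
      ((T.map g)ᘁ ▷ (X ⊗ Y)) ≫ j Y = ((T.obj Y')ᘁ ◁ (X ◁ g)) ≫ j Y') :
    ∃! r : Z.functor.obj X ⟶ W, ∀ Y : C, Z.coendι X Y ≫ r = j Y := by
  have conv (Y : C) (r : Z.functor.obj X ⟶ W) :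
      tensorLeftHomEquiv (X ⊗ Y) (T.obj Y) ((T.obj Y)ᘁ) W (Z.coendι X Y ≫ r) =
        Z.hb X Y ≫ (T.obj Y ◁ r) := by
    rw [tensorLeftHomEquiv_naturality, coendι_eq, Equiv.apply_symm_apply]
  obtain ⟨r, hr, hu⟩ := Z.existsUnique_desc X W
    (fun Y => tensorLeftHomEquiv (X ⊗ Y) (T.obj Y) ((T.obj Y)ᘁ) W (j Y)) (by
      intro Y Y' g
      apply (tensorLeftHomEquiv (X ⊗ Y) (T.obj Y') ((T.obj Y')ᘁ) W).symm.injective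
      rw [tensorLeftHomEquiv_symm_naturality, Equiv.symm_apply_apply, ← hj]
      rw [tensorLeftHomEquiv_symm_whiskerRight, Equiv.symm_apply_apply])
  refine ⟨r, fun Y => ?_, fun r' hr' => hu r' fun Y => ?_⟩
  · apply (tensorLeftHomEquiv (X ⊗ Y) (T.obj Y) ((T.obj Y)ᘁ) W).injective
    rw [conv, hr]
  · rw [← conv, hr']

/-- `T(i_{X,-})` is a universal dinatural transformation. -/
theorem existsUnique_map_coendDesc [RigidCategory C] {B : BimonadData T} (hB : B.IsHopfMonad)
    (X W : C) (j : ∀ Y : C, T.obj ((T.obj Y)ᘁ ⊗ (X ⊗ Y)) ⟶ W)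
    (hj : ∀ {Y Y' : C} (g : Y ⟶ Y'),
      T.map ((T.map g)ᘁ ▷ (X ⊗ Y)) ≫ j Y = T.map ((T.obj Y')ᘁ ◁ (X ◁ g)) ≫ j Y') :
    ∃! r : T.obj (Z.functor.obj X) ⟶ W, ∀ Y : C, T.map (Z.coendι X Y) ≫ r = j Y := by
  obtain ⟨R, e, he⟩ := hB.exists_universal W
  choose a ha hau using fun Y => he _ (j Y)
  simp only at ha hau
  obtain ⟨g, hg, hgu⟩ := Z.existsUnique_coendDesc X R a (by
    intro Y Y' f
    refine (he _ (T.map ((T.obj Y')ᘁ ◁ (X ◁ f)) ≫ j Y')).unique ?_ ?_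
    · rw [T.map_comp, Category.assoc, ha, hj]
    · rw [T.map_comp, Category.assoc, ha])
  refine ⟨T.map g ≫ e, fun Y => ?_, fun r hr => ?_⟩
  · rw [← T.map_comp_assoc, hg, ha]
  · obtain ⟨g', hg', -⟩ := he _ r
    rw [← hg', hgu g' fun Y => hau Y _ ?_]
    rw [T.map_comp, Category.assoc, hg', hr]

end Centralizer
end Centralizer

section Double
variable {C : Type u} [Category.{v} C] [MonoidalCategory C] [RigidCategory C]
  {T : C ⥤ C} {B : BimonadData T}

/-- The left antipode of a Hopf monad (a left antipode is unique). -/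
noncomputable def BimonadData.IsHopfMonad.leftAntipode (hB : B.IsHopfMonad) (X : C) :
    T.obj ((T.obj X)ᘁ) ⟶ Xᘁ :=
  hB.exists_leftAntipode.choose X

namespace Centralizer

theorem existsUnique_canonicalLaw (Z : Centralizer T) (hB : B.IsHopfMonad) (X : C) :
    ∃! ω : T.obj (Z.functor.obj X) ⟶ Z.functor.obj (T.obj X), ∀ Y : C,
      T.map (Z.coendι X Y) ≫ ω =
        B.comul ((T.obj Y)ᘁ) (X ⊗ Y) ≫ (T.obj ((T.obj Y)ᘁ) ◁ B.comul X Y) ≫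
          ((T.map ((B.mul Y)ᘁ) ≫ hB.leftAntipode (T.obj Y) ≫ (B.mul Y)ᘁ) ▷ (T.obj X ⊗ T.obj Y)) ≫
          Z.coendι (T.obj X) (T.obj Y) := by
  refine Z.existsUnique_map_coendDesc hB X _ _ ?_
  intro Y Y' g
  have hs : B.IsLeftAntipode hB.leftAntipode := hB.exists_leftAntipode.choose_spec
  have h1 := hB.isBimonad.comul_naturality ((T.map g)ᘁ) (𝟙 (X ⊗ Y))
  have h2 := hB.isBimonad.comul_naturality (𝟙 ((T.obj Y')ᘁ)) (X ◁ g)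
  have h3 := hB.isBimonad.comul_naturality (𝟙 X) g
  simp only [tensorHom_id, id_tensorHom, T.map_id] at h1 h2 h3
  have h4 : T.map ((T.map g)ᘁ) ≫ T.map ((B.mul Y)ᘁ) ≫ hB.leftAntipode (T.obj Y) ≫ (B.mul Y)ᘁ =
      (T.map ((B.mul Y')ᘁ) ≫ hB.leftAntipode (T.obj Y') ≫ (B.mul Y')ᘁ) ≫ (T.map (T.map g))ᘁ := by
    rw [← T.map_comp_assoc, ← rightMate_comp, ← hB.isBimonad.mul_naturality, rightMate_comp,
      T.map_comp_assoc, reassoc_of% (hs.naturality (T.map g)), ← rightMate_comp,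
      ← hB.isBimonad.mul_naturality, rightMate_comp]
    simp
  rw [reassoc_of% h1, reassoc_of% h2, ← whiskerLeft_comp_assoc, h3, ← whisker_exchange_assoc,
    ← comp_whiskerRight_assoc, h4, comp_whiskerRight_assoc, Z.coendι_dinatural,
    whiskerLeft_comp_assoc]
  simp only [whisker_exchange_assoc]

/-- The canonical distributive law `Ω : T Z_T ⟶ Z_T T`: the unique family with
`Ω_X T(i_{X,Y}) = i_{T(X),T(Y)} (ᵛμ_Y sˡ_{T(Y)} T(ᵛμ_Y) ⊗ id) T₃(ᵛT(Y), X, Y)`. -/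
noncomputable def canonicalLaw (Z : Centralizer T) (hB : B.IsHopfMonad) (X : C) :
    T.obj (Z.functor.obj X) ⟶ Z.functor.obj (T.obj X) :=
  (Z.existsUnique_canonicalLaw hB X).choose

/-- The double `D_T = Z_T ∘_Ω T`: the endofunctor `Z_T T` with
* product `m_{T(X)} Z_T²(μ_X) Z_T(Ω_{T(X)})` and unit `u_{T(X)} η_X`,
* comonoidal structure the composite of those of `Z_T` and `T`. -/
noncomputable def double (Z : Centralizer T) (hB : B.IsHopfMonad) : BimonadData (T ⋙ Z.functor) where
  mul X := Z.functor.map (Z.canonicalLaw hB (T.obj X)) ≫ Z.functor.map (Z.functor.map (B.mul X)) ≫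
    (Z.bimonadData hB.isBimonad).mul (T.obj X)
  unit X := B.unit X ≫ (Z.bimonadData hB.isBimonad).unit (T.obj X)
  comul X Y := Z.functor.map (B.comul X Y) ≫ (Z.bimonadData hB.isBimonad).comul (T.obj X) (T.obj Y)
  counit := Z.functor.map B.counit ≫ (Z.bimonadData hB.isBimonad).counit

end Centralizer
end Double

/-!
Write `F` for the centralizer functor `Z_T`, `∂` for its universal family, and let all compositions
be read from left to right.

*The centralizer.* A morphism out of `F(X)`, or out of `F(X) ⊗ A` since `A` has a dual, is
determined by its composites with `∂_{X,Y}` (`hom_ext`, `hom_ext_tensor`). Every axiom of a bimonad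
for `F` thus becomes an identity of families in which the structure maps of `F` may be replaced by their
definitions, and there it is an axiom of the bimonad `T` (`isBimonad_bimonadData`).

*The distributive law.* Since `T` is a Hopf monad it has a right adjoint, and the pairing of `T(Y)`
with its dual is `T`-linear. Hence a morphism `f` out of `T(F(X))` is determined by the composites
of `T(∂_{X,Y})`, `T₂` and `μ_Y ⊗ f` (`law_hom_ext`), and the dual pairing can be removed from the
definition of the canonical law `Ω`, which leaves
`T(∂_{X,Y}) T₂ (μ_Y ⊗ Ω_X) = T₂ ∂_{T(X),T(Y)} (μ_Y ⊗ id)` (`hb_law`).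
All axioms of a comonoidal distributive law follow from this identity, and the composite of two
bimonads along such a law is a bimonad (`isBimonad_composite`).

*Antipodes.* A bimonad has antipodes as soon as the duals of its free modules carry structure maps
for which the pairings are linear (`exists_isLeftAntipode`, `exists_isRightAntipode`). A free module
of the double is a `T`-module and an `F`-module, so structure maps for `T` and for `F` suffice. For
`T` they come from the antipodes of `T`. An action `b` of `F` on `M` is a half braiding
`σ_Y : M ⊗ Y ⟶ T(Y) ⊗ M`, and induces morphisms `c : M ⊗ P ⟶ P ⊗ M` for `T`-modules `P`. The
compatibility of `c` with linear pairings shows that `c` is invertible for free `P`, because the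
dual of a `T`-module is again a `T`-module. Rotating `c` or its inverse moves a dual `N` of `M` past
`P`, and this defines the structure map of `N` (`exists_linear_right`, `exists_linear_left`).

*The R-matrix.* The axioms reduce to the definitions of the product and coproduct of `F`; linearity
uses `hb_law` in addition (`comul_hb_mul`).
-/

/-! ### Morphisms out of the centralizer -/

section CentralizerStructure
variable {C : Type u} [Category.{v} C] [MonoidalCategory C] {T : C ⥤ C} (Z : Centralizer T)

namespace Centralizer

theorem hb_naturality_left {X X' : C} (f : X ⟶ X') (Y : C) :
    f ▷ Y ≫ Z.hb X' Y = Z.hb X Y ≫ T.obj Y ◁ Z.functor.map f := by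
  simpa using Z.hb_naturality f (𝟙 Y)

/-- The uniqueness part of the universal property of `∂_{X,-}`. -/
theorem hom_ext {X W : C} {r r' : Z.functor.obj X ⟶ W}
    (h : ∀ Y, Z.hb X Y ≫ T.obj Y ◁ r = Z.hb X Y ≫ T.obj Y ◁ r') : r = r' := by
  refine (Z.existsUnique_desc X W (fun Y => Z.hb X Y ≫ T.obj Y ◁ r) fun g => ?_).unique
    (fun _ => rfl) fun Y => (h Y).symm
  rw [reassoc_of% (Z.hb_naturality_right X g), ← whisker_exchange, Category.assoc]

/-- The universal property of `∂_{X,-}` persists after tensoring with `A` on the right, because `A`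
has a dual. -/
theorem hom_ext_tensor [RightRigidCategory C] {X A W : C} {r r' : Z.functor.obj X ⊗ A ⟶ W}
    (h : ∀ Y, Z.hb X Y ▷ A ⊗≫ T.obj Y ◁ r = Z.hb X Y ▷ A ⊗≫ T.obj Y ◁ r') : r = r' := by
  refine (Z.existsUnique_desc_tensor X A W (fun Y => Z.hb X Y ▷ A ⊗≫ T.obj Y ◁ r)
    fun {Y Y'} g => ?_).unique (fun Y => ?_) fun Y => ?_
  · calc _ = (X ◁ g ≫ Z.hb X Y') ▷ A ⊗≫ T.obj Y' ◁ r := by monoidal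
      _ = Z.hb X Y ▷ A ⊗≫ (T.map g ▷ (Z.functor.obj X ⊗ A) ≫ T.obj Y' ◁ r) := by
        rw [hb_naturality_right]; monoidal
      _ = _ := by rw [← whisker_exchange]; monoidal
  · monoidal
  · rw [h]; monoidal

theorem hom_ext_two [RightRigidCategory C] {X W : C} {r r' : Z.functor.obj (Z.functor.obj X) ⟶ W}
    (h : ∀ Y₁ Y₂, Z.hb X Y₁ ▷ Y₂ ⊗≫ T.obj Y₁ ◁ Z.hb (Z.functor.obj X) Y₂ ⊗≫
        (T.obj Y₁ ⊗ T.obj Y₂) ◁ r =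
      Z.hb X Y₁ ▷ Y₂ ⊗≫ T.obj Y₁ ◁ Z.hb (Z.functor.obj X) Y₂ ⊗≫
        (T.obj Y₁ ⊗ T.obj Y₂) ◁ r') : r = r' := by
  refine Z.hom_ext fun Y₂ => Z.hom_ext_tensor fun Y₁ => ?_
  rw [← cancel_mono (α_ (T.obj Y₁) (T.obj Y₂) W).inv]
  refine Eq.trans ?_ ((h Y₁ Y₂).trans ?_) <;> monoidal

theorem hom_ext_three [RightRigidCategory C] {X W : C}
    {r r' : Z.functor.obj (Z.functor.obj (Z.functor.obj X)) ⟶ W}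
    (h : ∀ Y₁ Y₂ Y₃, Z.hb X Y₁ ▷ (Y₂ ⊗ Y₃) ⊗≫ T.obj Y₁ ◁ Z.hb (Z.functor.obj X) Y₂ ▷ Y₃ ⊗≫
        (T.obj Y₁ ⊗ T.obj Y₂) ◁ Z.hb (Z.functor.obj (Z.functor.obj X)) Y₃ ⊗≫
        (T.obj Y₁ ⊗ T.obj Y₂ ⊗ T.obj Y₃) ◁ r =
      Z.hb X Y₁ ▷ (Y₂ ⊗ Y₃) ⊗≫ T.obj Y₁ ◁ Z.hb (Z.functor.obj X) Y₂ ▷ Y₃ ⊗≫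
        (T.obj Y₁ ⊗ T.obj Y₂) ◁ Z.hb (Z.functor.obj (Z.functor.obj X)) Y₃ ⊗≫
        (T.obj Y₁ ⊗ T.obj Y₂ ⊗ T.obj Y₃) ◁ r') : r = r' := by
  refine Z.hom_ext_two fun Y₂ Y₃ => ?_
  rw [← cancel_epi (α_ (Z.functor.obj X) Y₂ Y₃).inv]
  refine Z.hom_ext_tensor fun Y₁ => ?_
  rw [← cancel_mono (T.obj Y₁ ◁ (α_ (T.obj Y₂) (T.obj Y₃) W).hom)]
  rw [← cancel_epi (α_ (X ⊗ Y₁) Y₂ Y₃).hom]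
  have := congrArg (fun x => (α_ (X ⊗ Y₁) Y₂ Y₃).hom ≫ x ⊗≫
    𝟙 (T.obj Y₁ ⊗ T.obj Y₂ ⊗ T.obj Y₃ ⊗ W)) (h Y₁ Y₂ Y₃)
  refine Eq.trans ?_ (this.trans ?_) <;> monoidal

variable {B : BimonadData T} (hB : B.IsBimonad)

/-- The equation defining the product of the centralizer. -/
theorem hb_mul [RightRigidCategory C] (X Y₁ Y₂ : C) :
    Z.hb X Y₁ ▷ Y₂ ⊗≫ T.obj Y₁ ◁ Z.hb (Z.functor.obj X) Y₂ ⊗≫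
        (T.obj Y₁ ⊗ T.obj Y₂) ◁ (Z.bimonadData hB).mul X =
      𝟙 _ ⊗≫ Z.hb X (Y₁ ⊗ Y₂) ⊗≫ B.comul Y₁ Y₂ ▷ Z.functor.obj X := by
  have h := (Z.existsUnique_mul B hB X).choose_spec.1 Y₁ Y₂
  rw [← cancel_epi (α_ X Y₁ Y₂).hom, ← cancel_mono (α_ (T.obj Y₁) (T.obj Y₂) _).inv] at h
  refine Eq.trans ?_ (h.trans ?_)
  · dsimp only [hb₂, bimonadData]; monoidal
  · monoidal

/-- The equation defining the coproduct of the centralizer. -/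
theorem hb_comul [RightRigidCategory C] (X₁ X₂ Y : C) :
    Z.hb (X₁ ⊗ X₂) Y ⊗≫ T.obj Y ◁ (Z.bimonadData hB).comul X₁ X₂ =
      𝟙 _ ⊗≫ X₁ ◁ Z.hb X₂ Y ⊗≫ Z.hb X₁ (T.obj Y) ▷ Z.functor.obj X₂ ⊗≫
        B.mul Y ▷ (Z.functor.obj X₁ ⊗ Z.functor.obj X₂) := by
  have h := (Z.existsUnique_comul B hB X₁ X₂).choose_spec.1 Y
  refine Eq.trans ?_ (h.trans ?_)
  · dsimp only [bimonadData]; monoidal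
  · monoidal

/-- The equation defining the counit of the centralizer. -/
theorem hb_counit [RightRigidCategory C] (Y : C) :
    Z.hb (𝟙_ C) Y ⊗≫ T.obj Y ◁ (Z.bimonadData hB).counit = 𝟙 _ ⊗≫ B.unit Y ⊗≫ 𝟙 _ := by
  have h := (Z.existsUnique_counit B hB).choose_spec.1 Y
  refine Eq.trans ?_ (h.trans ?_)
  · dsimp only [bimonadData]; monoidal
  · monoidal

theorem unit_eq [RightRigidCategory C] (X : C) :
    (Z.bimonadData hB).unit X =
      𝟙 _ ⊗≫ Z.hb X (𝟙_ C) ⊗≫ B.counit ▷ Z.functor.obj X ⊗≫ 𝟙 _ := by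
  dsimp only [bimonadData]; monoidal

end Centralizer
end CentralizerStructure

/-! ### The centralizer of a bimonad is a bimonad -/

section CentralizerBimonad
variable {C : Type u} [Category.{v} C] [MonoidalCategory C] {T : C ⥤ C}

namespace BimonadData.IsBimonad
variable {B : BimonadData T} (hB : B.IsBimonad)
include hB

theorem comul_naturality_left {X X' : C} (f : X ⟶ X') (Y : C) :
    T.map (f ▷ Y) ≫ B.comul X' Y = B.comul X Y ≫ T.map f ▷ T.obj Y := by
  simpa using hB.comul_naturality f (𝟙 Y)

theorem comul_naturality_right (X : C) {Y Y' : C} (g : Y ⟶ Y') :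
    T.map (X ◁ g) ≫ B.comul X Y' = B.comul X Y ≫ T.obj X ◁ T.map g := by
  simpa using hB.comul_naturality (𝟙 X) g

end BimonadData.IsBimonad

namespace Centralizer
variable [RightRigidCategory C] {B : BimonadData T} (hB : B.IsBimonad) (Z : Centralizer T)

local notation "F" => Centralizer.functor Z
local notation "ZB" => Centralizer.bimonadData Z hB

theorem mul_naturality {X Y : C} (f : X ⟶ Y) :
    (F).map ((F).map f) ≫ (ZB).mul Y = (ZB).mul X ≫ (F).map f := by
  refine Z.hom_ext_two fun Y₁ Y₂ => ?_
  calc _ = 𝟙 _ ⊗≫ Z.hb X Y₁ ▷ Y₂ ⊗≫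
        T.obj Y₁ ◁ (Z.hb ((F).obj X) Y₂ ≫ T.obj Y₂ ◁ (F).map ((F).map f)) ⊗≫
        (T.obj Y₁ ⊗ T.obj Y₂) ◁ (ZB).mul Y := by monoidal
    _ = 𝟙 _ ⊗≫ (Z.hb X Y₁ ≫ T.obj Y₁ ◁ (F).map f) ▷ Y₂ ⊗≫
        T.obj Y₁ ◁ Z.hb ((F).obj Y) Y₂ ⊗≫ (T.obj Y₁ ⊗ T.obj Y₂) ◁ (ZB).mul Y := by
      rw [← hb_naturality_left]; monoidal
    _ = 𝟙 _ ⊗≫ f ▷ Y₁ ▷ Y₂ ⊗≫ (Z.hb Y Y₁ ▷ Y₂ ⊗≫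
        T.obj Y₁ ◁ Z.hb ((F).obj Y) Y₂ ⊗≫ (T.obj Y₁ ⊗ T.obj Y₂) ◁ (ZB).mul Y) := by
      rw [← hb_naturality_left]; monoidal
    _ = 𝟙 _ ⊗≫ (f ▷ (Y₁ ⊗ Y₂) ≫ Z.hb Y (Y₁ ⊗ Y₂)) ⊗≫ B.comul Y₁ Y₂ ▷ (F).obj Y := by
      rw [hb_mul]; monoidal
    _ = 𝟙 _ ⊗≫ Z.hb X (Y₁ ⊗ Y₂) ⊗≫
        (T.obj (Y₁ ⊗ Y₂) ◁ (F).map f ≫ B.comul Y₁ Y₂ ▷ (F).obj Y) := by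
      rw [hb_naturality_left]; monoidal
    _ = (𝟙 _ ⊗≫ Z.hb X (Y₁ ⊗ Y₂) ⊗≫ B.comul Y₁ Y₂ ▷ (F).obj X) ⊗≫
        (T.obj Y₁ ⊗ T.obj Y₂) ◁ (F).map f := by
      rw [whisker_exchange]; monoidal
    _ = _ := by rw [← Z.hb_mul hB]; monoidal

theorem unit_naturality {X Y : C} (f : X ⟶ Y) :
    f ≫ (ZB).unit Y = (ZB).unit X ≫ (F).map f := by
  rw [unit_eq, unit_eq]
  calc _ = 𝟙 _ ⊗≫ (f ▷ 𝟙_ C ≫ Z.hb Y (𝟙_ C)) ⊗≫ B.counit ▷ (F).obj Y ⊗≫ 𝟙 _ := by monoidal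
    _ = 𝟙 _ ⊗≫ Z.hb X (𝟙_ C) ⊗≫
        (T.obj (𝟙_ C) ◁ (F).map f ≫ B.counit ▷ (F).obj Y) ⊗≫ 𝟙 _ := by
      rw [hb_naturality_left]; monoidal
    _ = _ := by rw [whisker_exchange]; monoidal

theorem comul_naturality {X X' Y Y' : C} (f : X ⟶ X') (g : Y ⟶ Y') :
    (F).map (f ⊗ₘ g) ≫ (ZB).comul X' Y' = (ZB).comul X Y ≫ ((F).map f ⊗ₘ (F).map g) := by
  refine Z.hom_ext fun V => ?_
  simp only [MonoidalCategory.tensorHom_def]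
  calc _ = 𝟙 _ ⊗≫ (Z.hb (X ⊗ Y) V ≫ T.obj V ◁ (F).map (f ▷ Y ≫ X' ◁ g)) ⊗≫
        T.obj V ◁ (ZB).comul X' Y' := by monoidal
    _ = 𝟙 _ ⊗≫ (f ▷ Y ≫ X' ◁ g) ▷ V ⊗≫ (Z.hb (X' ⊗ Y') V ⊗≫ T.obj V ◁ (ZB).comul X' Y') := by
      rw [← hb_naturality_left]; monoidal
    _ = 𝟙 _ ⊗≫ f ▷ (Y ⊗ V) ⊗≫ X' ◁ (g ▷ V ≫ Z.hb Y' V) ⊗≫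
        Z.hb X' (T.obj V) ▷ (F).obj Y' ⊗≫ B.mul V ▷ ((F).obj X' ⊗ (F).obj Y') := by
      rw [hb_comul]; monoidal
    _ = 𝟙 _ ⊗≫ (f ▷ (Y ⊗ V) ≫ X' ◁ Z.hb Y V) ⊗≫ (X' ⊗ T.obj V) ◁ (F).map g ⊗≫
        Z.hb X' (T.obj V) ▷ (F).obj Y' ⊗≫ B.mul V ▷ ((F).obj X' ⊗ (F).obj Y') := by
      rw [hb_naturality_left]; monoidal
    _ = 𝟙 _ ⊗≫ X ◁ Z.hb Y V ⊗≫ f ▷ (T.obj V ⊗ (F).obj Y) ⊗≫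
        ((X' ⊗ T.obj V) ◁ (F).map g ≫
        (Z.hb X' (T.obj V) ⊗≫ B.mul V ▷ (F).obj X') ▷ (F).obj Y') ⊗≫ 𝟙 _ := by
      rw [← whisker_exchange]; monoidal
    _ = 𝟙 _ ⊗≫ X ◁ Z.hb Y V ⊗≫ (f ▷ T.obj V ≫ Z.hb X' (T.obj V)) ▷ (F).obj Y ⊗≫
        (B.mul V ▷ (F).obj X') ▷ (F).obj Y ⊗≫ (T.obj V ⊗ (F).obj X') ◁ (F).map g ⊗≫ 𝟙 _ := by
      rw [whisker_exchange]; monoidal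
    _ = 𝟙 _ ⊗≫ X ◁ Z.hb Y V ⊗≫ Z.hb X (T.obj V) ▷ (F).obj Y ⊗≫
        (T.obj (T.obj V) ◁ (F).map f ≫ B.mul V ▷ (F).obj X') ▷ (F).obj Y ⊗≫
        (T.obj V ⊗ (F).obj X') ◁ (F).map g ⊗≫ 𝟙 _ := by
      rw [hb_naturality_left]; monoidal
    _ = (𝟙 _ ⊗≫ X ◁ Z.hb Y V ⊗≫ Z.hb X (T.obj V) ▷ (F).obj Y ⊗≫
        B.mul V ▷ ((F).obj X ⊗ (F).obj Y)) ⊗≫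
        T.obj V ◁ ((F).map f ▷ (F).obj Y ≫ (F).obj X' ◁ (F).map g) := by
      rw [whisker_exchange]; monoidal
    _ = _ := by rw [← Z.hb_comul hB]; monoidal

/-- Associativity of the product is coassociativity of `T`. -/
theorem mul_assoc (X : C) :
    (F).map ((ZB).mul X) ≫ (ZB).mul X = (ZB).mul ((F).obj X) ≫ (ZB).mul X := by
  refine Z.hom_ext_three fun Y₁ Y₂ Y₃ => ?_
  calc _ = 𝟙 _ ⊗≫ Z.hb X Y₁ ▷ (Y₂ ⊗ Y₃) ⊗≫ T.obj Y₁ ◁ Z.hb ((F).obj X) Y₂ ▷ Y₃ ⊗≫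
        (T.obj Y₁ ⊗ T.obj Y₂) ◁ (Z.hb ((F).obj ((F).obj X)) Y₃ ≫
          T.obj Y₃ ◁ (F).map ((ZB).mul X)) ⊗≫
        (T.obj Y₁ ⊗ T.obj Y₂ ⊗ T.obj Y₃) ◁ (ZB).mul X := by monoidal
    _ = 𝟙 _ ⊗≫ (Z.hb X Y₁ ▷ Y₂ ⊗≫ T.obj Y₁ ◁ Z.hb ((F).obj X) Y₂ ⊗≫
          (T.obj Y₁ ⊗ T.obj Y₂) ◁ (ZB).mul X) ▷ Y₃ ⊗≫
        (T.obj Y₁ ⊗ T.obj Y₂) ◁ Z.hb ((F).obj X) Y₃ ⊗≫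
        (T.obj Y₁ ⊗ T.obj Y₂ ⊗ T.obj Y₃) ◁ (ZB).mul X := by
      rw [← hb_naturality_left]; monoidal
    _ = 𝟙 _ ⊗≫ Z.hb X (Y₁ ⊗ Y₂) ▷ Y₃ ⊗≫ (B.comul Y₁ Y₂ ▷ ((F).obj X ⊗ Y₃) ≫
        (T.obj Y₁ ⊗ T.obj Y₂) ◁ (Z.hb ((F).obj X) Y₃ ⊗≫ T.obj Y₃ ◁ (ZB).mul X)) ⊗≫ 𝟙 _ := by
      rw [hb_mul]; monoidal
    _ = 𝟙 _ ⊗≫ (Z.hb X (Y₁ ⊗ Y₂) ▷ Y₃ ⊗≫ T.obj (Y₁ ⊗ Y₂) ◁ Z.hb ((F).obj X) Y₃ ⊗≫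
        (T.obj (Y₁ ⊗ Y₂) ⊗ T.obj Y₃) ◁ (ZB).mul X) ⊗≫
        B.comul Y₁ Y₂ ▷ (T.obj Y₃ ⊗ (F).obj X) ⊗≫ 𝟙 _ := by
      rw [← whisker_exchange]; monoidal
    _ = 𝟙 _ ⊗≫ Z.hb X ((Y₁ ⊗ Y₂) ⊗ Y₃) ⊗≫ (B.comul (Y₁ ⊗ Y₂) Y₃ ≫ B.comul Y₁ Y₂ ▷ T.obj Y₃ ≫
        (α_ (T.obj Y₁) (T.obj Y₂) (T.obj Y₃)).hom) ▷ (F).obj X := by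
      rw [hb_mul]; monoidal
    _ = 𝟙 _ ⊗≫ (Z.hb X ((Y₁ ⊗ Y₂) ⊗ Y₃) ≫ T.map (α_ Y₁ Y₂ Y₃).hom ▷ (F).obj X) ⊗≫
        (B.comul Y₁ (Y₂ ⊗ Y₃) ≫ T.obj Y₁ ◁ B.comul Y₂ Y₃) ▷ (F).obj X := by
      rw [hB.coassoc]; monoidal
    _ = 𝟙 _ ⊗≫ (𝟙 ((X ⊗ Y₁) ⊗ (Y₂ ⊗ Y₃)) ⊗≫ Z.hb X (Y₁ ⊗ (Y₂ ⊗ Y₃)) ⊗≫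
          B.comul Y₁ (Y₂ ⊗ Y₃) ▷ (F).obj X) ⊗≫
        T.obj Y₁ ◁ B.comul Y₂ Y₃ ▷ (F).obj X ⊗≫ 𝟙 _ := by
      rw [← hb_naturality_right]; monoidal
    _ = 𝟙 _ ⊗≫ Z.hb X Y₁ ▷ (Y₂ ⊗ Y₃) ⊗≫ T.obj Y₁ ◁ Z.hb ((F).obj X) (Y₂ ⊗ Y₃) ⊗≫
        T.obj Y₁ ◁ (T.obj (Y₂ ⊗ Y₃) ◁ (ZB).mul X ≫ B.comul Y₂ Y₃ ▷ (F).obj X) ⊗≫ 𝟙 _ := by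
      rw [← Z.hb_mul hB]; monoidal
    _ = 𝟙 _ ⊗≫ Z.hb X Y₁ ▷ (Y₂ ⊗ Y₃) ⊗≫
        T.obj Y₁ ◁ (𝟙 (((F).obj X ⊗ Y₂) ⊗ Y₃) ⊗≫ Z.hb ((F).obj X) (Y₂ ⊗ Y₃) ⊗≫
          B.comul Y₂ Y₃ ▷ (F).obj ((F).obj X)) ⊗≫
        (T.obj Y₁ ⊗ T.obj Y₂ ⊗ T.obj Y₃) ◁ (ZB).mul X := by
      rw [whisker_exchange]; monoidal
    _ = _ := by rw [← Z.hb_mul hB]; monoidal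

theorem unit_mul (X : C) : (ZB).unit ((F).obj X) ≫ (ZB).mul X = 𝟙 _ := by
  refine Z.hom_ext fun Y => ?_
  rw [unit_eq]
  calc _ = 𝟙 _ ⊗≫ Z.hb X Y ▷ 𝟙_ C ⊗≫ T.obj Y ◁ Z.hb ((F).obj X) (𝟙_ C) ⊗≫
        ((T.obj Y ◁ B.counit) ▷ (F).obj ((F).obj X) ≫ (T.obj Y ⊗ 𝟙_ C) ◁ (ZB).mul X) ⊗≫
        𝟙 _ := by monoidal
    _ = 𝟙 _ ⊗≫ (Z.hb X Y ▷ 𝟙_ C ⊗≫ T.obj Y ◁ Z.hb ((F).obj X) (𝟙_ C) ⊗≫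
        (T.obj Y ⊗ T.obj (𝟙_ C)) ◁ (ZB).mul X) ⊗≫ T.obj Y ◁ B.counit ▷ (F).obj X ⊗≫ 𝟙 _ := by
      rw [← whisker_exchange]; monoidal
    _ = 𝟙 _ ⊗≫ Z.hb X (Y ⊗ 𝟙_ C) ⊗≫
        (B.comul Y (𝟙_ C) ≫ T.obj Y ◁ B.counit ≫ (ρ_ _).hom) ▷ (F).obj X := by
      rw [hb_mul]; monoidal
    _ = 𝟙 _ ⊗≫ (Z.hb X (Y ⊗ 𝟙_ C) ≫ T.map (ρ_ Y).hom ▷ (F).obj X) := by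
      rw [hB.comul_counit]; monoidal
    _ = _ := by rw [← hb_naturality_right]; monoidal

theorem map_unit_mul (X : C) : (F).map ((ZB).unit X) ≫ (ZB).mul X = 𝟙 _ := by
  refine Z.hom_ext fun Y => ?_
  calc _ = 𝟙 _ ⊗≫ (Z.hb X Y ≫ T.obj Y ◁ (F).map ((ZB).unit X)) ⊗≫ T.obj Y ◁ (ZB).mul X := by
        monoidal
    _ = 𝟙 _ ⊗≫ Z.hb X (𝟙_ C) ▷ Y ⊗≫ (B.counit ▷ ((F).obj X ⊗ Y) ≫
        𝟙_ C ◁ (Z.hb ((F).obj X) Y ⊗≫ T.obj Y ◁ (ZB).mul X)) ⊗≫ 𝟙 _ := by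
      rw [← hb_naturality_left, unit_eq]; monoidal
    _ = 𝟙 _ ⊗≫ (Z.hb X (𝟙_ C) ▷ Y ⊗≫ T.obj (𝟙_ C) ◁ Z.hb ((F).obj X) Y ⊗≫
        (T.obj (𝟙_ C) ⊗ T.obj Y) ◁ (ZB).mul X) ⊗≫ B.counit ▷ (T.obj Y ⊗ (F).obj X) ⊗≫ 𝟙 _ := by
      rw [← whisker_exchange]; monoidal
    _ = 𝟙 _ ⊗≫ Z.hb X (𝟙_ C ⊗ Y) ⊗≫
        (B.comul (𝟙_ C) Y ≫ B.counit ▷ T.obj Y ≫ (λ_ _).hom) ▷ (F).obj X := by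
      rw [hb_mul]; monoidal
    _ = 𝟙 _ ⊗≫ (Z.hb X (𝟙_ C ⊗ Y) ≫ T.map (λ_ Y).hom ▷ (F).obj X) := by
      rw [hB.counit_comul]; monoidal
    _ = _ := by rw [← hb_naturality_right]; monoidal

/-- Coassociativity is associativity of the product of `T`. -/
theorem coassoc (X Y W : C) :
    (ZB).comul (X ⊗ Y) W ≫ ((ZB).comul X Y ▷ (F).obj W) ≫ (α_ _ _ _).hom =
      (F).map (α_ X Y W).hom ≫ (ZB).comul X (Y ⊗ W) ≫ ((F).obj X ◁ (ZB).comul Y W) := by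
  refine Z.hom_ext fun V => ?_
  calc _ = 𝟙 _ ⊗≫ (Z.hb ((X ⊗ Y) ⊗ W) V ⊗≫ T.obj V ◁ (ZB).comul (X ⊗ Y) W) ⊗≫
        T.obj V ◁ (ZB).comul X Y ▷ (F).obj W ⊗≫ 𝟙 _ := by monoidal
    _ = 𝟙 _ ⊗≫ (X ⊗ Y) ◁ Z.hb W V ⊗≫ Z.hb (X ⊗ Y) (T.obj V) ▷ (F).obj W ⊗≫
        (B.mul V ▷ (F).obj (X ⊗ Y) ≫ T.obj V ◁ (ZB).comul X Y) ▷ (F).obj W ⊗≫ 𝟙 _ := by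
      rw [hb_comul]; monoidal
    _ = 𝟙 _ ⊗≫ (X ⊗ Y) ◁ Z.hb W V ⊗≫
        (Z.hb (X ⊗ Y) (T.obj V) ⊗≫ T.obj (T.obj V) ◁ (ZB).comul X Y) ▷ (F).obj W ⊗≫
        B.mul V ▷ ((F).obj X ⊗ (F).obj Y ⊗ (F).obj W) ⊗≫ 𝟙 _ := by
      rw [← whisker_exchange]; monoidal
    _ = 𝟙 _ ⊗≫ (X ⊗ Y) ◁ Z.hb W V ⊗≫ X ◁ Z.hb Y (T.obj V) ▷ (F).obj W ⊗≫
        Z.hb X (T.obj (T.obj V)) ▷ ((F).obj Y ⊗ (F).obj W) ⊗≫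
        (B.mul (T.obj V) ≫ B.mul V) ▷ ((F).obj X ⊗ (F).obj Y ⊗ (F).obj W) ⊗≫ 𝟙 _ := by
      rw [hb_comul]; monoidal
    _ = 𝟙 _ ⊗≫ X ◁ Y ◁ Z.hb W V ⊗≫ X ◁ Z.hb Y (T.obj V) ▷ (F).obj W ⊗≫
        (Z.hb X (T.obj (T.obj V)) ≫ T.map (B.mul V) ▷ (F).obj X) ▷ ((F).obj Y ⊗ (F).obj W) ⊗≫
        B.mul V ▷ ((F).obj X ⊗ (F).obj Y ⊗ (F).obj W) ⊗≫ 𝟙 _ := by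
      rw [← hB.mul_assoc]; monoidal
    _ = 𝟙 _ ⊗≫ X ◁ (𝟙 ((Y ⊗ W) ⊗ V) ⊗≫ Y ◁ Z.hb W V ⊗≫ Z.hb Y (T.obj V) ▷ (F).obj W ⊗≫
          B.mul V ▷ ((F).obj Y ⊗ (F).obj W)) ⊗≫
        (Z.hb X (T.obj V) ⊗≫ B.mul V ▷ (F).obj X) ▷ ((F).obj Y ⊗ (F).obj W) ⊗≫ 𝟙 _ := by
      rw [← hb_naturality_right]; monoidal
    _ = 𝟙 _ ⊗≫ X ◁ Z.hb (Y ⊗ W) V ⊗≫ ((X ⊗ T.obj V) ◁ (ZB).comul Y W ≫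
        (Z.hb X (T.obj V) ⊗≫ B.mul V ▷ (F).obj X) ▷ ((F).obj Y ⊗ (F).obj W)) ⊗≫ 𝟙 _ := by
      rw [← Z.hb_comul hB]; monoidal
    _ = 𝟙 _ ⊗≫ (𝟙 ((X ⊗ (Y ⊗ W)) ⊗ V) ⊗≫ X ◁ Z.hb (Y ⊗ W) V ⊗≫
        Z.hb X (T.obj V) ▷ (F).obj (Y ⊗ W) ⊗≫
        B.mul V ▷ ((F).obj X ⊗ (F).obj (Y ⊗ W))) ⊗≫
        (T.obj V ⊗ (F).obj X) ◁ (ZB).comul Y W ⊗≫ 𝟙 _ := by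
      rw [whisker_exchange]; monoidal
    _ = 𝟙 _ ⊗≫ ((α_ X Y W).hom ▷ V ≫ Z.hb (X ⊗ Y ⊗ W) V) ⊗≫ T.obj V ◁ (ZB).comul X (Y ⊗ W) ⊗≫
        (T.obj V ⊗ (F).obj X) ◁ (ZB).comul Y W ⊗≫ 𝟙 _ := by
      rw [← Z.hb_comul hB]; monoidal
    _ = _ := by rw [hb_naturality_left]; monoidal

theorem counit_comul (X : C) :
    (ZB).comul (𝟙_ C) X ≫ ((ZB).counit ▷ (F).obj X) ≫ (λ_ ((F).obj X)).hom =
      (F).map (λ_ X).hom := by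
  refine Z.hom_ext fun V => ?_
  calc _ = 𝟙 _ ⊗≫ (Z.hb (𝟙_ C ⊗ X) V ⊗≫ T.obj V ◁ (ZB).comul (𝟙_ C) X) ⊗≫
        T.obj V ◁ (ZB).counit ▷ (F).obj X ⊗≫ 𝟙 _ := by monoidal
    _ = 𝟙 _ ⊗≫ 𝟙_ C ◁ Z.hb X V ⊗≫ Z.hb (𝟙_ C) (T.obj V) ▷ (F).obj X ⊗≫
        (B.mul V ▷ (F).obj (𝟙_ C) ≫ T.obj V ◁ (ZB).counit) ▷ (F).obj X ⊗≫ 𝟙 _ := by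
      rw [hb_comul]; monoidal
    _ = 𝟙 _ ⊗≫ 𝟙_ C ◁ Z.hb X V ⊗≫
        (Z.hb (𝟙_ C) (T.obj V) ⊗≫ T.obj (T.obj V) ◁ (ZB).counit) ▷ (F).obj X ⊗≫
        B.mul V ▷ (F).obj X ⊗≫ 𝟙 _ := by
      rw [← whisker_exchange]; monoidal
    _ = 𝟙 _ ⊗≫ Z.hb X V ⊗≫ (B.unit (T.obj V) ≫ B.mul V) ▷ (F).obj X ⊗≫ 𝟙 _ := by
      rw [hb_counit]; monoidal
    _ = 𝟙 _ ⊗≫ ((λ_ X).hom ▷ V ≫ Z.hb X V) ⊗≫ 𝟙 _ := by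
      rw [hB.unit_mul]; monoidal
    _ = _ := by rw [hb_naturality_left]; monoidal

theorem comul_counit (X : C) :
    (ZB).comul X (𝟙_ C) ≫ ((F).obj X ◁ (ZB).counit) ≫ (ρ_ ((F).obj X)).hom =
      (F).map (ρ_ X).hom := by
  refine Z.hom_ext fun V => ?_
  calc _ = 𝟙 _ ⊗≫ (Z.hb (X ⊗ 𝟙_ C) V ⊗≫ T.obj V ◁ (ZB).comul X (𝟙_ C)) ⊗≫
        (T.obj V ⊗ (F).obj X) ◁ (ZB).counit ⊗≫ 𝟙 _ := by monoidal
    _ = 𝟙 _ ⊗≫ X ◁ Z.hb (𝟙_ C) V ⊗≫ ((Z.hb X (T.obj V) ⊗≫ B.mul V ▷ (F).obj X) ▷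
        (F).obj (𝟙_ C) ≫ (T.obj V ⊗ (F).obj X) ◁ (ZB).counit) ⊗≫ 𝟙 _ := by
      rw [hb_comul]; monoidal
    _ = 𝟙 _ ⊗≫ X ◁ (Z.hb (𝟙_ C) V ⊗≫ T.obj V ◁ (ZB).counit) ⊗≫
        Z.hb X (T.obj V) ⊗≫ B.mul V ▷ (F).obj X ⊗≫ 𝟙 _ := by
      rw [← whisker_exchange]; monoidal
    _ = 𝟙 _ ⊗≫ (X ◁ B.unit V ≫ Z.hb X (T.obj V)) ⊗≫ B.mul V ▷ (F).obj X ⊗≫ 𝟙 _ := by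
      rw [hb_counit]; monoidal
    _ = 𝟙 _ ⊗≫ Z.hb X V ⊗≫ (T.map (B.unit V) ≫ B.mul V) ▷ (F).obj X ⊗≫ 𝟙 _ := by
      rw [hb_naturality_right]; monoidal
    _ = 𝟙 _ ⊗≫ ((ρ_ X).hom ▷ V ≫ Z.hb X V) ⊗≫ 𝟙 _ := by
      rw [hB.map_unit_mul]; monoidal
    _ = _ := by rw [hb_naturality_left]; monoidal

theorem mul_counit : (ZB).mul (𝟙_ C) ≫ (ZB).counit = (F).map (ZB).counit ≫ (ZB).counit := by
  refine Z.hom_ext_two fun Y₁ Y₂ => ?_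
  calc _ = 𝟙 _ ⊗≫ (Z.hb (𝟙_ C) Y₁ ▷ Y₂ ⊗≫ T.obj Y₁ ◁ Z.hb ((F).obj (𝟙_ C)) Y₂ ⊗≫
          (T.obj Y₁ ⊗ T.obj Y₂) ◁ (ZB).mul (𝟙_ C)) ⊗≫
        (T.obj Y₁ ⊗ T.obj Y₂) ◁ (ZB).counit := by monoidal
    _ = 𝟙 _ ⊗≫ Z.hb (𝟙_ C) (Y₁ ⊗ Y₂) ⊗≫ (B.comul Y₁ Y₂ ▷ (F).obj (𝟙_ C) ≫
        (T.obj Y₁ ⊗ T.obj Y₂) ◁ (ZB).counit) := by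
      rw [hb_mul]; monoidal
    _ = 𝟙 _ ⊗≫ (Z.hb (𝟙_ C) (Y₁ ⊗ Y₂) ⊗≫ T.obj (Y₁ ⊗ Y₂) ◁ (ZB).counit) ⊗≫
        B.comul Y₁ Y₂ ⊗≫ 𝟙 _ := by
      rw [← whisker_exchange]; monoidal
    _ = 𝟙 _ ⊗≫ (B.unit (Y₁ ⊗ Y₂) ≫ B.comul Y₁ Y₂) ⊗≫ 𝟙 _ := by
      rw [hb_counit]; monoidal
    _ = 𝟙 _ ⊗≫ (𝟙 (𝟙_ C ⊗ Y₁) ⊗≫ B.unit Y₁ ⊗≫ 𝟙 (T.obj Y₁ ⊗ 𝟙_ C)) ▷ Y₂ ⊗≫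
        T.obj Y₁ ◁ (𝟙 (𝟙_ C ⊗ Y₂) ⊗≫ B.unit Y₂ ⊗≫ 𝟙 (T.obj Y₂ ⊗ 𝟙_ C)) ⊗≫ 𝟙 _ := by
      rw [hB.unit_comul, MonoidalCategory.tensorHom_def]; monoidal
    _ = 𝟙 _ ⊗≫ Z.hb (𝟙_ C) Y₁ ▷ Y₂ ⊗≫ T.obj Y₁ ◁ ((ZB).counit ▷ Y₂ ≫ Z.hb (𝟙_ C) Y₂) ⊗≫
        (T.obj Y₁ ⊗ T.obj Y₂) ◁ (ZB).counit := by
      rw [← Z.hb_counit hB Y₁, ← Z.hb_counit hB Y₂]; monoidal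
    _ = _ := by rw [hb_naturality_left]; monoidal

theorem unit_comul (X Y : C) :
    (ZB).unit (X ⊗ Y) ≫ (ZB).comul X Y = (ZB).unit X ⊗ₘ (ZB).unit Y := by
  rw [unit_eq, unit_eq, unit_eq, MonoidalCategory.tensorHom_def']
  calc _ = 𝟙 _ ⊗≫ Z.hb (X ⊗ Y) (𝟙_ C) ⊗≫
        (B.counit ▷ (F).obj (X ⊗ Y) ≫ 𝟙_ C ◁ (ZB).comul X Y) ⊗≫ 𝟙 _ := by monoidal
    _ = 𝟙 _ ⊗≫ (Z.hb (X ⊗ Y) (𝟙_ C) ⊗≫ T.obj (𝟙_ C) ◁ (ZB).comul X Y) ⊗≫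
        B.counit ▷ ((F).obj X ⊗ (F).obj Y) ⊗≫ 𝟙 _ := by
      rw [← whisker_exchange]; monoidal
    _ = 𝟙 _ ⊗≫ X ◁ Z.hb Y (𝟙_ C) ⊗≫ Z.hb X (T.obj (𝟙_ C)) ▷ (F).obj Y ⊗≫
        (B.mul (𝟙_ C) ≫ B.counit) ▷ ((F).obj X ⊗ (F).obj Y) ⊗≫ 𝟙 _ := by
      rw [hb_comul]; monoidal
    _ = 𝟙 _ ⊗≫ X ◁ Z.hb Y (𝟙_ C) ⊗≫
        (Z.hb X (T.obj (𝟙_ C)) ≫ T.map B.counit ▷ (F).obj X) ▷ (F).obj Y ⊗≫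
        B.counit ▷ ((F).obj X ⊗ (F).obj Y) ⊗≫ 𝟙 _ := by
      rw [hB.mul_counit]; monoidal
    _ = 𝟙 _ ⊗≫ X ◁ Z.hb Y (𝟙_ C) ⊗≫ (X ◁ B.counit) ▷ (F).obj Y ⊗≫
        Z.hb X (𝟙_ C) ▷ (F).obj Y ⊗≫ B.counit ▷ ((F).obj X ⊗ (F).obj Y) ⊗≫ 𝟙 _ := by
      rw [← hb_naturality_right]; monoidal
    _ = _ := by monoidal

theorem unit_counit : (ZB).unit (𝟙_ C) ≫ (ZB).counit = 𝟙 (𝟙_ C) := by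
  rw [unit_eq]
  calc _ = 𝟙 _ ⊗≫ Z.hb (𝟙_ C) (𝟙_ C) ⊗≫
        (B.counit ▷ (F).obj (𝟙_ C) ≫ 𝟙_ C ◁ (ZB).counit) ⊗≫ 𝟙 _ := by monoidal
    _ = 𝟙 _ ⊗≫ (Z.hb (𝟙_ C) (𝟙_ C) ⊗≫ T.obj (𝟙_ C) ◁ (ZB).counit) ⊗≫ B.counit ⊗≫ 𝟙 _ := by
      rw [← whisker_exchange]; monoidal
    _ = 𝟙 _ ⊗≫ (B.unit (𝟙_ C) ≫ B.counit) ⊗≫ 𝟙 _ := by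
      rw [hb_counit]; monoidal
    _ = _ := by rw [hB.unit_counit]; monoidal

/-- Compatibility of product and coproduct is the same compatibility for `T`: in
`∂_{X ⊗ Y, Y₁ ⊗ Y₂}` the product of `T` meets its coproduct. -/
theorem mul_comul (X Y : C) :
    (ZB).mul (X ⊗ Y) ≫ (ZB).comul X Y =
      (F).map ((ZB).comul X Y) ≫ (ZB).comul ((F).obj X) ((F).obj Y) ≫
        ((ZB).mul X ⊗ₘ (ZB).mul Y) := by
  refine Z.hom_ext_two fun Y₁ Y₂ => ?_
  rw [MonoidalCategory.tensorHom_def']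
  calc _ = 𝟙 _ ⊗≫ (Z.hb (X ⊗ Y) Y₁ ▷ Y₂ ⊗≫ T.obj Y₁ ◁ Z.hb ((F).obj (X ⊗ Y)) Y₂ ⊗≫
          (T.obj Y₁ ⊗ T.obj Y₂) ◁ (ZB).mul (X ⊗ Y)) ⊗≫
        (T.obj Y₁ ⊗ T.obj Y₂) ◁ (ZB).comul X Y := by monoidal
    _ = 𝟙 _ ⊗≫ Z.hb (X ⊗ Y) (Y₁ ⊗ Y₂) ⊗≫ (B.comul Y₁ Y₂ ▷ (F).obj (X ⊗ Y) ≫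
        (T.obj Y₁ ⊗ T.obj Y₂) ◁ (ZB).comul X Y) := by
      rw [hb_mul]; monoidal
    _ = 𝟙 _ ⊗≫ (Z.hb (X ⊗ Y) (Y₁ ⊗ Y₂) ⊗≫ T.obj (Y₁ ⊗ Y₂) ◁ (ZB).comul X Y) ⊗≫
        B.comul Y₁ Y₂ ▷ ((F).obj X ⊗ (F).obj Y) := by
      rw [← whisker_exchange]; monoidal
    _ = 𝟙 _ ⊗≫ X ◁ Z.hb Y (Y₁ ⊗ Y₂) ⊗≫ Z.hb X (T.obj (Y₁ ⊗ Y₂)) ▷ (F).obj Y ⊗≫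
        (B.mul (Y₁ ⊗ Y₂) ≫ B.comul Y₁ Y₂) ▷ ((F).obj X ⊗ (F).obj Y) := by
      rw [hb_comul]; monoidal
    _ = 𝟙 _ ⊗≫ X ◁ Z.hb Y (Y₁ ⊗ Y₂) ⊗≫
        (Z.hb X (T.obj (Y₁ ⊗ Y₂)) ≫ T.map (B.comul Y₁ Y₂) ▷ (F).obj X) ▷ (F).obj Y ⊗≫
        (B.comul (T.obj Y₁) (T.obj Y₂) ≫ (B.mul Y₁ ⊗ₘ B.mul Y₂)) ▷
          ((F).obj X ⊗ (F).obj Y) := by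
      rw [hB.mul_comul]; monoidal
    _ = 𝟙 _ ⊗≫ X ◁ (𝟙 ((Y ⊗ Y₁) ⊗ Y₂) ⊗≫ Z.hb Y (Y₁ ⊗ Y₂) ⊗≫ B.comul Y₁ Y₂ ▷ (F).obj Y) ⊗≫
        (𝟙 ((X ⊗ T.obj Y₁) ⊗ T.obj Y₂) ⊗≫ Z.hb X (T.obj Y₁ ⊗ T.obj Y₂) ⊗≫
          B.comul (T.obj Y₁) (T.obj Y₂) ▷ (F).obj X) ▷ (F).obj Y ⊗≫
        (B.mul Y₁ ⊗ₘ B.mul Y₂) ▷ ((F).obj X ⊗ (F).obj Y) := by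
      rw [← hb_naturality_right]; monoidal
    _ = 𝟙 _ ⊗≫ X ◁ (Z.hb Y Y₁ ▷ Y₂ ⊗≫ T.obj Y₁ ◁ Z.hb ((F).obj Y) Y₂) ⊗≫
        ((X ⊗ T.obj Y₁ ⊗ T.obj Y₂) ◁ (ZB).mul Y ≫
          (𝟙 (X ⊗ T.obj Y₁ ⊗ T.obj Y₂) ⊗≫ Z.hb X (T.obj Y₁) ▷ T.obj Y₂ ⊗≫
            T.obj (T.obj Y₁) ◁ Z.hb ((F).obj X) (T.obj Y₂) ⊗≫
          𝟙 ((T.obj (T.obj Y₁) ⊗ T.obj (T.obj Y₂)) ⊗ (F).obj ((F).obj X))) ▷ (F).obj Y) ⊗≫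
        (T.obj (T.obj Y₁) ⊗ T.obj (T.obj Y₂)) ◁ (ZB).mul X ▷ (F).obj Y ⊗≫
        (B.mul Y₁ ⊗ₘ B.mul Y₂) ▷ ((F).obj X ⊗ (F).obj Y) := by
      rw [← Z.hb_mul hB, ← Z.hb_mul hB]; monoidal
    _ = 𝟙 _ ⊗≫ X ◁ (Z.hb Y Y₁ ▷ Y₂ ⊗≫ T.obj Y₁ ◁ Z.hb ((F).obj Y) Y₂) ⊗≫
        (𝟙 (X ⊗ T.obj Y₁ ⊗ T.obj Y₂) ⊗≫ Z.hb X (T.obj Y₁) ▷ T.obj Y₂ ⊗≫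
            T.obj (T.obj Y₁) ◁ Z.hb ((F).obj X) (T.obj Y₂) ⊗≫
          𝟙 ((T.obj (T.obj Y₁) ⊗ T.obj (T.obj Y₂)) ⊗ (F).obj ((F).obj X))) ▷
            (F).obj ((F).obj Y) ⊗≫
        ((T.obj (T.obj Y₁) ⊗ T.obj (T.obj Y₂)) ◁
          ((F).obj ((F).obj X) ◁ (ZB).mul Y ≫ (ZB).mul X ▷ (F).obj Y) ≫
        (B.mul Y₁ ⊗ₘ B.mul Y₂) ▷ ((F).obj X ⊗ (F).obj Y)) := by
      rw [whisker_exchange]; monoidal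
    _ = 𝟙 _ ⊗≫ X ◁ (Z.hb Y Y₁ ▷ Y₂ ⊗≫ T.obj Y₁ ◁ Z.hb ((F).obj Y) Y₂) ⊗≫
        Z.hb X (T.obj Y₁) ▷ (T.obj Y₂ ⊗ (F).obj ((F).obj Y)) ⊗≫
        (T.obj (T.obj Y₁) ◁ (Z.hb ((F).obj X) (T.obj Y₂) ⊗≫
          B.mul Y₂ ▷ (F).obj ((F).obj X)) ≫ B.mul Y₁ ▷ _) ▷ (F).obj ((F).obj Y) ⊗≫
        (T.obj Y₁ ⊗ T.obj Y₂) ◁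
          ((F).obj ((F).obj X) ◁ (ZB).mul Y ≫ (ZB).mul X ▷ (F).obj Y) := by
      rw [whisker_exchange (B.mul Y₁ ⊗ₘ B.mul Y₂), MonoidalCategory.tensorHom_def']; monoidal
    _ = 𝟙 _ ⊗≫ X ◁ Z.hb Y Y₁ ▷ Y₂ ⊗≫ ((X ⊗ T.obj Y₁) ◁ Z.hb ((F).obj Y) Y₂ ≫
        (Z.hb X (T.obj Y₁) ⊗≫ B.mul Y₁ ▷ (F).obj X) ▷ (T.obj Y₂ ⊗ (F).obj ((F).obj Y))) ⊗≫
        T.obj Y₁ ◁ (Z.hb ((F).obj X) (T.obj Y₂) ⊗≫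
          B.mul Y₂ ▷ (F).obj ((F).obj X)) ▷ (F).obj ((F).obj Y) ⊗≫
        (T.obj Y₁ ⊗ T.obj Y₂) ◁
          ((F).obj ((F).obj X) ◁ (ZB).mul Y ≫ (ZB).mul X ▷ (F).obj Y) := by
      rw [whisker_exchange (B.mul Y₁)]; monoidal
    _ = 𝟙 _ ⊗≫ (𝟙 ((X ⊗ Y) ⊗ Y₁) ⊗≫ X ◁ Z.hb Y Y₁ ⊗≫ Z.hb X (T.obj Y₁) ▷ (F).obj Y ⊗≫
          B.mul Y₁ ▷ ((F).obj X ⊗ (F).obj Y)) ▷ Y₂ ⊗≫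
        T.obj Y₁ ◁ (𝟙 (((F).obj X ⊗ (F).obj Y) ⊗ Y₂) ⊗≫ (F).obj X ◁ Z.hb ((F).obj Y) Y₂ ⊗≫
          Z.hb ((F).obj X) (T.obj Y₂) ▷ (F).obj ((F).obj Y) ⊗≫
          B.mul Y₂ ▷ ((F).obj ((F).obj X) ⊗ (F).obj ((F).obj Y))) ⊗≫
        (T.obj Y₁ ⊗ T.obj Y₂) ◁
          ((F).obj ((F).obj X) ◁ (ZB).mul Y ≫ (ZB).mul X ▷ (F).obj Y) := by
      rw [whisker_exchange]; monoidal
    _ = 𝟙 _ ⊗≫ Z.hb (X ⊗ Y) Y₁ ▷ Y₂ ⊗≫ T.obj Y₁ ◁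
          ((ZB).comul X Y ▷ Y₂ ≫ Z.hb ((F).obj X ⊗ (F).obj Y) Y₂) ⊗≫
        (T.obj Y₁ ⊗ T.obj Y₂) ◁ ((ZB).comul ((F).obj X) ((F).obj Y) ≫
          ((F).obj ((F).obj X) ◁ (ZB).mul Y ≫ (ZB).mul X ▷ (F).obj Y)) := by
      rw [← Z.hb_comul hB X Y, ← Z.hb_comul hB]; monoidal
    _ = _ := by rw [hb_naturality_left]; monoidal

/-- The centralizer of a bimonad is a bimonad. -/
theorem isBimonad_bimonadData : (ZB).IsBimonad where
  mul_naturality := Z.mul_naturality hB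
  unit_naturality := Z.unit_naturality hB
  comul_naturality := Z.comul_naturality hB
  mul_assoc := Z.mul_assoc hB
  unit_mul := Z.unit_mul hB
  map_unit_mul := Z.map_unit_mul hB
  coassoc := Z.coassoc hB
  counit_comul := Z.counit_comul hB
  comul_counit := Z.comul_counit hB
  mul_comul := Z.mul_comul hB
  mul_counit := Z.mul_counit hB
  unit_comul := Z.unit_comul hB
  unit_counit := Z.unit_counit hB

end Centralizer
end CentralizerBimonad

/-! ### Linear pairings and the image of the universal family -/

section LinearPairings
variable {C : Type u} [Category.{v} C] [MonoidalCategory C]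

open Functor.OplaxMonoidal

section
variable {G : C ⥤ C} [G.OplaxMonoidal] {M N : C} [ExactPairing M N] {r : G.obj M ⟶ M}
  {t : G.obj N ⟶ N}

/-- The image under `G` of a linear evaluation, with a third factor `A`. -/
theorem EvLin.map_evaluation_whiskerRight (h : EvLin G r t) (A : C) :
    G.map ((α_ N M A).inv ≫ ε_ M N ▷ A ≫ (λ_ A).hom) =
      δ G N (M ⊗ A) ≫ G.obj N ◁ δ G M A ≫ t ▷ (G.obj M ⊗ G.obj A) ≫ N ◁ r ▷ G.obj A ≫
        (α_ N M (G.obj A)).inv ≫ ε_ M N ▷ G.obj A ≫ (λ_ (G.obj A)).hom := by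
  unfold EvLin at h
  calc _ = G.map (α_ N M A).inv ≫ G.map (ε_ M N ▷ A) ≫ δ G (𝟙_ C) A ≫
        η G ▷ G.obj A ≫ (λ_ (G.obj A)).hom := by simp
    _ = G.map (α_ N M A).inv ≫ δ G (N ⊗ M) A ≫ (G.map (ε_ M N) ≫ η G) ▷ G.obj A ≫
        (λ_ (G.obj A)).hom := by
      rw [← δ_natural_left_assoc]; simp
    _ = (G.map (α_ N M A).inv ≫ δ G (N ⊗ M) A ≫ δ G N M ▷ G.obj A) ≫
        ((t ⊗ₘ r) ≫ ε_ M N) ▷ G.obj A ≫ (λ_ (G.obj A)).hom := by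
      rw [h]; simp
    _ = _ := by
      rw [← associativity_inv, MonoidalCategory.tensorHom_def]; simp

/-- The image under `G` of a linear coevaluation, with a third factor `A`. -/
theorem CoevLin.map_coevaluation_whiskerRight (h : CoevLin G r t) (A : C) :
    G.map ((λ_ A).inv ≫ η_ M N ▷ A ≫ (α_ M N A).hom) ≫ δ G M (N ⊗ A) ≫ G.obj M ◁ δ G N A ≫
        r ▷ (G.obj N ⊗ G.obj A) ≫ M ◁ t ▷ G.obj A =
      (λ_ (G.obj A)).inv ≫ η_ M N ▷ G.obj A ≫ (α_ M N (G.obj A)).hom := by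
  unfold CoevLin at h
  calc _ = G.map (λ_ A).inv ≫ G.map (η_ M N ▷ A) ≫ (δ G (M ⊗ N) A ≫ δ G M N ▷ G.obj A ≫
        (α_ (G.obj M) (G.obj N) (G.obj A)).hom) ≫
        r ▷ (G.obj N ⊗ G.obj A) ≫ M ◁ t ▷ G.obj A := by rw [associativity]; simp
    _ = G.map (λ_ A).inv ≫ δ G (𝟙_ C) A ≫ (G.map (η_ M N) ≫ δ G M N ≫ (r ⊗ₘ t)) ▷ G.obj A ≫
        (α_ M N (G.obj A)).hom := by
      rw [MonoidalCategory.tensorHom_def]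
      simp only [Category.assoc, ← δ_natural_left_assoc, comp_whiskerRight]
      simp
    _ = G.map (λ_ A).inv ≫ δ G (𝟙_ C) A ≫ η G ▷ G.obj A ≫ η_ M N ▷ G.obj A ≫
        (α_ M N (G.obj A)).hom := by rw [← h]; simp
    _ = _ := by
      rw [left_unitality]; simp
end

variable {T : C ⥤ C} (Z : Centralizer T)

namespace Centralizer

/-- The family `∂` recovered from the dinatural family `i`. -/
theorem hb_eq [RightRigidCategory C] (X Y : C) :
    Z.hb X Y = ((λ_ (X ⊗ Y)).inv ≫ η_ (T.obj Y) (T.obj Y)ᘁ ▷ (X ⊗ Y) ≫ (α_ _ _ _).hom) ≫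
      T.obj Y ◁ Z.coendι X Y := by
  have h := (tensorLeftHomEquiv (X ⊗ Y) (T.obj Y) ((T.obj Y)ᘁ) (Z.functor.obj X)).apply_symm_apply
    (Z.hb X Y)
  rw [← coendι_eq] at h
  rw [← h]
  simp [tensorLeftHomEquiv]

theorem coendι_whiskerRight_ext [RightRigidCategory C] {X A W : C}
    {g g' : Z.functor.obj X ⊗ A ⟶ W}
    (h : ∀ Y, Z.coendι X Y ▷ A ≫ g = Z.coendι X Y ▷ A ≫ g') : g = g' := by
  refine Z.hom_ext_tensor fun Y => ?_
  have key (k : Z.functor.obj X ⊗ A ⟶ W) : Z.hb X Y ▷ A ⊗≫ T.obj Y ◁ k =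
      ((λ_ (X ⊗ Y)).inv ≫ η_ (T.obj Y) (T.obj Y)ᘁ ▷ (X ⊗ Y) ≫ (α_ _ _ _).hom) ▷ A ⊗≫
      T.obj Y ◁ (Z.coendι X Y ▷ A ≫ k) := by
    rw [hb_eq]; monoidal
  rw [key, key, h]

section
variable {G : C ⥤ C} [G.OplaxMonoidal]

/-- If `G` has a right adjoint (`hG`), the family `G(∂_{X,Y} ⊗ A)` is jointly epimorphic in the
following sense: a morphism out of `G(Z_T(X) ⊗ A)` is determined by its composites with this family
after acting on the factor `T(Y)`. The linear evaluations `hrt` turn these composites into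
composites with the universal dinatural family `G(i_{X,Y} ⊗ A)`. -/
theorem hom_ext_map_tensor [RightRigidCategory C]
    (hG : ∀ W : C, ∃ (R : C) (e : G.obj R ⟶ W), ∀ (X : C) (f : G.obj X ⟶ W),
      ∃! g : X ⟶ R, G.map g ≫ e = f)
    (r : ∀ Y, G.obj (T.obj Y) ⟶ T.obj Y) (t : ∀ Y, G.obj ((T.obj Y)ᘁ) ⟶ (T.obj Y)ᘁ)
    (hrt : ∀ Y, EvLin G (r Y) (t Y)) {X A W : C} {f f' : G.obj (Z.functor.obj X ⊗ A) ⟶ W}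
    (h : ∀ Y, G.map (Z.hb X Y ▷ A ≫ (α_ _ _ _).hom) ≫ δ G (T.obj Y) (Z.functor.obj X ⊗ A) ≫
        r Y ▷ _ ≫ T.obj Y ◁ f =
      G.map (Z.hb X Y ▷ A ≫ (α_ _ _ _).hom) ≫ δ G (T.obj Y) (Z.functor.obj X ⊗ A) ≫
        r Y ▷ _ ≫ T.obj Y ◁ f') : f = f' := by
  have key (Y : C) (k : G.obj (Z.functor.obj X ⊗ A) ⟶ W) :
      G.map (Z.coendι X Y ▷ A) ≫ k = G.map (α_ _ _ _).hom ≫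
        δ G ((T.obj Y)ᘁ) ((X ⊗ Y) ⊗ A) ≫ t Y ▷ _ ≫ (T.obj Y)ᘁ ◁
        (G.map (Z.hb X Y ▷ A ≫ (α_ _ _ _).hom) ≫ δ G (T.obj Y) (Z.functor.obj X ⊗ A) ≫
        r Y ▷ _ ≫ T.obj Y ◁ k) ≫ (α_ _ _ _).inv ≫ ε_ _ _ ▷ W ≫ (λ_ W).hom := by
    calc _ = G.map (α_ _ _ _).hom ≫ G.map ((T.obj Y)ᘁ ◁ (Z.hb X Y ▷ A ≫ (α_ _ _ _).hom)) ≫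
          G.map ((α_ _ _ _).inv ≫ ε_ (T.obj Y) (T.obj Y)ᘁ ▷ (Z.functor.obj X ⊗ A) ≫
            (λ_ _).hom) ≫ k := by
          simp only [← G.map_comp_assoc, coendι]
          congr 2
          monoidal
      _ = G.map (α_ _ _ _).hom ≫ (δ G ((T.obj Y)ᘁ) ((X ⊗ Y) ⊗ A) ≫
          G.obj (T.obj Y)ᘁ ◁ G.map (Z.hb X Y ▷ A ≫ (α_ _ _ _).hom)) ≫
          G.obj (T.obj Y)ᘁ ◁ δ G (T.obj Y) (Z.functor.obj X ⊗ A) ≫ t Y ▷ _ ≫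
          (T.obj Y)ᘁ ◁ r Y ▷ G.obj _ ≫ (α_ _ _ _).inv ≫ ε_ _ _ ▷ G.obj _ ≫ (λ_ _).hom ≫ k := by
        rw [(hrt Y).map_evaluation_whiskerRight, δ_natural_right]
        simp only [Category.assoc]
      _ = G.map (α_ _ _ _).hom ≫ δ G ((T.obj Y)ᘁ) ((X ⊗ Y) ⊗ A) ≫
          (G.obj (T.obj Y)ᘁ ◁ (G.map (Z.hb X Y ▷ A ≫ (α_ _ _ _).hom) ≫
            δ G (T.obj Y) (Z.functor.obj X ⊗ A)) ≫ t Y ▷ _) ≫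
          (T.obj Y)ᘁ ◁ r Y ▷ G.obj _ ≫ (α_ _ _ _).inv ≫ (ε_ _ _ ▷ G.obj _ ≫ 𝟙_ C ◁ k) ≫
          (λ_ _).hom := by monoidal
      _ = _ := by
        rw [whisker_exchange (t Y), ← whisker_exchange (ε_ (T.obj Y) (T.obj Y)ᘁ) k]; monoidal
  obtain ⟨R, e, he⟩ := hG W
  obtain ⟨g, hg, -⟩ := he _ f
  obtain ⟨g', hg', -⟩ := he _ f'
  rw [← hg, ← hg', Z.coendι_whiskerRight_ext (g := g) (g' := g') fun Y => ?_]
  refine (he _ (G.map (Z.coendι X Y ▷ A ≫ g) ≫ e)).unique rfl ?_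
  rw [G.map_comp, G.map_comp, Category.assoc, Category.assoc, hg, hg', key, key, h]

/-- The case `A = 𝟙` of `hom_ext_map_tensor`. -/
theorem hom_ext_map [RightRigidCategory C]
    (hG : ∀ W : C, ∃ (R : C) (e : G.obj R ⟶ W), ∀ (X : C) (f : G.obj X ⟶ W),
      ∃! g : X ⟶ R, G.map g ≫ e = f)
    (r : ∀ Y, G.obj (T.obj Y) ⟶ T.obj Y) (t : ∀ Y, G.obj ((T.obj Y)ᘁ) ⟶ (T.obj Y)ᘁ)
    (hrt : ∀ Y, EvLin G (r Y) (t Y)) {X W : C} {f f' : G.obj (Z.functor.obj X) ⟶ W}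
    (h : ∀ Y, G.map (Z.hb X Y) ≫ δ G (T.obj Y) (Z.functor.obj X) ≫ r Y ▷ _ ≫ T.obj Y ◁ f =
      G.map (Z.hb X Y) ≫ δ G (T.obj Y) (Z.functor.obj X) ≫ r Y ▷ _ ≫ T.obj Y ◁ f') : f = f' := by
  rw [← cancel_epi (G.map (ρ_ (Z.functor.obj X)).hom)]
  refine Z.hom_ext_map_tensor hG r t hrt fun Y => ?_
  have key (k : G.obj (Z.functor.obj X) ⟶ W) :
      G.map (Z.hb X Y ▷ 𝟙_ C ≫ (α_ _ _ _).hom) ≫ δ G (T.obj Y) (Z.functor.obj X ⊗ 𝟙_ C) ≫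
        r Y ▷ _ ≫ T.obj Y ◁ (G.map (ρ_ (Z.functor.obj X)).hom ≫ k) = G.map (ρ_ (X ⊗ Y)).hom ≫
      G.map (Z.hb X Y) ≫ δ G (T.obj Y) (Z.functor.obj X) ≫ r Y ▷ _ ≫ T.obj Y ◁ k := by
    rw [whiskerLeft_comp, ← whisker_exchange_assoc, δ_natural_right_assoc, ← G.map_comp_assoc,
      ← G.map_comp_assoc]
    congr 2
    monoidal
  rw [key, key, h]
end

end Centralizer
end LinearPairings

/-! ### The canonical distributive law -/

section DistributiveLaw
variable {C : Type u} [Category.{v} C] [MonoidalCategory C]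

theorem BimonadData.IsBimonad.comul_mul_whiskerLeft {T : C ⥤ C} {B : BimonadData T}
    (hB : B.IsBimonad) (Y : C) {A A' W : C} (g : A ⟶ A') (k : T.obj A' ⟶ W) :
    B.comul (T.obj Y) A ≫ B.mul Y ▷ T.obj A ≫ T.obj Y ◁ (T.map g ≫ k) =
      T.map (T.obj Y ◁ g) ≫ B.comul (T.obj Y) A' ≫ B.mul Y ▷ T.obj A' ≫ T.obj Y ◁ k := by
  rw [reassoc_of% (hB.comul_naturality_right (T.obj Y) g), whisker_exchange_assoc,
    whiskerLeft_comp]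

variable [RigidCategory C] {T : C ⥤ C} {B : BimonadData T}

theorem BimonadData.IsHopfMonad.isLeftAntipode_leftAntipode (hB : B.IsHopfMonad) :
    B.IsLeftAntipode hB.leftAntipode := hB.exists_leftAntipode.choose_spec

namespace Centralizer
variable (hB : B.IsHopfMonad) (Z : Centralizer T)

local notation "F" => Centralizer.functor Z
local notation "ZB" => Centralizer.bimonadData Z (BimonadData.IsHopfMonad.isBimonad hB)
local notation "Ω" => Centralizer.canonicalLaw Z hB

include hB in
/-- A morphism `f` out of `T(Z_T(X) ⊗ A)` is determined by the composites of `T(∂_{X,Y} ⊗ A)`, `T₂`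
and `μ_Y ⊗ f`. -/
theorem law_hom_ext_tensor {X A W : C} {f f' : T.obj ((F).obj X ⊗ A) ⟶ W}
    (h : ∀ Y, T.map (Z.hb X Y ▷ A ≫ (α_ _ _ _).hom) ≫ B.comul (T.obj Y) ((F).obj X ⊗ A) ≫
        B.mul Y ▷ _ ≫ T.obj Y ◁ f =
      T.map (Z.hb X Y ▷ A ≫ (α_ _ _ _).hom) ≫ B.comul (T.obj Y) ((F).obj X ⊗ A) ≫
        B.mul Y ▷ _ ≫ T.obj Y ◁ f') : f = f' := by
  let _ := hB.isBimonad.oplax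
  exact Z.hom_ext_map_tensor hB.exists_universal B.mul _ (fun Y => evLin_leftAntipode hB.isBimonad
    hB.isLeftAntipode_leftAntipode (hB.isBimonad.free Y)) h

include hB in
/-- A morphism `f` out of `T(Z_T(X))` is determined by the composites of `T(∂_{X,Y})`, `T₂` and
`μ_Y ⊗ f`. -/
theorem law_hom_ext {X W : C} {f f' : T.obj ((F).obj X) ⟶ W}
    (h : ∀ Y, T.map (Z.hb X Y) ≫ B.comul (T.obj Y) ((F).obj X) ≫ B.mul Y ▷ _ ≫ T.obj Y ◁ f =
      T.map (Z.hb X Y) ≫ B.comul (T.obj Y) ((F).obj X) ≫ B.mul Y ▷ _ ≫ T.obj Y ◁ f') :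
    f = f' := by
  let _ := hB.isBimonad.oplax
  exact Z.hom_ext_map hB.exists_universal B.mul _ (fun Y => evLin_leftAntipode hB.isBimonad
    hB.isLeftAntipode_leftAntipode (hB.isBimonad.free Y)) h

include hB in
/-- The analogue of `law_hom_ext` for `T²` instead of `T`; here `T²` acts on `T(Y)` by
`T(μ_Y) μ_Y`. -/
theorem law_hom_ext_map {X W : C} {f f' : T.obj (T.obj ((F).obj X)) ⟶ W}
    (h : ∀ Y, T.map (T.map (Z.hb X Y) ≫ B.comul (T.obj Y) ((F).obj X) ≫ B.mul Y ▷ _) ≫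
        B.comul (T.obj Y) (T.obj ((F).obj X)) ≫ B.mul Y ▷ _ ≫ T.obj Y ◁ f =
      T.map (T.map (Z.hb X Y) ≫ B.comul (T.obj Y) ((F).obj X) ≫ B.mul Y ▷ _) ≫
        B.comul (T.obj Y) (T.obj ((F).obj X)) ≫ B.mul Y ▷ _ ≫ T.obj Y ◁ f') :
    f = f' := by
  let _ := hB.isBimonad.oplax
  refine Z.hom_ext_map (G := T ⋙ T) (fun W => ?_) _ _ (fun Y => evLin_comp
    (evLin_leftAntipode hB.isBimonad hB.isLeftAntipode_leftAntipode (hB.isBimonad.free Y)))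
    (f := f) (f' := f') fun Y => ?_
  · -- composing the two universal arrows gives one for `T²`
    obtain ⟨R, e, he⟩ := hB.exists_universal W
    obtain ⟨R', e', he'⟩ := hB.exists_universal R
    refine ⟨R', T.map e' ≫ e, fun X f => ?_⟩
    obtain ⟨g, hg, hgu⟩ := he _ f
    obtain ⟨g', hg', hgu'⟩ := he' _ g
    simp only at hg hgu hg' hgu'
    refine ⟨g', ?_, fun k hk => hgu' _ (hgu _ ?_)⟩
    · simp [← T.map_comp_assoc, hg', hg]
    · simpa using hk
  · have key (k : T.obj (T.obj ((F).obj X)) ⟶ W) : T.map (T.map (Z.hb X Y)) ≫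
        (T.map (B.comul (T.obj Y) ((F).obj X)) ≫
        B.comul (T.obj (T.obj Y)) (T.obj ((F).obj X))) ≫ (T.map (B.mul Y) ≫ B.mul Y) ▷ _ ≫
        T.obj Y ◁ k = T.map (T.map (Z.hb X Y) ≫ B.comul (T.obj Y) ((F).obj X) ≫ B.mul Y ▷ _) ≫
        B.comul (T.obj Y) (T.obj ((F).obj X)) ≫ B.mul Y ▷ _ ≫ T.obj Y ◁ k := by
      simp only [T.map_comp, Category.assoc, comp_whiskerRight]
      rw [reassoc_of% (hB.isBimonad.comul_naturality_left (B.mul Y) (T.obj ((F).obj X)))]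
    exact (key f).trans ((h Y).trans (key f').symm)

/-- The characterization of the canonical law by `∂` alone: by `law_hom_ext` this equation
determines `Ω_X`. -/
theorem hb_law (X Y : C) :
    T.map (Z.hb X Y) ≫ B.comul (T.obj Y) ((F).obj X) ≫ B.mul Y ▷ _ ≫ T.obj Y ◁ (Ω) X =
      B.comul X Y ≫ Z.hb (T.obj X) (T.obj Y) ≫ B.mul Y ▷ _ := by
  have hΩ := (Z.existsUnique_canonicalLaw hB X).choose_spec.1 Y
  -- the coevaluation of `T(Y)` is linear; this cancels the antipode in the definition of `Ω`
  have hc : T.map ((λ_ (X ⊗ Y)).inv ≫ η_ (T.obj Y) (T.obj Y)ᘁ ▷ (X ⊗ Y) ≫ (α_ _ _ _).hom) ≫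
      B.comul (T.obj Y) ((T.obj Y)ᘁ ⊗ X ⊗ Y) ≫ T.obj (T.obj Y) ◁ B.comul ((T.obj Y)ᘁ) (X ⊗ Y) ≫
        B.mul Y ▷ _ ≫ T.obj Y ◁ (T.map ((B.mul Y)ᘁ) ≫ hB.leftAntipode (T.obj Y)) ▷ T.obj (X ⊗ Y) =
      (λ_ (T.obj (X ⊗ Y))).inv ≫ η_ (T.obj Y) (T.obj Y)ᘁ ▷ T.obj (X ⊗ Y) ≫ (α_ _ _ _).hom := by
    let _ := hB.isBimonad.oplax
    exact (coevLin_leftAntipode hB.isBimonad hB.isLeftAntipode_leftAntipode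
      (hB.isBimonad.free Y)).map_coevaluation_whiskerRight (X ⊗ Y)
  calc _ = T.map ((λ_ (X ⊗ Y)).inv ≫ η_ (T.obj Y) (T.obj Y)ᘁ ▷ (X ⊗ Y) ≫ (α_ _ _ _).hom) ≫
        (T.map (T.obj Y ◁ Z.coendι X Y) ≫ B.comul (T.obj Y) ((F).obj X)) ≫ B.mul Y ▷ _ ≫
        T.obj Y ◁ (Ω) X := by
        rw [Z.hb_eq X Y, T.map_comp]; simp only [Category.assoc]
    _ = T.map ((λ_ (X ⊗ Y)).inv ≫ η_ (T.obj Y) (T.obj Y)ᘁ ▷ (X ⊗ Y) ≫ (α_ _ _ _).hom) ≫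
        B.comul (T.obj Y) ((T.obj Y)ᘁ ⊗ X ⊗ Y) ≫ B.mul Y ▷ _ ≫
        T.obj Y ◁ (T.map (Z.coendι X Y) ≫ (Ω) X) := by
      rw [hB.isBimonad.comul_naturality_right, Category.assoc, whisker_exchange_assoc]
      simp only [whiskerLeft_comp]
    _ = (T.map ((λ_ (X ⊗ Y)).inv ≫ η_ (T.obj Y) (T.obj Y)ᘁ ▷ (X ⊗ Y) ≫ (α_ _ _ _).hom) ≫
        B.comul (T.obj Y) ((T.obj Y)ᘁ ⊗ X ⊗ Y) ≫ B.mul Y ▷ T.obj ((T.obj Y)ᘁ ⊗ X ⊗ Y) ≫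
        T.obj Y ◁ B.comul ((T.obj Y)ᘁ) (X ⊗ Y)) ≫
        T.obj Y ◁ (T.obj (T.obj Y)ᘁ ◁ B.comul X Y ≫
          (T.map ((B.mul Y)ᘁ) ≫ hB.leftAntipode (T.obj Y)) ▷ (T.obj X ⊗ T.obj Y)) ≫
        T.obj Y ◁ (((B.mul Y)ᘁ) ▷ _ ≫ Z.coendι (T.obj X) (T.obj Y)) := by
      rw [canonicalLaw, hΩ]; simp
    _ = (T.map ((λ_ (X ⊗ Y)).inv ≫ η_ (T.obj Y) (T.obj Y)ᘁ ▷ (X ⊗ Y) ≫ (α_ _ _ _).hom) ≫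
        B.comul (T.obj Y) ((T.obj Y)ᘁ ⊗ X ⊗ Y) ≫ T.obj (T.obj Y) ◁ B.comul ((T.obj Y)ᘁ) (X ⊗ Y) ≫
        B.mul Y ▷ _ ≫ T.obj Y ◁ (T.map ((B.mul Y)ᘁ) ≫ hB.leftAntipode (T.obj Y)) ▷ T.obj (X ⊗ Y)) ≫
        T.obj Y ◁ (T.obj Y)ᘁ ◁ B.comul X Y ≫
        T.obj Y ◁ (((B.mul Y)ᘁ) ▷ _ ≫ Z.coendι (T.obj X) (T.obj Y)) := by
      rw [← whisker_exchange (B.mul Y),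
        whisker_exchange (T.map ((B.mul Y)ᘁ) ≫ hB.leftAntipode (T.obj Y))]
      simp only [whiskerLeft_comp, Category.assoc]
    _ = B.comul X Y ≫ (λ_ _).inv ≫ (η_ (T.obj Y) (T.obj Y)ᘁ ≫ T.obj Y ◁ ((B.mul Y)ᘁ)) ▷ _ ≫
        (α_ _ _ _).hom ≫ T.obj Y ◁ Z.coendι (T.obj X) (T.obj Y) := by
      rw [hc]
      simp only [Category.assoc, comp_whiskerRight, whiskerLeft_comp]
      rw [← associator_naturality_right_assoc, ← whisker_exchange_assoc,
        ← leftUnitor_inv_naturality_assoc, ← associator_naturality_middle_assoc]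
    _ = _ := by
      rw [coevaluation_comp_rightAdjointMate, Z.hb_eq]
      simp [whisker_exchange]

theorem hb_comp_counit (Y : C) :
    Z.hb (𝟙_ C) Y ≫ T.obj Y ◁ (ZB).counit = (λ_ Y).hom ≫ B.unit Y ≫ (ρ_ (T.obj Y)).inv :=
  (Z.existsUnique_counit B hB.isBimonad).choose_spec.1 Y

theorem hb_comp_comul (X₁ X₂ Y : C) :
    Z.hb (X₁ ⊗ X₂) Y ≫ T.obj Y ◁ (ZB).comul X₁ X₂ =
      (α_ X₁ X₂ Y).hom ≫ X₁ ◁ Z.hb X₂ Y ≫ (α_ _ _ _).inv ≫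
        (Z.hb X₁ (T.obj Y) ≫ B.mul Y ▷ (F).obj X₁) ▷ (F).obj X₂ ≫ (α_ _ _ _).hom := by
  refine ((Z.existsUnique_comul B hB.isBimonad X₁ X₂).choose_spec.1 Y).trans ?_
  simp

theorem law_naturality {X X' : C} (f : X ⟶ X') :
    T.map ((F).map f) ≫ (Ω) X' = (Ω) X ≫ (F).map (T.map f) := by
  refine Z.law_hom_ext hB fun Y => ?_
  rw [hB.isBimonad.comul_mul_whiskerLeft, ← T.map_comp_assoc, ← hb_naturality_left,
    T.map_comp_assoc, hb_law, reassoc_of% (hB.isBimonad.comul_naturality_left f Y),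
    whiskerLeft_comp,
    reassoc_of% (Z.hb_naturality_left (T.map f) (T.obj Y)), whisker_exchange,
    reassoc_of% (Z.hb_law hB X Y)]

theorem unit_law (X : C) : B.unit ((F).obj X) ≫ (Ω) X = (F).map (B.unit X) := by
  refine Z.hom_ext fun Y => ?_
  -- the unit on the right factor alone, written so that `hb_law` applies
  have h1 : T.obj Y ◁ B.unit ((F).obj X) =
      B.unit (T.obj Y ⊗ (F).obj X) ≫ B.comul (T.obj Y) ((F).obj X) ≫ B.mul Y ▷ _ := by
    rw [reassoc_of% (hB.isBimonad.unit_comul (T.obj Y) ((F).obj X)),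
      MonoidalCategory.tensorHom_def', Category.assoc, ← comp_whiskerRight, hB.isBimonad.unit_mul,
      id_whiskerRight, Category.comp_id]
  rw [whiskerLeft_comp, h1, Category.assoc, Category.assoc,
    reassoc_of% (hB.isBimonad.unit_naturality (Z.hb X Y)), hb_law,
    reassoc_of% (hB.isBimonad.unit_comul X Y), reassoc_of% (Z.hb_naturality (B.unit X) (B.unit Y)),
    MonoidalCategory.tensorHom_def', Category.assoc, ← comp_whiskerRight,
    hB.isBimonad.map_unit_mul]
  simp

theorem law_counit :
    T.map (ZB).counit ≫ B.counit = (Ω) (𝟙_ C) ≫ (F).map B.counit ≫ (ZB).counit := by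
  refine Z.law_hom_ext hB fun Y => ?_
  have h1 := Z.hb_naturality_left B.counit (T.obj Y)
  have h2 := hB.isBimonad.comul_counit (T.obj Y)
  have h3 := hB.isBimonad.counit_comul Y
  calc _ = T.map ((λ_ Y).hom ≫ B.unit Y ≫ (ρ_ (T.obj Y)).inv) ≫ (B.comul (T.obj Y) (𝟙_ C) ≫
        T.obj (T.obj Y) ◁ B.counit ≫ (ρ_ _).hom) ≫ B.mul Y ≫ (ρ_ _).inv := by
        rw [hB.isBimonad.comul_mul_whiskerLeft, ← T.map_comp_assoc, Z.hb_comp_counit hB]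
        rw [← whisker_exchange (B.mul Y) B.counit]; monoidal
    _ = T.map (λ_ Y).hom ≫ (T.map (B.unit Y) ≫ B.mul Y) ≫ (ρ_ _).inv := by
      rw [h2, ← T.map_comp_assoc]; simp
    _ = (B.comul (𝟙_ C) Y ≫ B.counit ▷ T.obj Y ≫ (λ_ _).hom) ≫ (B.unit (T.obj Y) ≫ B.mul Y) ≫
        (ρ_ _).inv := by
      rw [hB.isBimonad.map_unit_mul, hB.isBimonad.unit_mul, h3]
    _ = B.comul (𝟙_ C) Y ≫ B.counit ▷ T.obj Y ≫ (Z.hb (𝟙_ C) (T.obj Y) ≫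
        T.obj (T.obj Y) ◁ (ZB).counit) ≫ B.mul Y ▷ _ := by
      rw [Z.hb_comp_counit hB]; simp
    _ = (T.map (Z.hb (𝟙_ C) Y) ≫ B.comul (T.obj Y) ((F).obj (𝟙_ C)) ≫ B.mul Y ▷ _ ≫
        T.obj Y ◁ (Ω) (𝟙_ C)) ≫ T.obj Y ◁ ((F).map B.counit ≫ (ZB).counit) := by
      rw [hb_law, Category.assoc, Category.assoc, Category.assoc, reassoc_of% h1,
        ← whisker_exchange (B.mul Y), whiskerLeft_comp, Category.assoc]
    _ = _ := by simp

theorem law_unit (X : C) : T.map ((ZB).unit X) ≫ (Ω) X = (ZB).unit (T.obj X) := by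
  have h1 := hB.isBimonad.counit_comul ((F).obj X)
  have h2 := hB.isBimonad.comul_counit X
  have h3 := hB.isBimonad.comul_naturality_left B.counit ((F).obj X)
  calc _ = T.map (ρ_ X).inv ≫ T.map (Z.hb X (𝟙_ C)) ≫ B.comul (T.obj (𝟙_ C)) ((F).obj X) ≫
        (T.map B.counit ≫ B.counit) ▷ T.obj ((F).obj X) ≫ (λ_ _).hom ≫ (Ω) X := by
        simp only [bimonadData, T.map_comp, Category.assoc, comp_whiskerRight, ← h1]
        rw [reassoc_of% h3]
    _ = T.map (ρ_ X).inv ≫ (T.map (Z.hb X (𝟙_ C)) ≫ B.comul (T.obj (𝟙_ C)) ((F).obj X) ≫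
        B.mul (𝟙_ C) ▷ T.obj ((F).obj X) ≫ T.obj (𝟙_ C) ◁ (Ω) X) ≫ B.counit ▷ _ ≫ (λ_ _).hom := by
      rw [← hB.isBimonad.mul_counit]
      simp only [Category.assoc, comp_whiskerRight, ← leftUnitor_naturality]
      rw [whisker_exchange_assoc]
    _ = T.map (ρ_ X).inv ≫ B.comul X (𝟙_ C) ≫ Z.hb (T.obj X) (T.obj (𝟙_ C)) ≫
        (T.map B.counit ≫ B.counit) ▷ _ ≫ (λ_ _).hom := by
      rw [hb_law, ← hB.isBimonad.mul_counit]; simp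
    _ = T.map (ρ_ X).inv ≫ (B.comul X (𝟙_ C) ≫ T.obj X ◁ B.counit ≫ (ρ_ _).hom) ≫
        (ρ_ _).inv ≫ Z.hb (T.obj X) (𝟙_ C) ≫ B.counit ▷ _ ≫ (λ_ _).hom := by
      simp only [comp_whiskerRight, Category.assoc, Iso.hom_inv_id_assoc]
      rw [← reassoc_of% (Z.hb_naturality_right (T.obj X) B.counit)]
    _ = _ := by
      rw [h2, ← T.map_comp_assoc]; simp [bimonadData]

theorem law_mul_T (X : C) :
    B.mul ((F).obj X) ≫ (Ω) X = T.map ((Ω) X) ≫ (Ω) (T.obj X) ≫ (F).map (B.mul X) := by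
  refine Z.law_hom_ext_map hB fun Y => ?_
  have h1 := hB.isBimonad.mul_comul (T.obj Y) ((F).obj X)
  have h2 := hB.isBimonad.comul_naturality_left (B.mul Y) (T.obj ((F).obj X))
  have h3 := hB.isBimonad.comul_naturality_left (B.mul Y) ((F).obj (T.obj X))
  have h4 := hB.isBimonad.mul_comul X Y
  calc _ = T.map (T.map (Z.hb X Y)) ≫ (T.map (B.comul (T.obj Y) ((F).obj X)) ≫
        B.comul (T.obj (T.obj Y)) (T.obj ((F).obj X)) ≫ (B.mul (T.obj Y) ⊗ₘ B.mul ((F).obj X))) ≫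
        B.mul Y ▷ _ ≫ T.obj Y ◁ (Ω) X := by
        simp only [T.map_comp, Category.assoc]
        rw [reassoc_of% h2, ← comp_whiskerRight_assoc, hB.isBimonad.mul_assoc,
          MonoidalCategory.tensorHom_def]
        simp only [comp_whiskerRight, Category.assoc, whiskerLeft_comp]
        rw [whisker_exchange_assoc]
    _ = B.mul (X ⊗ Y) ≫ T.map (Z.hb X Y) ≫ B.comul (T.obj Y) ((F).obj X) ≫
        B.mul Y ▷ _ ≫ T.obj Y ◁ (Ω) X := by
      rw [← h1, Category.assoc, reassoc_of% (hB.isBimonad.mul_naturality (Z.hb X Y))]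
    _ = T.map (B.comul X Y) ≫ B.comul (T.obj X) (T.obj Y) ≫
        (B.mul X ⊗ₘ B.mul Y) ≫ Z.hb (T.obj X) (T.obj Y) ≫ B.mul Y ▷ _ := by
      rw [hb_law, reassoc_of% h4]
    _ = T.map (B.comul X Y) ≫ (T.map (Z.hb (T.obj X) (T.obj Y)) ≫
        B.comul (T.obj (T.obj Y)) ((F).obj (T.obj X)) ≫ B.mul (T.obj Y) ▷ _ ≫
        T.obj (T.obj Y) ◁ (Ω) (T.obj X)) ≫ B.mul Y ▷ _ ≫ T.obj Y ◁ (F).map (B.mul X) := by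
      rw [hb_law, reassoc_of% (Z.hb_naturality (B.mul X) (B.mul Y)),
        MonoidalCategory.tensorHom_def']
      simp only [Category.assoc, ← comp_whiskerRight, ← comp_whiskerRight_assoc,
        hB.isBimonad.mul_assoc]
      rw [whisker_exchange]
    _ = T.map (B.comul X Y ≫ Z.hb (T.obj X) (T.obj Y) ≫ B.mul Y ▷ _) ≫
        B.comul (T.obj Y) ((F).obj (T.obj X)) ≫ B.mul Y ▷ _ ≫
        T.obj Y ◁ ((Ω) (T.obj X) ≫ (F).map (B.mul X)) := by
      simp only [T.map_comp, Category.assoc]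
      rw [reassoc_of% h3, ← comp_whiskerRight_assoc, hB.isBimonad.mul_assoc]
      simp only [comp_whiskerRight, Category.assoc, whiskerLeft_comp]
      rw [whisker_exchange_assoc]
    _ = _ := by
      rw [← Z.hb_law hB, hB.isBimonad.comul_mul_whiskerLeft, ← T.map_comp_assoc]
      simp only [Category.assoc]

end Centralizer
end DistributiveLaw

/-! ### Compatibility of the law with the coproduct and the product of the centralizer -/

section DistributiveLawCompatibilities
variable {C : Type u} [Category.{v} C] [MonoidalCategory C]

theorem BimonadData.IsBimonad.coassoc_inv {T : C ⥤ C} {B : BimonadData T} (hB : B.IsBimonad)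
    (X Y W : C) :
    T.map (α_ X Y W).inv ≫ B.comul (X ⊗ Y) W ≫ B.comul X Y ▷ T.obj W =
      B.comul X (Y ⊗ W) ≫ T.obj X ◁ B.comul Y W ≫ (α_ _ _ _).inv := by
  rw [← cancel_mono (α_ (T.obj X) (T.obj Y) (T.obj W)).hom]
  simp only [Category.assoc, hB.coassoc, Iso.inv_hom_id, Category.comp_id]
  rw [← T.map_comp_assoc]; simp

variable [RigidCategory C] {T : C ⥤ C} {B : BimonadData T}

namespace Centralizer
variable (hB : B.IsHopfMonad) (Z : Centralizer T)

local notation "F" => Centralizer.functor Z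
local notation "ZB" => Centralizer.bimonadData Z (BimonadData.IsHopfMonad.isBimonad hB)
local notation "Ω" => Centralizer.canonicalLaw Z hB

theorem hb_comp_mul (X Y₁ Y₂ : C) :
    Z.hb X Y₁ ▷ Y₂ ≫ (α_ _ _ _).hom ≫ T.obj Y₁ ◁ Z.hb ((F).obj X) Y₂ ≫
        T.obj Y₁ ◁ T.obj Y₂ ◁ (ZB).mul X =
      (α_ _ _ _).hom ≫ Z.hb X (Y₁ ⊗ Y₂) ≫ B.comul Y₁ Y₂ ▷ (F).obj X ≫ (α_ _ _ _).hom := by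
  have h := (Z.existsUnique_mul B hB.isBimonad X).choose_spec.1 Y₁ Y₂
  rw [← cancel_epi (α_ X Y₁ Y₂).hom] at h
  refine Eq.trans ?_ h
  simp [hb₂, bimonadData]

/-- The canonical law is comonoidal. -/
theorem law_comul (X Y : C) :
    T.map ((ZB).comul X Y) ≫ B.comul ((F).obj X) ((F).obj Y) ≫ ((Ω) X ⊗ₘ (Ω) Y) =
      (Ω) (X ⊗ Y) ≫ (F).map (B.comul X Y) ≫ (ZB).comul (T.obj X) (T.obj Y) := by
  have hb := hB.isBimonad
  refine Z.law_hom_ext hB fun V => ?_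
  rw [MonoidalCategory.tensorHom_def]
  calc _ = T.map (α_ X Y V).hom ≫ T.map (X ◁ Z.hb Y V) ≫
          T.map (α_ X (T.obj V) ((F).obj Y)).inv ≫
          (T.map ((Z.hb X (T.obj V) ≫ B.mul V ▷ (F).obj X) ▷ (F).obj Y) ≫
            B.comul (T.obj V ⊗ (F).obj X) ((F).obj Y)) ≫
          B.comul (T.obj V) ((F).obj X) ▷ T.obj ((F).obj Y) ≫ (α_ _ _ _).hom ≫ B.mul V ▷ _ ≫
          T.obj V ◁ ((Ω) X ▷ T.obj ((F).obj Y) ≫ (F).obj (T.obj X) ◁ (Ω) Y) := by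
        rw [hb.comul_mul_whiskerLeft, ← T.map_comp_assoc, Z.hb_comp_comul hB]
        simp only [T.map_comp, Category.assoc, whiskerLeft_comp]
        rw [← whisker_exchange_assoc (B.mul V),
          ← reassoc_of% (hb.coassoc (T.obj V) ((F).obj X) ((F).obj Y))]
    _ = T.map (α_ X Y V).hom ≫ T.map (X ◁ Z.hb Y V) ≫
          T.map (α_ X (T.obj V) ((F).obj Y)).inv ≫ B.comul (X ⊗ T.obj V) ((F).obj Y) ≫
          (T.map (Z.hb X (T.obj V)) ≫ (T.map (B.mul V ▷ (F).obj X) ≫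
            B.comul (T.obj V) ((F).obj X)) ≫ B.mul V ▷ _ ≫ T.obj V ◁ (Ω) X) ▷
            T.obj ((F).obj Y) ≫ (α_ _ _ _).hom ≫
          T.obj V ◁ (F).obj (T.obj X) ◁ (Ω) Y := by
      rw [hb.comul_naturality_left, T.map_comp]; monoidal
    _ = T.map (α_ X Y V).hom ≫ T.map (X ◁ Z.hb Y V) ≫
          T.map (α_ X (T.obj V) ((F).obj Y)).inv ≫ B.comul (X ⊗ T.obj V) ((F).obj Y) ≫
          ((T.map (Z.hb X (T.obj V)) ≫ B.comul (T.obj (T.obj V)) ((F).obj X) ≫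
            B.mul (T.obj V) ▷ _ ≫ T.obj (T.obj V) ◁ (Ω) X) ≫ B.mul V ▷ _) ▷
            T.obj ((F).obj Y) ≫ (α_ _ _ _).hom ≫
          T.obj V ◁ (F).obj (T.obj X) ◁ (Ω) Y := by
      rw [hb.comul_naturality_left]
      simp only [Category.assoc]
      rw [whisker_exchange (B.mul V), ← comp_whiskerRight_assoc, ← comp_whiskerRight_assoc,
        hb.mul_assoc]
    _ = T.map (α_ X Y V).hom ≫ T.map (X ◁ Z.hb Y V) ≫
          (T.map (α_ X (T.obj V) ((F).obj Y)).inv ≫ B.comul (X ⊗ T.obj V) ((F).obj Y) ≫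
          B.comul X (T.obj V) ▷ T.obj ((F).obj Y)) ≫ (Z.hb (T.obj X) (T.obj (T.obj V)) ≫
            T.map (B.mul V) ▷ _ ≫ B.mul V ▷ _) ▷
            T.obj ((F).obj Y) ≫ (α_ _ _ _).hom ≫
          T.obj V ◁ (F).obj (T.obj X) ◁ (Ω) Y := by
      rw [hb_law, ← comp_whiskerRight (T.map (B.mul V)), hb.mul_assoc]; monoidal
    _ = T.map (α_ X Y V).hom ≫ B.comul X (Y ⊗ V) ≫
          T.obj X ◁ (T.map (Z.hb Y V) ≫ B.comul (T.obj V) ((F).obj Y) ≫ B.mul V ▷ _) ⊗≫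
          ((Z.hb (T.obj X) (T.obj V) ≫ B.mul V ▷ _) ▷ T.obj ((F).obj Y) ≫
          (T.obj V ⊗ (F).obj (T.obj X)) ◁ (Ω) Y) ⊗≫ 𝟙 _ := by
      rw [hb.coassoc_inv, Category.assoc, reassoc_of% (hb.comul_naturality_right X (Z.hb Y V)),
        ← reassoc_of% (Z.hb_naturality_right (T.obj X) (B.mul V))]
      monoidal
    _ = T.map (α_ X Y V).hom ≫ B.comul X (Y ⊗ V) ≫
          T.obj X ◁ (T.map (Z.hb Y V) ≫ B.comul (T.obj V) ((F).obj Y) ≫ B.mul V ▷ _ ≫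
            T.obj V ◁ (Ω) Y) ⊗≫
          (Z.hb (T.obj X) (T.obj V) ≫ B.mul V ▷ _) ▷ (F).obj (T.obj Y) ⊗≫ 𝟙 _ := by
      rw [← whisker_exchange]; monoidal
    _ = (T.map (α_ X Y V).hom ≫ B.comul X (Y ⊗ V) ≫ T.obj X ◁ B.comul Y V) ≫
          T.obj X ◁ (Z.hb (T.obj Y) (T.obj V) ≫ B.mul V ▷ _) ⊗≫
          (Z.hb (T.obj X) (T.obj V) ≫ B.mul V ▷ _) ▷ (F).obj (T.obj Y) ⊗≫ 𝟙 _ := by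
      rw [hb_law]; monoidal
    _ = B.comul (X ⊗ Y) V ≫ B.comul X Y ▷ T.obj V ⊗≫ T.obj X ◁ Z.hb (T.obj Y) (T.obj V) ⊗≫
          (T.obj X ◁ B.mul V ≫ Z.hb (T.obj X) (T.obj V)) ▷ (F).obj (T.obj Y) ⊗≫
          B.mul V ▷ ((F).obj (T.obj X) ⊗ (F).obj (T.obj Y)) := by
      rw [← hb.coassoc]; monoidal
    _ = B.comul (X ⊗ Y) V ≫ B.comul X Y ▷ T.obj V ≫ ((α_ _ _ _).hom ≫
          T.obj X ◁ Z.hb (T.obj Y) (T.obj V) ≫ (α_ _ _ _).inv ≫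
          (Z.hb (T.obj X) (T.obj (T.obj V)) ≫ B.mul (T.obj V) ▷ _) ▷ (F).obj (T.obj Y) ≫
          (α_ _ _ _).hom) ≫ B.mul V ▷ ((F).obj (T.obj X) ⊗ (F).obj (T.obj Y)) := by
      rw [hb_naturality_right]
      have h : B.mul (T.obj V) ≫ B.mul V = T.map (B.mul V) ≫ B.mul V := (hb.mul_assoc V).symm
      calc _ = B.comul (X ⊗ Y) V ≫ B.comul X Y ▷ T.obj V ⊗≫
            T.obj X ◁ Z.hb (T.obj Y) (T.obj V) ⊗≫
            Z.hb (T.obj X) (T.obj (T.obj V)) ▷ (F).obj (T.obj Y) ⊗≫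
            (T.map (B.mul V) ≫ B.mul V) ▷ ((F).obj (T.obj X) ⊗ (F).obj (T.obj Y)) := by
            monoidal
        _ = _ := by rw [← h]; monoidal
    _ = B.comul (X ⊗ Y) V ≫ (B.comul X Y ▷ T.obj V ≫ Z.hb (T.obj X ⊗ T.obj Y) (T.obj V)) ≫
          T.obj (T.obj V) ◁ (ZB).comul (T.obj X) (T.obj Y) ≫
          B.mul V ▷ ((F).obj (T.obj X) ⊗ (F).obj (T.obj Y)) := by
      rw [← Z.hb_comp_comul hB]; simp only [Category.assoc]
    _ = (B.comul (X ⊗ Y) V ≫ Z.hb (T.obj (X ⊗ Y)) (T.obj V) ≫ B.mul V ▷ _) ≫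
          T.obj V ◁ ((F).map (B.comul X Y) ≫ (ZB).comul (T.obj X) (T.obj Y)) := by
      rw [hb_naturality_left]
      simp only [Category.assoc, whiskerLeft_comp]
      rw [whisker_exchange, whisker_exchange_assoc]
    _ = _ := by rw [← Z.hb_law hB]; simp only [Category.assoc, whiskerLeft_comp]

/-- The canonical law is compatible with the product of the centralizer. Both sides are tested on
`T(∂_{X,Y₁} ⊗ Y₂)` and `T(∂_{F(X),Y₂})`. -/
theorem law_mul (X : C) :
    T.map ((ZB).mul X) ≫ (Ω) X = (Ω) ((F).obj X) ≫ (F).map ((Ω) X) ≫ (ZB).mul (T.obj X) := by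
  have hb := hB.isBimonad
  refine Z.law_hom_ext hB fun Y₂ => Z.law_hom_ext_tensor hB fun Y₁ => ?_
  calc _ = T.map (Z.hb X Y₁ ▷ Y₂ ≫ (α_ _ _ _).hom ≫ T.obj Y₁ ◁ Z.hb ((F).obj X) Y₂ ≫
          T.obj Y₁ ◁ T.obj Y₂ ◁ (ZB).mul X) ≫ B.comul (T.obj Y₁) (T.obj Y₂ ⊗ (F).obj X) ≫
          B.mul Y₁ ▷ _ ≫ T.obj Y₁ ◁ (B.comul (T.obj Y₂) ((F).obj X) ≫ B.mul Y₂ ▷ _ ≫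
          T.obj Y₂ ◁ (Ω) X) := by
        rw [hb.comul_mul_whiskerLeft, hb.comul_mul_whiskerLeft, hb.comul_mul_whiskerLeft]
        simp only [← T.map_comp_assoc, Category.assoc]
    _ = T.map (α_ X Y₁ Y₂).hom ≫ T.map (Z.hb X (Y₁ ⊗ Y₂)) ≫
          T.map (B.comul Y₁ Y₂ ▷ (F).obj X) ≫ (T.map (α_ (T.obj Y₁) (T.obj Y₂) ((F).obj X)).hom ≫
          B.comul (T.obj Y₁) (T.obj Y₂ ⊗ (F).obj X) ≫
          T.obj (T.obj Y₁) ◁ B.comul (T.obj Y₂) ((F).obj X)) ≫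
          B.mul Y₁ ▷ _ ≫ T.obj Y₁ ◁ (B.mul Y₂ ▷ _ ≫ T.obj Y₂ ◁ (Ω) X) := by
      rw [Z.hb_comp_mul hB, whiskerLeft_comp, ← whisker_exchange_assoc]
      simp only [T.map_comp, Category.assoc]
    _ = T.map (α_ X Y₁ Y₂).hom ≫ T.map (Z.hb X (Y₁ ⊗ Y₂)) ≫
          B.comul (T.obj (Y₁ ⊗ Y₂)) ((F).obj X) ≫
          (T.map (B.comul Y₁ Y₂) ≫ B.comul (T.obj Y₁) (T.obj Y₂) ≫
            (B.mul Y₁ ⊗ₘ B.mul Y₂)) ▷ T.obj ((F).obj X) ≫ (α_ _ _ _).hom ≫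
          T.obj Y₁ ◁ T.obj Y₂ ◁ (Ω) X := by
      rw [← hb.coassoc, MonoidalCategory.tensorHom_def]
      simp only [Category.assoc, comp_whiskerRight]
      rw [reassoc_of% (hb.comul_naturality_left (B.comul Y₁ Y₂) ((F).obj X))]
      monoidal
    _ = T.map (α_ X Y₁ Y₂).hom ≫ (T.map (Z.hb X (Y₁ ⊗ Y₂)) ≫
          B.comul (T.obj (Y₁ ⊗ Y₂)) ((F).obj X) ≫ B.mul (Y₁ ⊗ Y₂) ▷ _ ≫
          T.obj (Y₁ ⊗ Y₂) ◁ (Ω) X) ≫ B.comul Y₁ Y₂ ▷ _ ≫ (α_ _ _ _).hom := by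
      rw [← hb.mul_comul]
      simp only [Category.assoc, comp_whiskerRight]
      rw [← associator_naturality_right, whisker_exchange_assoc]
    _ = T.map (α_ X Y₁ Y₂).hom ≫ B.comul X (Y₁ ⊗ Y₂) ≫ (Z.hb (T.obj X) (T.obj (Y₁ ⊗ Y₂)) ≫
          T.map (B.comul Y₁ Y₂) ▷ _) ≫ B.comul (T.obj Y₁) (T.obj Y₂) ▷ _ ≫
            (B.mul Y₁ ⊗ₘ B.mul Y₂) ▷ _ ≫ (α_ _ _ _).hom := by
      rw [hb_law]
      simp only [Category.assoc, ← comp_whiskerRight_assoc]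
      rw [← hb.mul_comul]
    _ = (T.map (α_ X Y₁ Y₂).hom ≫ B.comul X (Y₁ ⊗ Y₂) ≫ T.obj X ◁ B.comul Y₁ Y₂) ≫
          Z.hb (T.obj X) (T.obj Y₁ ⊗ T.obj Y₂) ≫ B.comul (T.obj Y₁) (T.obj Y₂) ▷ _ ≫
            (B.mul Y₁ ⊗ₘ B.mul Y₂) ▷ _ ≫ (α_ _ _ _).hom := by
      rw [← hb_naturality_right]; simp only [Category.assoc]
    _ = B.comul (X ⊗ Y₁) Y₂ ≫ B.comul X Y₁ ▷ T.obj Y₂ ≫ ((α_ _ _ _).hom ≫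
          Z.hb (T.obj X) (T.obj Y₁ ⊗ T.obj Y₂) ≫ B.comul (T.obj Y₁) (T.obj Y₂) ▷ _ ≫
          (α_ _ _ _).hom) ≫ B.mul Y₁ ▷ _ ≫ T.obj Y₁ ◁ B.mul Y₂ ▷ _ := by
      rw [← hb.coassoc, MonoidalCategory.tensorHom_def]; monoidal
    _ = B.comul (X ⊗ Y₁) Y₂ ≫ B.comul X Y₁ ▷ T.obj Y₂ ≫
          Z.hb (T.obj X) (T.obj Y₁) ▷ T.obj Y₂ ≫ (α_ _ _ _).hom ≫
          T.obj (T.obj Y₁) ◁ (Z.hb ((F).obj (T.obj X)) (T.obj Y₂) ≫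
          T.obj (T.obj Y₂) ◁ (ZB).mul (T.obj X)) ≫ B.mul Y₁ ▷ _ ≫ T.obj Y₁ ◁ B.mul Y₂ ▷ _ := by
      rw [← Z.hb_comp_mul hB]; simp only [Category.assoc, whiskerLeft_comp]
    _ = B.comul (X ⊗ Y₁) Y₂ ≫ (B.comul X Y₁ ≫ Z.hb (T.obj X) (T.obj Y₁) ≫ B.mul Y₁ ▷ _) ▷
          T.obj Y₂ ≫ (α_ _ _ _).hom ≫
          T.obj Y₁ ◁ (Z.hb ((F).obj (T.obj X)) (T.obj Y₂) ≫ B.mul Y₂ ▷ _ ≫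
          T.obj Y₂ ◁ (ZB).mul (T.obj X)) := by
      rw [whisker_exchange_assoc, ← whisker_exchange (B.mul Y₂)]; monoidal
    _ = B.comul (X ⊗ Y₁) Y₂ ≫ (T.map (Z.hb X Y₁) ≫ B.comul (T.obj Y₁) ((F).obj X) ≫
          B.mul Y₁ ▷ _) ▷ T.obj Y₂ ≫ (α_ _ _ _).hom ≫ T.obj Y₁ ◁ ((Ω) X ▷ _ ≫
          Z.hb ((F).obj (T.obj X)) (T.obj Y₂) ≫ B.mul Y₂ ▷ _ ≫
          T.obj Y₂ ◁ (ZB).mul (T.obj X)) := by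
      rw [← Z.hb_law hB]; monoidal
    _ = T.map (Z.hb X Y₁ ▷ Y₂) ≫ (B.comul (T.obj Y₁ ⊗ (F).obj X) Y₂ ≫
          B.comul (T.obj Y₁) ((F).obj X) ▷ T.obj Y₂ ≫ (α_ _ _ _).hom) ≫
          B.mul Y₁ ▷ _ ≫ T.obj Y₁ ◁ (Z.hb (T.obj ((F).obj X)) (T.obj Y₂) ≫
          B.mul Y₂ ▷ _ ≫
          T.obj Y₂ ◁ ((F).map ((Ω) X) ≫ (ZB).mul (T.obj X))) := by
      rw [reassoc_of% (Z.hb_naturality_left ((Ω) X) (T.obj Y₂)), whiskerLeft_comp (T.obj Y₂),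
        whisker_exchange_assoc]
      simp only [Category.assoc]
      rw [reassoc_of% (hb.comul_naturality_left (Z.hb X Y₁) Y₂)]
      monoidal
    _ = T.map (Z.hb X Y₁ ▷ Y₂ ≫ (α_ _ _ _).hom) ≫ B.comul (T.obj Y₁) ((F).obj X ⊗ Y₂) ≫
          B.mul Y₁ ▷ _ ≫ T.obj Y₁ ◁ ((B.comul ((F).obj X) Y₂ ≫
          Z.hb (T.obj ((F).obj X)) (T.obj Y₂) ≫ B.mul Y₂ ▷ _) ≫
          T.obj Y₂ ◁ ((F).map ((Ω) X) ≫ (ZB).mul (T.obj X))) := by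
      rw [hb.coassoc, T.map_comp]
      simp only [Category.assoc, whiskerLeft_comp]
      rw [whisker_exchange_assoc]
    _ = _ := by
      rw [← Z.hb_law hB]; simp only [Category.assoc, whiskerLeft_comp]

end Centralizer
end DistributiveLawCompatibilities

/-! ### Composites of bimonads -/

section CompositeBimonad
variable {C : Type u} [Category.{v} C] [MonoidalCategory C] {S T : C ⥤ C}

/-- A comonoidal distributive law `ω : T S ⟶ S T` of the bimonad `T` over the bimonad `S`. -/
structure BimonadData.IsDistributiveLaw (A : BimonadData S) (B : BimonadData T)
    (ω : ∀ X : C, T.obj (S.obj X) ⟶ S.obj (T.obj X)) : Prop where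
  naturality : ∀ {X Y : C} (f : X ⟶ Y), T.map (S.map f) ≫ ω Y = ω X ≫ S.map (T.map f)
  unit_comp : ∀ X : C, B.unit (S.obj X) ≫ ω X = S.map (B.unit X)
  map_unit_comp : ∀ X : C, T.map (A.unit X) ≫ ω X = A.unit (T.obj X)
  mul_comp : ∀ X : C,
    B.mul (S.obj X) ≫ ω X = T.map (ω X) ≫ ω (T.obj X) ≫ S.map (B.mul X)
  map_mul_comp : ∀ X : C,
    T.map (A.mul X) ≫ ω X = ω (S.obj X) ≫ S.map (ω X) ≫ A.mul (T.obj X)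
  comul : ∀ X Y : C,
    T.map (A.comul X Y) ≫ B.comul (S.obj X) (S.obj Y) ≫ (ω X ⊗ₘ ω Y) =
      ω (X ⊗ Y) ≫ S.map (B.comul X Y) ≫ A.comul (T.obj X) (T.obj Y)
  counit : T.map A.counit ≫ B.counit = ω (𝟙_ C) ≫ S.map B.counit ≫ A.counit

namespace BimonadData

/-- The action `S(μ_X) ω_{T(X)}` of `T` on `S(T(X))`. -/
def compositeAction (B : BimonadData T) (ω : ∀ X : C, T.obj (S.obj X) ⟶ S.obj (T.obj X)) (X : C) :
    T.obj (S.obj (T.obj X)) ⟶ S.obj (T.obj X) :=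
  ω (T.obj X) ≫ S.map (B.mul X)

/-- The structure maps of the composite `S ∘_ω T`. -/
def composite (A : BimonadData S) (B : BimonadData T)
    (ω : ∀ X : C, T.obj (S.obj X) ⟶ S.obj (T.obj X)) : BimonadData (T ⋙ S) where
  mul X := S.map (B.compositeAction ω X) ≫ A.mul (T.obj X)
  unit X := B.unit X ≫ A.unit (T.obj X)
  comul X Y := S.map (B.comul X Y) ≫ A.comul (T.obj X) (T.obj Y)
  counit := S.map B.counit ≫ A.counit

namespace IsDistributiveLaw
variable {A : BimonadData S} {B : BimonadData T}
  {ω : ∀ X : C, T.obj (S.obj X) ⟶ S.obj (T.obj X)} (h : A.IsDistributiveLaw B ω)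
include h

theorem action_naturality (hB : B.IsBimonad) {X Y : C} (f : X ⟶ Y) :
    T.map (S.map (T.map f)) ≫ B.compositeAction ω Y = B.compositeAction ω X ≫ S.map (T.map f) := by
  dsimp only [compositeAction]
  rw [reassoc_of% (h.naturality (T.map f)), ← S.map_comp, hB.mul_naturality, S.map_comp,
    Category.assoc]

theorem isAction_compositeAction (hB : B.IsBimonad) (X : C) :
    B.IsAction (B.compositeAction ω X) where
  assoc := by
    dsimp only [compositeAction]
    rw [reassoc_of% (h.mul_comp (T.obj X)), T.map_comp, Category.assoc,
      reassoc_of% (h.naturality (B.mul X)), ← S.map_comp, ← S.map_comp, hB.mul_assoc]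
  unit := by
    dsimp only [compositeAction]
    rw [reassoc_of% (h.unit_comp (T.obj X)), ← S.map_comp, hB.unit_mul, S.map_id]

theorem map_unit_action (hA : A.IsBimonad) (X : C) :
    T.map (A.unit (T.obj X)) ≫ B.compositeAction ω X = B.mul X ≫ A.unit (T.obj X) := by
  dsimp only [compositeAction]
  rw [reassoc_of% (h.map_unit_comp (T.obj X)), hA.unit_naturality]

theorem map_map_unit_action (hB : B.IsBimonad) (X : C) :
    T.map (S.map (B.unit X)) ≫ B.compositeAction ω X = ω X := by
  dsimp only [compositeAction]
  rw [reassoc_of% (h.naturality (B.unit X)), ← S.map_comp, hB.map_unit_mul, S.map_id,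
    Category.comp_id]

/-- The action of `T` on the product of the composite. -/
theorem map_mul_action (hA : A.IsBimonad) (X : C) :
    T.map (S.map (B.compositeAction ω X) ≫ A.mul (T.obj X)) ≫ B.compositeAction ω X =
      ω (T.obj (S.obj (T.obj X))) ≫ S.map (T.map (B.compositeAction ω X) ≫ B.compositeAction ω X) ≫
        A.mul (T.obj X) := by
  have key : T.map (A.mul (T.obj X)) ≫ B.compositeAction ω X =
      ω (S.obj (T.obj X)) ≫ S.map (B.compositeAction ω X) ≫ A.mul (T.obj X) := by
    dsimp only [compositeAction]
    rw [reassoc_of% (h.map_mul_comp (T.obj X)), ← hA.mul_naturality, S.map_comp, Category.assoc]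
  rw [T.map_comp, Category.assoc, key, reassoc_of% (h.naturality (B.compositeAction ω X)),
    S.map_comp, Category.assoc]

/-- The coproduct of the composite is linear for the actions of `T`. -/
theorem comul_action (hA : A.IsBimonad) (hB : B.IsBimonad) (X Y : C) :
    T.map ((A.composite B ω).comul X Y) ≫ B.comul (S.obj (T.obj X)) (S.obj (T.obj Y)) ≫
        (B.compositeAction ω X ⊗ₘ B.compositeAction ω Y) =
      B.compositeAction ω (X ⊗ Y) ≫ (A.composite B ω).comul X Y := by
  dsimp only [composite, compositeAction]
  rw [← tensorHom_comp_tensorHom, T.map_comp, Category.assoc,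
    reassoc_of% (h.comul (T.obj X) (T.obj Y)), ← hA.comul_naturality,
    reassoc_of% (h.naturality (B.comul X Y)), Category.assoc]
  simp only [← S.map_comp_assoc]
  rw [hB.mul_comul]

theorem counit_action (hB : B.IsBimonad) :
    T.map (A.composite B ω).counit ≫ B.counit =
      B.compositeAction ω (𝟙_ C) ≫ (A.composite B ω).counit := by
  dsimp only [composite, compositeAction]
  rw [T.map_comp, Category.assoc, h.counit, reassoc_of% (h.naturality B.counit), Category.assoc]
  simp only [← S.map_comp_assoc]
  rw [hB.mul_counit]

/-- The composite of two bimonads along a comonoidal distributive law is a bimonad. -/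
theorem isBimonad_composite (hA : A.IsBimonad) (hB : B.IsBimonad) :
    (A.composite B ω).IsBimonad where
  mul_naturality f := by
    dsimp only [composite, Functor.comp_map, Functor.comp_obj]
    rw [← S.map_comp_assoc, h.action_naturality hB, S.map_comp, Category.assoc, hA.mul_naturality,
      Category.assoc]
  unit_naturality f := by
    dsimp only [composite, Functor.comp_map, Functor.comp_obj]
    rw [reassoc_of% (hB.unit_naturality f), hA.unit_naturality, Category.assoc]
  comul_naturality f g := by
    dsimp only [composite, Functor.comp_map, Functor.comp_obj]
    rw [← S.map_comp_assoc, hB.comul_naturality, S.map_comp, Category.assoc, hA.comul_naturality,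
      Category.assoc]
  mul_assoc X := by
    have h1 := h.map_mul_action hA X
    have h2 := (h.isAction_compositeAction hB X).assoc
    dsimp only [composite, Functor.comp_map, Functor.comp_obj]
    rw [← S.map_comp_assoc, h1, h2]
    simp only [S.map_comp, Category.assoc]
    rw [← reassoc_of% (hA.mul_naturality (B.compositeAction ω X)), hA.mul_assoc]
    simp only [compositeAction, S.map_comp, Category.assoc]
  unit_mul X := by
    dsimp only [composite, Functor.comp_map, Functor.comp_obj]
    rw [Category.assoc, ← reassoc_of% (hA.unit_naturality (B.compositeAction ω X)), hA.unit_mul,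
      Category.comp_id, (h.isAction_compositeAction hB X).unit]
  map_unit_mul X := by
    dsimp only [composite, Functor.comp_map, Functor.comp_obj]
    rw [← S.map_comp_assoc, T.map_comp, Category.assoc, h.map_unit_action hA,
      reassoc_of% (hB.map_unit_mul X), hA.map_unit_mul]
  coassoc X Y W := by
    let _ := hA.oplax
    let _ := hB.oplax
    exact Functor.OplaxMonoidal.associativity (T ⋙ S) X Y W
  counit_comul X := by
    let _ := hA.oplax
    let _ := hB.oplax
    exact Functor.OplaxMonoidal.left_unitality_hom (T ⋙ S) X
  comul_counit X := by
    let _ := hA.oplax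
    let _ := hB.oplax
    exact Functor.OplaxMonoidal.right_unitality_hom (T ⋙ S) X
  mul_comul X Y := by
    have h1 := h.comul_action hA hB X Y
    dsimp only [composite, Functor.comp_map, Functor.comp_obj] at h1 ⊢
    rw [← tensorHom_comp_tensorHom, Category.assoc]
    simp only [Category.assoc]
    rw [← reassoc_of% (hA.comul_naturality (B.compositeAction ω X) (B.compositeAction ω Y)),
      ← reassoc_of% (hA.mul_naturality (B.comul X Y)), hA.mul_comul]
    simp only [← S.map_comp_assoc]
    rw [h1]
  mul_counit := by
    have h1 := h.counit_action hB
    dsimp only [composite, Functor.comp_map, Functor.comp_obj] at h1 ⊢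
    rw [Category.assoc, ← reassoc_of% (hA.mul_naturality B.counit), hA.mul_counit]
    simp only [← S.map_comp_assoc]
    rw [h1]
  unit_comul X Y := by
    dsimp only [composite, Functor.comp_map, Functor.comp_obj]
    rw [Category.assoc, ← reassoc_of% (hA.unit_naturality (B.comul X Y)), hA.unit_comul,
      reassoc_of% (hB.unit_comul X Y), tensorHom_comp_tensorHom]
  unit_counit := by
    dsimp only [composite, Functor.comp_map, Functor.comp_obj]
    rw [Category.assoc, ← reassoc_of% (hA.unit_naturality B.counit), hA.unit_counit,
      Category.comp_id, hB.unit_counit]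

end IsDistributiveLaw
end BimonadData
end CompositeBimonad

/-! ### Antipodes from linear pairings -/

section AntipodeCriterion
variable {C : Type u} [Category.{v} C] [MonoidalCategory C] {S T : C ⥤ C} {B : BimonadData T}

open Functor.OplaxMonoidal

/-- An evaluation which is linear for `T` and for `S` is linear for the composite. -/
theorem EvLin.comp [S.OplaxMonoidal] [T.OplaxMonoidal] {M N : C} [ExactPairing M N]
    {r : T.obj M ⟶ M} {t : T.obj N ⟶ N} {r' : S.obj M ⟶ M} {t' : S.obj N ⟶ N}
    (h : EvLin T r t) (h' : EvLin S r' t') : EvLin (T ⋙ S) (S.map r ≫ r') (S.map t ≫ t') := by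
  unfold EvLin at *
  simp only [comp_η, comp_δ, Functor.comp_map, Category.assoc]
  rw [← S.map_comp_assoc, h, ← tensorHom_comp_tensorHom]
  simp only [S.map_comp, Category.assoc]
  rw [h', δ_natural_assoc]

/-- A coevaluation which is linear for `T` and for `S` is linear for the composite. -/
theorem CoevLin.comp [S.OplaxMonoidal] [T.OplaxMonoidal] {M N : C} [ExactPairing M N]
    {r : T.obj M ⟶ M} {t : T.obj N ⟶ N} {r' : S.obj M ⟶ M} {t' : S.obj N ⟶ N}
    (h : CoevLin T r t) (h' : CoevLin S r' t') :
    CoevLin (T ⋙ S) (S.map r ≫ r') (S.map t ≫ t') := by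
  unfold CoevLin at *
  simp only [comp_η, comp_δ, Functor.comp_map, Category.assoc]
  rw [h', ← S.map_comp_assoc, h, ← tensorHom_comp_tensorHom]
  simp only [S.map_comp, Category.assoc]
  rw [δ_natural_assoc]

/-- A bimonad has a left antipode as soon as the pairings of the free modules with their duals
are linear for some structure maps on the duals: naturality comes from the fact that mates of
linear maps are linear. -/
theorem BimonadData.IsBimonad.exists_isLeftAntipode [RightRigidCategory C] (h : B.IsBimonad)
    (H : ∀ X : C, ∃ t : T.obj ((T.obj X)ᘁ) ⟶ (T.obj X)ᘁ,
      @EvLin _ _ _ T h.oplax _ _ _ (B.mul X) t ∧ @CoevLin _ _ _ T h.oplax _ _ _ (B.mul X) t) :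
    ∃ s, B.IsLeftAntipode s := by
  choose t he hc using H
  have lin {X Y : C} (f : T.obj X ⟶ T.obj Y) (hf : T.map f ≫ B.mul Y = B.mul X ≫ f) :
      T.map (fᘁ) ≫ t X = t Y ≫ fᘁ := by
    let _ := h.oplax
    exact mate_linear_right (isMate_right f) (hc X) (he Y) hf
  -- the antipode is the structure map of the dual followed by the transpose of the unit
  refine ⟨fun X => t X ≫ (B.unit X)ᘁ, ⟨fun {X Y} f => ?_, fun X => ?_, fun X => ?_⟩⟩
  · rw [reassoc_of% (lin (T.map f) (h.mul_naturality f)), ← rightMate_comp, ← h.unit_naturality,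
      rightMate_comp, Category.assoc]
  · have he' : T.map (ε_ (T.obj X) ((T.obj X)ᘁ)) ≫ B.counit =
        B.comul ((T.obj X)ᘁ) (T.obj X) ≫ (t X ⊗ₘ B.mul X) ≫ ε_ (T.obj X) ((T.obj X)ᘁ) := he X
    have e : T.map ((B.mul X)ᘁ) ≫ t (T.obj X) ≫ (B.unit (T.obj X))ᘁ = t X := by
      rw [reassoc_of% (lin (B.mul X) (h.mul_assoc X)), ← rightMate_comp, h.unit_mul,
        rightAdjointMate_id, Category.comp_id]
    rw [e, rightAdjointMate_comp_evaluation, T.map_comp, Category.assoc, he',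
      reassoc_of% (h.comul_naturality_right ((T.obj X)ᘁ) (B.unit X)),
      MonoidalCategory.tensorHom_def', Category.assoc, ← whiskerLeft_comp_assoc, h.map_unit_mul,
      whiskerLeft_id, Category.id_comp]
  · have hc' : B.counit ≫ η_ (T.obj X) ((T.obj X)ᘁ) = T.map (η_ (T.obj X) ((T.obj X)ᘁ)) ≫
        B.comul (T.obj X) ((T.obj X)ᘁ) ≫ (B.mul X ⊗ₘ t X) := hc X
    rw [← coevaluation_comp_rightAdjointMate, reassoc_of% hc', ← id_tensorHom,
      tensorHom_comp_tensorHom, Category.comp_id]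

/-- The mirror image of `exists_isLeftAntipode`. -/
theorem BimonadData.IsBimonad.exists_isRightAntipode [LeftRigidCategory C] (h : B.IsBimonad)
    (H : ∀ X : C, ∃ t : T.obj (ᘁ(T.obj X)) ⟶ ᘁ(T.obj X),
      @EvLin _ _ _ T h.oplax (ᘁ(T.obj X)) (T.obj X) _ t (B.mul X) ∧
      @CoevLin _ _ _ T h.oplax (ᘁ(T.obj X)) (T.obj X) _ t (B.mul X)) :
    ∃ s, B.IsRightAntipode s := by
  choose t he hc using H
  have lin {X Y : C} (f : T.obj X ⟶ T.obj Y) (hf : T.map f ≫ B.mul Y = B.mul X ≫ f) :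
      T.map (ᘁf) ≫ t X = t Y ≫ (ᘁf) := by
    let _ := h.oplax
    exact mate_linear_left (isMate_left f) (he Y) (hc X) hf
  refine ⟨fun X => t X ≫ (ᘁ(B.unit X)), ⟨fun {X Y} f => ?_, fun X => ?_, fun X => ?_⟩⟩
  · rw [reassoc_of% (lin (T.map f) (h.mul_naturality f)), ← leftMate_comp, ← h.unit_naturality,
      leftMate_comp, Category.assoc]
  · have he' : T.map (ε_ (ᘁ(T.obj X)) (T.obj X)) ≫ B.counit =
        B.comul (T.obj X) (ᘁ(T.obj X)) ≫ (B.mul X ⊗ₘ t X) ≫ ε_ (ᘁ(T.obj X)) (T.obj X) := he X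
    have e : T.map (ᘁ(B.mul X)) ≫ t (T.obj X) ≫ (ᘁ(B.unit (T.obj X))) = t X := by
      rw [reassoc_of% (lin (B.mul X) (h.mul_assoc X)), ← leftMate_comp, h.unit_mul,
        leftAdjointMate_id, Category.comp_id]
    rw [e, leftAdjointMate_comp_evaluation, T.map_comp, Category.assoc, he',
      reassoc_of% (h.comul_naturality_left (B.unit X) (ᘁ(T.obj X))),
      MonoidalCategory.tensorHom_def, Category.assoc, ← comp_whiskerRight_assoc, h.map_unit_mul,
      id_whiskerRight, Category.id_comp]
  · have hc' : B.counit ≫ η_ (ᘁ(T.obj X)) (T.obj X) = T.map (η_ (ᘁ(T.obj X)) (T.obj X)) ≫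
        B.comul (ᘁ(T.obj X)) (T.obj X) ≫ (t X ⊗ₘ B.mul X) := hc X
    rw [← coevaluation_comp_leftAdjointMate, reassoc_of% hc', ← tensorHom_id,
      tensorHom_comp_tensorHom, Category.comp_id]

end AntipodeCriterion

/-! ### Moving an object past a dual pair -/

section Swaps
variable {C : Type u} [Category.{v} C] [MonoidalCategory C]

/-- A morphism `c : M ⊗ P ⟶ P ⊗ M` is invertible if there is `c' : M ⊗ Q ⟶ Q ⊗ M`, for a dual `Q`
of `P`, such that moving `M` past the pairing of `P` and `Q` by `c` and `c'` is trivial. -/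
theorem isIso_swap_of_dual {M P Q : C} [ExactPairing Q P] (c : M ⊗ P ⟶ P ⊗ M)
    (c' : M ⊗ Q ⟶ Q ⊗ M)
    (hε : c ▷ Q ⊗≫ P ◁ c' ⊗≫ ε_ Q P ▷ M = 𝟙 ((M ⊗ P) ⊗ Q) ⊗≫ M ◁ ε_ Q P ⊗≫ 𝟙 (𝟙_ C ⊗ M))
    (hη : M ◁ η_ Q P ⊗≫ c' ▷ P ⊗≫ Q ◁ c =
      𝟙 (M ⊗ 𝟙_ C) ⊗≫ η_ Q P ▷ M ⊗≫ 𝟙 (Q ⊗ P ⊗ M)) : IsIso c := by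
  -- the inverse is the rotation of `c'` around the pairing
  refine ⟨𝟙 _ ⊗≫ (P ⊗ M) ◁ η_ Q P ⊗≫ P ◁ c' ▷ P ⊗≫ ε_ Q P ▷ (M ⊗ P) ⊗≫ 𝟙 _, ?_, ?_⟩
  · calc _ = 𝟙 _ ⊗≫ (c ▷ 𝟙_ C ≫ (P ⊗ M) ◁ η_ Q P) ⊗≫ P ◁ c' ▷ P ⊗≫
          ε_ Q P ▷ (M ⊗ P) ⊗≫ 𝟙 _ := by monoidal
      _ = 𝟙 _ ⊗≫ (M ⊗ P) ◁ η_ Q P ⊗≫ (c ▷ Q ⊗≫ P ◁ c' ⊗≫ ε_ Q P ▷ M) ▷ P ⊗≫ 𝟙 _ := by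
        rw [← whisker_exchange]; monoidal
      _ = 𝟙 _ ⊗≫ M ◁ (P ◁ η_ Q P ⊗≫ ε_ Q P ▷ P) ⊗≫ 𝟙 _ := by rw [hε]; monoidal
      _ = _ := by rw [ExactPairing.coevaluation_evaluation'']; monoidal
  · calc _ = 𝟙 _ ⊗≫ (P ⊗ M) ◁ η_ Q P ⊗≫ P ◁ c' ▷ P ⊗≫
          (ε_ Q P ▷ (M ⊗ P) ≫ 𝟙_ C ◁ c) ⊗≫ 𝟙 _ := by monoidal
      _ = 𝟙 _ ⊗≫ P ◁ (𝟙 (M ⊗ 𝟙_ C) ⊗≫ M ◁ η_ Q P ⊗≫ c' ▷ P ⊗≫ Q ◁ c) ⊗≫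
          ε_ Q P ▷ (P ⊗ M) ⊗≫ 𝟙 _ := by
        rw [← whisker_exchange]; monoidal
      _ = 𝟙 _ ⊗≫ (P ◁ η_ Q P ⊗≫ ε_ Q P ▷ P) ▷ M ⊗≫ 𝟙 _ := by rw [hη]; monoidal
      _ = _ := by rw [ExactPairing.coevaluation_evaluation'']; monoidal

section
variable {M N : C} [ExactPairing M N]

/-- The morphism `N ⊗ P ⟶ P ⊗ N` obtained from `k : P ⊗ M ⟶ M ⊗ P` by rotation, where `N` is dual
to `M` by an evaluation `N ⊗ M ⟶ 𝟙`. -/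
def rotateSwap {P : C} (k : P ⊗ M ⟶ M ⊗ P) : N ⊗ P ⟶ P ⊗ N :=
  𝟙 _ ⊗≫ (N ⊗ P) ◁ η_ M N ⊗≫ N ◁ k ▷ N ⊗≫ ε_ M N ▷ (P ⊗ N) ⊗≫ 𝟙 _

theorem rotateSwap_naturality {P P' : C} {k : P ⊗ M ⟶ M ⊗ P} {k' : P' ⊗ M ⟶ M ⊗ P'} {f : P ⟶ P'}
    (h : f ▷ M ≫ k' = k ≫ M ◁ f) :
    N ◁ f ≫ rotateSwap (N := N) k' = rotateSwap (N := N) k ≫ f ▷ N := by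
  unfold rotateSwap
  calc _ = 𝟙 _ ⊗≫ N ◁ (f ▷ 𝟙_ C ≫ P' ◁ η_ M N) ⊗≫ N ◁ k' ▷ N ⊗≫
        ε_ M N ▷ (P' ⊗ N) ⊗≫ 𝟙 _ := by monoidal
    _ = 𝟙 _ ⊗≫ N ◁ P ◁ η_ M N ⊗≫ N ◁ (f ▷ M ≫ k') ▷ N ⊗≫ ε_ M N ▷ (P' ⊗ N) ⊗≫ 𝟙 _ := by
      rw [← whisker_exchange]; monoidal
    _ = 𝟙 _ ⊗≫ N ◁ P ◁ η_ M N ⊗≫ N ◁ k ▷ N ⊗≫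
        ((N ⊗ M) ◁ f ▷ N ≫ ε_ M N ▷ (P' ⊗ N)) ⊗≫ 𝟙 _ := by rw [h]; monoidal
    _ = _ := by rw [whisker_exchange]; monoidal

theorem rotateSwap_evaluation {P : C} (k : P ⊗ M ⟶ M ⊗ P) :
    rotateSwap (N := N) k ▷ M ⊗≫ P ◁ ε_ M N = 𝟙 _ ⊗≫ N ◁ k ⊗≫ ε_ M N ▷ P ⊗≫ 𝟙 _ := by
  unfold rotateSwap
  calc _ = 𝟙 _ ⊗≫ (N ⊗ P) ◁ η_ M N ▷ M ⊗≫ N ◁ k ▷ (N ⊗ M) ⊗≫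
        (ε_ M N ▷ (P ⊗ N ⊗ M) ≫ 𝟙_ C ◁ (P ◁ ε_ M N)) ⊗≫ 𝟙 _ := by monoidal
    _ = 𝟙 _ ⊗≫ (N ⊗ P) ◁ η_ M N ▷ M ⊗≫ N ◁ (k ▷ (N ⊗ M) ≫ (M ⊗ P) ◁ ε_ M N) ⊗≫
        ε_ M N ▷ P ⊗≫ 𝟙 _ := by rw [← whisker_exchange]; monoidal
    _ = 𝟙 _ ⊗≫ (N ⊗ P) ◁ (η_ M N ▷ M ⊗≫ M ◁ ε_ M N) ⊗≫ N ◁ k ⊗≫ ε_ M N ▷ P ⊗≫ 𝟙 _ := by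
      rw [← whisker_exchange]; monoidal
    _ = _ := by rw [ExactPairing.evaluation_coevaluation'']; monoidal

theorem coevaluation_rotateSwap {P : C} (k : P ⊗ M ⟶ M ⊗ P) :
    η_ M N ▷ P ⊗≫ M ◁ rotateSwap (N := N) k = 𝟙 _ ⊗≫ P ◁ η_ M N ⊗≫ k ▷ N ⊗≫ 𝟙 _ := by
  unfold rotateSwap
  calc _ = 𝟙 _ ⊗≫ (η_ M N ▷ (P ⊗ 𝟙_ C) ≫ (M ⊗ N) ◁ (P ◁ η_ M N ⊗≫ k ▷ N)) ⊗≫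
        M ◁ ε_ M N ▷ (P ⊗ N) ⊗≫ 𝟙 _ := by monoidal
    _ = 𝟙 _ ⊗≫ P ◁ η_ M N ⊗≫ k ▷ N ⊗≫ (η_ M N ▷ M ⊗≫ M ◁ ε_ M N) ▷ (P ⊗ N) ⊗≫ 𝟙 _ := by
      rw [← whisker_exchange]; monoidal
    _ = _ := by rw [ExactPairing.evaluation_coevaluation'']; monoidal
end

section
variable {M N : C} [ExactPairing N M]

/-- The morphism `P ⊗ N ⟶ N ⊗ P` obtained from `c : M ⊗ P ⟶ P ⊗ M` by rotation, where `N` is dual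
to `M` by an evaluation `M ⊗ N ⟶ 𝟙`. -/
def corotateSwap {P : C} (c : M ⊗ P ⟶ P ⊗ M) : P ⊗ N ⟶ N ⊗ P :=
  𝟙 _ ⊗≫ η_ N M ▷ (P ⊗ N) ⊗≫ N ◁ c ▷ N ⊗≫ (N ⊗ P) ◁ ε_ N M ⊗≫ 𝟙 _

theorem corotateSwap_naturality {P P' : C} {c : M ⊗ P ⟶ P ⊗ M} {c' : M ⊗ P' ⟶ P' ⊗ M}
    {f : P ⟶ P'} (h : M ◁ f ≫ c' = c ≫ f ▷ M) :
    f ▷ N ≫ corotateSwap (N := N) c' = corotateSwap (N := N) c ≫ N ◁ f := by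
  unfold corotateSwap
  calc _ = 𝟙 _ ⊗≫ (𝟙_ C ◁ (f ▷ N) ≫ η_ N M ▷ (P' ⊗ N)) ⊗≫ N ◁ c' ▷ N ⊗≫
        (N ⊗ P') ◁ ε_ N M ⊗≫ 𝟙 _ := by monoidal
    _ = 𝟙 _ ⊗≫ η_ N M ▷ (P ⊗ N) ⊗≫ N ◁ (M ◁ f ≫ c') ▷ N ⊗≫ (N ⊗ P') ◁ ε_ N M ⊗≫ 𝟙 _ := by
      rw [whisker_exchange]; monoidal
    _ = 𝟙 _ ⊗≫ η_ N M ▷ (P ⊗ N) ⊗≫ N ◁ c ▷ N ⊗≫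
        N ◁ (f ▷ (M ⊗ N) ≫ P' ◁ ε_ N M) ⊗≫ 𝟙 _ := by rw [h]; monoidal
    _ = _ := by rw [← whisker_exchange]; monoidal

theorem corotateSwap_evaluation {P : C} (c : M ⊗ P ⟶ P ⊗ M) :
    M ◁ corotateSwap (N := N) c ⊗≫ ε_ N M ▷ P = 𝟙 _ ⊗≫ c ▷ N ⊗≫ P ◁ ε_ N M ⊗≫ 𝟙 _ := by
  unfold corotateSwap
  calc _ = 𝟙 _ ⊗≫ M ◁ η_ N M ▷ (P ⊗ N) ⊗≫ (M ⊗ N) ◁ (c ▷ N) ⊗≫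
        ((M ⊗ N) ◁ (P ◁ ε_ N M) ≫ ε_ N M ▷ (P ⊗ 𝟙_ C)) ⊗≫ 𝟙 _ := by monoidal
    _ = 𝟙 _ ⊗≫ M ◁ η_ N M ▷ (P ⊗ N) ⊗≫ ((M ⊗ N) ◁ (c ▷ N) ≫
        ε_ N M ▷ ((P ⊗ M) ⊗ N)) ⊗≫ P ◁ ε_ N M ⊗≫ 𝟙 _ := by rw [whisker_exchange]; monoidal
    _ = 𝟙 _ ⊗≫ (M ◁ η_ N M ⊗≫ ε_ N M ▷ M) ▷ (P ⊗ N) ⊗≫ c ▷ N ⊗≫ P ◁ ε_ N M ⊗≫ 𝟙 _ := by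
      rw [whisker_exchange]; monoidal
    _ = _ := by rw [ExactPairing.coevaluation_evaluation'']; monoidal

theorem coevaluation_corotateSwap {P : C} (c : M ⊗ P ⟶ P ⊗ M) :
    P ◁ η_ N M ⊗≫ corotateSwap (N := N) c ▷ M = 𝟙 _ ⊗≫ η_ N M ▷ P ⊗≫ N ◁ c ⊗≫ 𝟙 _ := by
  unfold corotateSwap
  calc _ = 𝟙 _ ⊗≫ (𝟙_ C ◁ (P ◁ η_ N M) ≫ η_ N M ▷ (P ⊗ (N ⊗ M))) ⊗≫
        N ◁ c ▷ (N ⊗ M) ⊗≫ (N ⊗ P) ◁ ε_ N M ▷ M ⊗≫ 𝟙 _ := by monoidal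
    _ = 𝟙 _ ⊗≫ η_ N M ▷ P ⊗≫ N ◁ ((M ⊗ P) ◁ η_ N M ≫ c ▷ (N ⊗ M)) ⊗≫
        (N ⊗ P) ◁ ε_ N M ▷ M ⊗≫ 𝟙 _ := by rw [whisker_exchange]; monoidal
    _ = 𝟙 _ ⊗≫ η_ N M ▷ P ⊗≫ N ◁ c ⊗≫ (N ⊗ P) ◁ (M ◁ η_ N M ⊗≫ ε_ N M ▷ M) ⊗≫ 𝟙 _ := by
      rw [whisker_exchange]; monoidal
    _ = _ := by rw [ExactPairing.coevaluation_evaluation'']; monoidal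

/-- The rotation of `c : M ⊗ P ⟶ P ⊗ M` is invertible under the conditions of
`isIso_swap_of_dual` for a dual `Q` of `P` on the other side; the inverse is the rotation of the
rotation of `c'`. -/
theorem isIso_corotateSwap {P Q : C} [ExactPairing P Q] (c : M ⊗ P ⟶ P ⊗ M)
    (c' : M ⊗ Q ⟶ Q ⊗ M)
    (hε : c' ▷ P ⊗≫ Q ◁ c ⊗≫ ε_ P Q ▷ M = 𝟙 ((M ⊗ Q) ⊗ P) ⊗≫ M ◁ ε_ P Q ⊗≫ 𝟙 (𝟙_ C ⊗ M))
    (hη : M ◁ η_ P Q ⊗≫ c ▷ Q ⊗≫ P ◁ c' =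
      𝟙 (M ⊗ 𝟙_ C) ⊗≫ η_ P Q ▷ M ⊗≫ 𝟙 (P ⊗ Q ⊗ M)) :
    IsIso (corotateSwap (N := N) c) := by
  let v' : Q ⊗ N ⟶ N ⊗ Q := corotateSwap c'
  let w : N ⊗ P ⟶ P ⊗ N :=
    𝟙 _ ⊗≫ η_ P Q ▷ (N ⊗ P) ⊗≫ P ◁ v' ▷ P ⊗≫ (P ⊗ N) ◁ ε_ P Q ⊗≫ 𝟙 _
  -- `w` inverts `c` after the evaluation of `M`, respectively after its coevaluation
  have hA : M ◁ w ⊗≫ c ▷ N ⊗≫ P ◁ ε_ N M =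
      𝟙 (M ⊗ N ⊗ P) ⊗≫ ε_ N M ▷ P ⊗≫ 𝟙 (P ⊗ 𝟙_ C) := by
    calc _ = 𝟙 _ ⊗≫ M ◁ η_ P Q ▷ (N ⊗ P) ⊗≫ (M ⊗ P) ◁ v' ▷ P ⊗≫
          ((M ⊗ P) ◁ (N ◁ ε_ P Q) ≫ c ▷ (N ⊗ 𝟙_ C)) ⊗≫ P ◁ ε_ N M ⊗≫ 𝟙 _ := by
          dsimp only [w]; monoidal
      _ = 𝟙 _ ⊗≫ M ◁ η_ P Q ▷ (N ⊗ P) ⊗≫ ((M ⊗ P) ◁ (v' ▷ P) ≫ c ▷ ((N ⊗ Q) ⊗ P)) ⊗≫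
          P ◁ ((M ⊗ N) ◁ ε_ P Q ≫ ε_ N M ▷ 𝟙_ C) ⊗≫ 𝟙 _ := by
        rw [whisker_exchange]; monoidal
      _ = 𝟙 _ ⊗≫ M ◁ η_ P Q ▷ (N ⊗ P) ⊗≫ c ▷ ((Q ⊗ N) ⊗ P) ⊗≫
          P ◁ (M ◁ v' ⊗≫ ε_ N M ▷ Q) ▷ P ⊗≫ P ◁ ε_ P Q ⊗≫ 𝟙 _ := by
        rw [whisker_exchange, whisker_exchange]; monoidal
      _ = 𝟙 _ ⊗≫ (M ◁ η_ P Q ⊗≫ c ▷ Q ⊗≫ P ◁ c') ▷ (N ⊗ P) ⊗≫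
          (P ⊗ Q) ◁ ε_ N M ▷ P ⊗≫ P ◁ ε_ P Q ⊗≫ 𝟙 _ := by
        rw [corotateSwap_evaluation]; monoidal
      _ = 𝟙 _ ⊗≫ (η_ P Q ▷ ((M ⊗ N) ⊗ P) ≫ (P ⊗ Q) ◁ (ε_ N M ▷ P)) ⊗≫ P ◁ ε_ P Q ⊗≫ 𝟙 _ := by
        rw [hη]; monoidal
      _ = 𝟙 _ ⊗≫ ε_ N M ▷ P ⊗≫ (η_ P Q ▷ P ⊗≫ P ◁ ε_ P Q) ⊗≫ 𝟙 _ := by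
        rw [← whisker_exchange]; monoidal
      _ = _ := by rw [ExactPairing.evaluation_coevaluation'']; monoidal
  have hB : η_ N M ▷ P ⊗≫ N ◁ c ⊗≫ w ▷ M =
      𝟙 (𝟙_ C ⊗ P) ⊗≫ P ◁ η_ N M ⊗≫ 𝟙 ((P ⊗ N) ⊗ M) := by
    calc _ = 𝟙 _ ⊗≫ (𝟙_ C ◁ (η_ N M ▷ P ⊗≫ N ◁ c) ≫ η_ P Q ▷ (N ⊗ P ⊗ M)) ⊗≫
          P ◁ v' ▷ (P ⊗ M) ⊗≫ (P ⊗ N) ◁ ε_ P Q ▷ M ⊗≫ 𝟙 _ := by dsimp only [w]; monoidal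
      _ = 𝟙 _ ⊗≫ η_ P Q ▷ P ⊗≫ (P ⊗ Q) ◁ η_ N M ▷ P ⊗≫ P ◁ ((Q ⊗ N) ◁ c ≫ v' ▷ (P ⊗ M)) ⊗≫
          (P ⊗ N) ◁ ε_ P Q ▷ M ⊗≫ 𝟙 _ := by rw [whisker_exchange]; monoidal
      _ = 𝟙 _ ⊗≫ η_ P Q ▷ P ⊗≫ P ◁ (Q ◁ η_ N M ⊗≫ v' ▷ M) ▷ P ⊗≫ (P ⊗ N ⊗ Q) ◁ c ⊗≫
          (P ⊗ N) ◁ ε_ P Q ▷ M ⊗≫ 𝟙 _ := by rw [whisker_exchange]; monoidal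
      _ = 𝟙 _ ⊗≫ η_ P Q ▷ P ⊗≫ P ◁ η_ N M ▷ (Q ⊗ P) ⊗≫
          (P ⊗ N) ◁ (c' ▷ P ⊗≫ Q ◁ c ⊗≫ ε_ P Q ▷ M) ⊗≫ 𝟙 _ := by
        rw [coevaluation_corotateSwap]; monoidal
      _ = 𝟙 _ ⊗≫ η_ P Q ▷ P ⊗≫ P ◁ (η_ N M ▷ (Q ⊗ P) ≫ (N ⊗ M) ◁ ε_ P Q) ⊗≫ 𝟙 _ := by
        rw [hε]; monoidal
      _ = 𝟙 _ ⊗≫ (η_ P Q ▷ P ⊗≫ P ◁ ε_ P Q) ⊗≫ P ◁ η_ N M ⊗≫ 𝟙 _ := by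
        rw [← whisker_exchange]; monoidal
      _ = _ := by rw [ExactPairing.evaluation_coevaluation'']; monoidal
  refine ⟨w, ?_, ?_⟩
  · calc _ = 𝟙 _ ⊗≫ η_ N M ▷ (P ⊗ N) ⊗≫ N ◁ c ▷ N ⊗≫ ((N ⊗ P) ◁ ε_ N M ≫ w ▷ 𝟙_ C) ⊗≫ 𝟙 _ := by
          dsimp only [corotateSwap]; monoidal
      _ = 𝟙 _ ⊗≫ (η_ N M ▷ P ⊗≫ N ◁ c ⊗≫ w ▷ M) ▷ N ⊗≫ (P ⊗ N) ◁ ε_ N M ⊗≫ 𝟙 _ := by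
        rw [whisker_exchange]; monoidal
      _ = 𝟙 _ ⊗≫ P ◁ (η_ N M ▷ N ⊗≫ N ◁ ε_ N M) ⊗≫ 𝟙 _ := by rw [hB]; monoidal
      _ = _ := by rw [ExactPairing.evaluation_coevaluation'']; monoidal
  · calc _ = 𝟙 _ ⊗≫ (𝟙_ C ◁ w ≫ η_ N M ▷ (P ⊗ N)) ⊗≫ N ◁ c ▷ N ⊗≫ (N ⊗ P) ◁ ε_ N M ⊗≫ 𝟙 _ := by
          dsimp only [corotateSwap]; monoidal
      _ = 𝟙 _ ⊗≫ η_ N M ▷ (N ⊗ P) ⊗≫ N ◁ (M ◁ w ⊗≫ c ▷ N ⊗≫ P ◁ ε_ N M) ⊗≫ 𝟙 _ := by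
        rw [whisker_exchange]; monoidal
      _ = 𝟙 _ ⊗≫ (η_ N M ▷ N ⊗≫ N ◁ ε_ N M) ▷ P ⊗≫ 𝟙 _ := by rw [hA]; monoidal
      _ = _ := by rw [ExactPairing.evaluation_coevaluation'']; monoidal
end
end Swaps

/-! ### Half braidings of modules over the centralizer -/

section HalfBraiding
variable {C : Type u} [Category.{v} C] [MonoidalCategory C] {T : C ⥤ C} (Z : Centralizer T)

namespace Centralizer

/-- The family `σ_Y : M ⊗ Y ⟶ T(Y) ⊗ M` corresponding to `b : Z_T(M) ⟶ M`; for an action `b` it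
is a half braiding relative to `T`. -/
def halfBraiding {M : C} (b : Z.functor.obj M ⟶ M) (Y : C) : M ⊗ Y ⟶ T.obj Y ⊗ M :=
  Z.hb M Y ≫ T.obj Y ◁ b

/-- The morphism `M ⊗ P ⟶ P ⊗ M` moving `M` past the `T`-module `(P, r)`. -/
def swap {M P : C} (b : Z.functor.obj M ⟶ M) (r : T.obj P ⟶ P) : M ⊗ P ⟶ P ⊗ M :=
  Z.halfBraiding b P ≫ r ▷ M

theorem halfBraiding_naturality {M : C} (b : Z.functor.obj M ⟶ M) {Y Y' : C} (f : Y ⟶ Y') :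
    M ◁ f ≫ Z.halfBraiding b Y' = Z.halfBraiding b Y ≫ T.map f ▷ M := by
  dsimp only [halfBraiding]
  rw [reassoc_of% (Z.hb_naturality_right M f), ← whisker_exchange, Category.assoc]

theorem swap_naturality {M P P' : C} (b : Z.functor.obj M ⟶ M) {r : T.obj P ⟶ P}
    {r' : T.obj P' ⟶ P'} {f : P ⟶ P'} (hf : T.map f ≫ r' = r ≫ f) :
    M ◁ f ≫ Z.swap b r' = Z.swap b r ≫ f ▷ M := by
  dsimp only [swap]
  rw [reassoc_of% (Z.halfBraiding_naturality b f), ← comp_whiskerRight, hf, comp_whiskerRight,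
    Category.assoc]

variable {B : BimonadData T} (hB : B.IsBimonad)

include hB in
theorem unit_swap_mul {M : C} (b : Z.functor.obj M ⟶ M) (Y : C) :
    M ◁ B.unit Y ≫ Z.swap b (B.mul Y) = Z.halfBraiding b Y := by
  dsimp only [swap]
  rw [reassoc_of% (Z.halfBraiding_naturality b (B.unit Y)), ← comp_whiskerRight, hB.map_unit_mul,
    id_whiskerRight, Category.comp_id]

variable [RightRigidCategory C] {M : C} {b : Z.functor.obj M ⟶ M}
  (hM : (Z.bimonadData hB).IsAction b)
include hM

/-- Associativity of the action `b` is the hexagon identity of the half braiding. -/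
theorem halfBraiding_tensor (Y₁ Y₂ : C) :
    Z.halfBraiding b Y₁ ▷ Y₂ ⊗≫ T.obj Y₁ ◁ Z.halfBraiding b Y₂ =
      𝟙 ((M ⊗ Y₁) ⊗ Y₂) ⊗≫ Z.halfBraiding b (Y₁ ⊗ Y₂) ⊗≫ B.comul Y₁ Y₂ ▷ M ⊗≫
        𝟙 (T.obj Y₁ ⊗ T.obj Y₂ ⊗ M) := by
  dsimp only [halfBraiding]
  calc _ = Z.hb M Y₁ ▷ Y₂ ⊗≫ T.obj Y₁ ◁ (b ▷ Y₂ ≫ Z.hb M Y₂) ⊗≫ (T.obj Y₁ ⊗ T.obj Y₂) ◁ b ⊗≫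
        𝟙 _ := by monoidal
    _ = Z.hb M Y₁ ▷ Y₂ ⊗≫ T.obj Y₁ ◁ Z.hb (Z.functor.obj M) Y₂ ⊗≫
        (T.obj Y₁ ⊗ T.obj Y₂) ◁ (Z.functor.map b ≫ b) ⊗≫ 𝟙 _ := by
      rw [hb_naturality_left]; monoidal
    _ = (Z.hb M Y₁ ▷ Y₂ ⊗≫ T.obj Y₁ ◁ Z.hb (Z.functor.obj M) Y₂ ⊗≫
        (T.obj Y₁ ⊗ T.obj Y₂) ◁ (Z.bimonadData hB).mul M) ⊗≫ (T.obj Y₁ ⊗ T.obj Y₂) ◁ b ⊗≫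
        𝟙 _ := by rw [hM.assoc]; monoidal
    _ = 𝟙 _ ⊗≫ Z.hb M (Y₁ ⊗ Y₂) ⊗≫ (B.comul Y₁ Y₂ ▷ Z.functor.obj M ≫
        (T.obj Y₁ ⊗ T.obj Y₂) ◁ b) ⊗≫ 𝟙 _ := by rw [hb_mul]; monoidal
    _ = _ := by rw [← whisker_exchange]; monoidal

/-- Unitality of the action `b` is the unit identity of the half braiding. -/
theorem halfBraiding_tensorUnit :
    Z.halfBraiding b (𝟙_ C) ≫ B.counit ▷ M = 𝟙 (M ⊗ 𝟙_ C) ⊗≫ 𝟙 (𝟙_ C ⊗ M) := by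
  dsimp only [halfBraiding]
  calc _ = Z.hb M (𝟙_ C) ≫ B.counit ▷ Z.functor.obj M ≫ 𝟙_ C ◁ b := by
          rw [Category.assoc, whisker_exchange]
    _ = 𝟙 _ ⊗≫ ((Z.bimonadData hB).unit M ≫ b) ⊗≫ 𝟙 _ := by rw [unit_eq]; monoidal
    _ = _ := by rw [hM.unit]; monoidal

/-- The morphisms `swap` are compatible with a linear evaluation. -/
theorem swap_evaluation {P Q : C} [ExactPairing P Q] {r : T.obj P ⟶ P} {t : T.obj Q ⟶ Q}
    (h : @EvLin _ _ _ T hB.oplax _ _ _ r t) :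
    Z.swap b t ▷ P ⊗≫ Q ◁ Z.swap b r ⊗≫ ε_ P Q ▷ M =
      𝟙 ((M ⊗ Q) ⊗ P) ⊗≫ M ◁ ε_ P Q ⊗≫ 𝟙 (𝟙_ C ⊗ M) := by
  have h : T.map (ε_ P Q) ≫ B.counit = B.comul Q P ≫ (t ⊗ₘ r) ≫ ε_ P Q := h
  calc _ = 𝟙 _ ⊗≫ Z.halfBraiding b Q ▷ P ⊗≫ (t ▷ (M ⊗ P) ≫ Q ◁ Z.halfBraiding b P) ⊗≫
        Q ◁ r ▷ M ⊗≫ ε_ P Q ▷ M := by dsimp only [swap]; monoidal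
    _ = 𝟙 _ ⊗≫ (Z.halfBraiding b Q ▷ P ⊗≫ T.obj Q ◁ Z.halfBraiding b P) ⊗≫
        ((t ⊗ₘ r) ≫ ε_ P Q) ▷ M := by
      rw [← whisker_exchange, MonoidalCategory.tensorHom_def]; monoidal
    _ = 𝟙 _ ⊗≫ Z.halfBraiding b (Q ⊗ P) ⊗≫ (B.comul Q P ≫ (t ⊗ₘ r) ≫ ε_ P Q) ▷ M := by
      rw [Z.halfBraiding_tensor hB hM]; monoidal
    _ = 𝟙 _ ⊗≫ (Z.halfBraiding b (Q ⊗ P) ≫ T.map (ε_ P Q) ▷ M) ⊗≫ B.counit ▷ M := by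
      rw [← h]; monoidal
    _ = 𝟙 _ ⊗≫ M ◁ ε_ P Q ⊗≫ (Z.halfBraiding b (𝟙_ C) ≫ B.counit ▷ M) := by
      rw [← halfBraiding_naturality]; monoidal
    _ = _ := by rw [Z.halfBraiding_tensorUnit hB hM]; monoidal

/-- The morphisms `swap` are compatible with a linear coevaluation. -/
theorem coevaluation_swap {P Q : C} [ExactPairing P Q] {r : T.obj P ⟶ P} {t : T.obj Q ⟶ Q}
    (h : @CoevLin _ _ _ T hB.oplax _ _ _ r t) :
    M ◁ η_ P Q ⊗≫ Z.swap b r ▷ Q ⊗≫ P ◁ Z.swap b t =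
      𝟙 (M ⊗ 𝟙_ C) ⊗≫ η_ P Q ▷ M ⊗≫ 𝟙 (P ⊗ Q ⊗ M) := by
  have h : B.counit ≫ η_ P Q = T.map (η_ P Q) ≫ B.comul P Q ≫ (r ⊗ₘ t) := h
  calc _ = 𝟙 _ ⊗≫ M ◁ η_ P Q ⊗≫ Z.halfBraiding b P ▷ Q ⊗≫ (r ▷ (M ⊗ Q) ≫
        P ◁ Z.halfBraiding b Q) ⊗≫ P ◁ t ▷ M ⊗≫ 𝟙 _ := by dsimp only [swap]; monoidal
    _ = 𝟙 _ ⊗≫ M ◁ η_ P Q ⊗≫ (Z.halfBraiding b P ▷ Q ⊗≫ T.obj P ◁ Z.halfBraiding b Q) ⊗≫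
        (r ⊗ₘ t) ▷ M ⊗≫ 𝟙 _ := by
      rw [← whisker_exchange, MonoidalCategory.tensorHom_def]; monoidal
    _ = 𝟙 _ ⊗≫ (M ◁ η_ P Q ≫ Z.halfBraiding b (P ⊗ Q)) ⊗≫ (B.comul P Q ≫ (r ⊗ₘ t)) ▷ M ⊗≫
        𝟙 _ := by rw [Z.halfBraiding_tensor hB hM]; monoidal
    _ = 𝟙 _ ⊗≫ Z.halfBraiding b (𝟙_ C) ⊗≫ (T.map (η_ P Q) ≫ B.comul P Q ≫ (r ⊗ₘ t)) ▷ M ⊗≫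
        𝟙 _ := by rw [halfBraiding_naturality]; monoidal
    _ = 𝟙 _ ⊗≫ (Z.halfBraiding b (𝟙_ C) ≫ B.counit ▷ M) ⊗≫ η_ P Q ▷ M ⊗≫ 𝟙 _ := by
      rw [← h]; monoidal
    _ = _ := by rw [Z.halfBraiding_tensorUnit hB hM]; monoidal

end Centralizer
end HalfBraiding

/-! ### Linear structures on duals -/

section LinearDuals
variable {C : Type u} [Category.{v} C] [MonoidalCategory C] {T : C ⥤ C} (Z : Centralizer T)
  {B : BimonadData T}

namespace Centralizer

/-- A family `w_Y : N ⊗ T(Y) ⟶ T(Y) ⊗ N` which is natural for linear maps of free modules comes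
from a morphism `Z_T(N) ⟶ N`. -/
theorem exists_swap_eq (hB : B.IsBimonad) {N : C} (w : ∀ Y : C, N ⊗ T.obj Y ⟶ T.obj Y ⊗ N)
    (hw : ∀ {X Y : C} (f : T.obj X ⟶ T.obj Y), T.map f ≫ B.mul Y = B.mul X ≫ f →
      N ◁ f ≫ w Y = w X ≫ f ▷ N) :
    ∃ t : Z.functor.obj N ⟶ N, ∀ Y : C, Z.swap t (B.mul Y) = w Y := by
  -- `t` corresponds to the half braiding `(N ⊗ η_Y) w_Y`
  obtain ⟨t, ht, -⟩ := Z.existsUnique_desc N N (fun Y => N ◁ B.unit Y ≫ w Y) (fun {Y Y'} g => by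
    rw [← whiskerLeft_comp_assoc, hB.unit_naturality, whiskerLeft_comp_assoc,
      hw (T.map g) (hB.mul_naturality g), Category.assoc])
  refine ⟨t, fun Y => ?_⟩
  dsimp only [swap, halfBraiding]
  rw [ht, Category.assoc, ← hw (B.mul Y) (hB.mul_assoc Y), ← whiskerLeft_comp_assoc, hB.unit_mul,
    whiskerLeft_id, Category.id_comp]

variable [RightRigidCategory C] (hB : B.IsBimonad) {M N : C} {b : Z.functor.obj M ⟶ M}
  {t : Z.functor.obj N ⟶ N}

/-- The two factors of a tensor product move past a free module one after the other. -/
theorem hb_comul_action (Y : C) :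
    Z.hb (N ⊗ M) Y ⊗≫ T.obj Y ◁ ((Z.bimonadData hB).comul N M ≫ (t ⊗ₘ b)) =
      𝟙 ((N ⊗ M) ⊗ Y) ⊗≫ N ◁ M ◁ B.unit Y ⊗≫ N ◁ Z.swap b (B.mul Y) ⊗≫
        Z.swap t (B.mul Y) ▷ M ⊗≫ 𝟙 (T.obj Y ⊗ N ⊗ M) := by
  calc _ = (Z.hb (N ⊗ M) Y ⊗≫ T.obj Y ◁ (Z.bimonadData hB).comul N M) ⊗≫
        T.obj Y ◁ (Z.functor.obj N ◁ b) ⊗≫ T.obj Y ◁ t ▷ M ⊗≫ 𝟙 _ := by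
          rw [MonoidalCategory.tensorHom_def']; monoidal
    _ = 𝟙 _ ⊗≫ N ◁ Z.hb M Y ⊗≫ Z.hb N (T.obj Y) ▷ Z.functor.obj M ⊗≫
        (B.mul Y ▷ Z.functor.obj N ▷ Z.functor.obj M ≫ (T.obj Y ⊗ Z.functor.obj N) ◁ b) ⊗≫
        T.obj Y ◁ t ▷ M ⊗≫ 𝟙 _ := by rw [hb_comul]; monoidal
    _ = 𝟙 _ ⊗≫ N ◁ Z.hb M Y ⊗≫ (Z.hb N (T.obj Y) ▷ Z.functor.obj M ≫
        (T.obj (T.obj Y) ⊗ Z.functor.obj N) ◁ b) ⊗≫ (B.mul Y ▷ Z.functor.obj N ≫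
        T.obj Y ◁ t) ▷ M ⊗≫ 𝟙 _ := by rw [← whisker_exchange]; monoidal
    _ = 𝟙 _ ⊗≫ N ◁ Z.halfBraiding b Y ⊗≫ Z.swap t (B.mul Y) ▷ M ⊗≫ 𝟙 _ := by
      rw [← whisker_exchange, ← whisker_exchange]; dsimp only [swap, halfBraiding]; monoidal
    _ = _ := by rw [← Z.unit_swap_mul hB]; monoidal

variable [ExactPairing M N]

/-- The evaluation is linear if moving free modules past its two factors and past `𝟙` agree. -/
theorem evLin_of_swap (h : ∀ Y : C, N ◁ Z.swap b (B.mul Y) ⊗≫ Z.swap t (B.mul Y) ▷ M ⊗≫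
      T.obj Y ◁ ε_ M N = 𝟙 (N ⊗ M ⊗ T.obj Y) ⊗≫ ε_ M N ▷ T.obj Y ⊗≫ 𝟙 (T.obj Y ⊗ 𝟙_ C)) :
    @EvLin _ _ _ Z.functor (Z.isBimonad_bimonadData hB).oplax _ _ _ b t := by
  change Z.functor.map (ε_ M N) ≫ (Z.bimonadData hB).counit =
    (Z.bimonadData hB).comul N M ≫ (t ⊗ₘ b) ≫ ε_ M N
  refine Z.hom_ext fun Y => ?_
  calc _ = (Z.hb (N ⊗ M) Y ≫ T.obj Y ◁ Z.functor.map (ε_ M N)) ≫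
        T.obj Y ◁ (Z.bimonadData hB).counit := by monoidal
    _ = ε_ M N ▷ Y ≫ (Z.hb (𝟙_ C) Y ⊗≫ T.obj Y ◁ (Z.bimonadData hB).counit) := by
      rw [← hb_naturality_left]; monoidal
    _ = 𝟙 _ ⊗≫ (ε_ M N ▷ Y ≫ 𝟙_ C ◁ B.unit Y) ⊗≫ 𝟙 _ := by rw [hb_counit]; monoidal
    _ = 𝟙 _ ⊗≫ N ◁ M ◁ B.unit Y ⊗≫ ε_ M N ▷ T.obj Y ⊗≫ 𝟙 _ := by
      rw [← whisker_exchange]; monoidal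
    _ = 𝟙 _ ⊗≫ N ◁ M ◁ B.unit Y ⊗≫ (N ◁ Z.swap b (B.mul Y) ⊗≫ Z.swap t (B.mul Y) ▷ M ⊗≫
        T.obj Y ◁ ε_ M N) ⊗≫ 𝟙 _ := by rw [h]; monoidal
    _ = (Z.hb (N ⊗ M) Y ⊗≫ T.obj Y ◁ ((Z.bimonadData hB).comul N M ≫ (t ⊗ₘ b))) ⊗≫
        T.obj Y ◁ ε_ M N := by rw [hb_comul_action]; monoidal
    _ = _ := by monoidal

/-- The coevaluation is linear if moving free modules past `𝟙` and past its two factors agree. -/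
theorem coevLin_of_swap (h : ∀ Y : C, η_ M N ▷ T.obj Y ⊗≫ M ◁ Z.swap t (B.mul Y) ⊗≫
      Z.swap b (B.mul Y) ▷ N = 𝟙 (𝟙_ C ⊗ T.obj Y) ⊗≫ T.obj Y ◁ η_ M N ⊗≫
        𝟙 ((T.obj Y ⊗ M) ⊗ N)) :
    @CoevLin _ _ _ Z.functor (Z.isBimonad_bimonadData hB).oplax _ _ _ b t := by
  change (Z.bimonadData hB).counit ≫ η_ M N =
    Z.functor.map (η_ M N) ≫ (Z.bimonadData hB).comul M N ≫ (b ⊗ₘ t)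
  refine Z.hom_ext fun Y => ?_
  calc _ = (Z.hb (𝟙_ C) Y ⊗≫ T.obj Y ◁ (Z.bimonadData hB).counit) ⊗≫ T.obj Y ◁ η_ M N := by
          monoidal
    _ = 𝟙 _ ⊗≫ B.unit Y ⊗≫ T.obj Y ◁ η_ M N ⊗≫ 𝟙 _ := by rw [hb_counit]; monoidal
    _ = 𝟙 _ ⊗≫ 𝟙_ C ◁ B.unit Y ⊗≫ (η_ M N ▷ T.obj Y ⊗≫ M ◁ Z.swap t (B.mul Y) ⊗≫
        Z.swap b (B.mul Y) ▷ N) ⊗≫ 𝟙 _ := by rw [h]; monoidal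
    _ = 𝟙 _ ⊗≫ (𝟙_ C ◁ B.unit Y ≫ η_ M N ▷ T.obj Y) ⊗≫ M ◁ Z.swap t (B.mul Y) ⊗≫
        Z.swap b (B.mul Y) ▷ N ⊗≫ 𝟙 _ := by monoidal
    _ = 𝟙 _ ⊗≫ η_ M N ▷ Y ≫ (𝟙 ((M ⊗ N) ⊗ Y) ⊗≫ M ◁ N ◁ B.unit Y ⊗≫
        M ◁ Z.swap t (B.mul Y) ⊗≫ Z.swap b (B.mul Y) ▷ N ⊗≫ 𝟙 (T.obj Y ⊗ M ⊗ N)) := by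
      rw [whisker_exchange]; monoidal
    _ = 𝟙 _ ⊗≫ (η_ M N ▷ Y ≫ Z.hb (M ⊗ N) Y) ⊗≫
        T.obj Y ◁ ((Z.bimonadData hB).comul M N ≫ (b ⊗ₘ t)) := by
      rw [← Z.hb_comul_action hB (N := M) (M := N)]; monoidal
    _ = _ := by rw [hb_naturality_left]; monoidal

end Centralizer
end LinearDuals

section LinearDualsOfHopfMonad
variable {C : Type u} [Category.{v} C] [MonoidalCategory C] [RigidCategory C] {T : C ⥤ C}
  (Z : Centralizer T) {B : BimonadData T} (hB : B.IsHopfMonad)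

namespace Centralizer
variable {M : C} {b : Z.functor.obj M ⟶ M} (hM : (Z.bimonadData hB.isBimonad).IsAction b)
include hM

/-- A `Z_T`-module can be moved past free `T`-modules invertibly: the dual of a free `T`-module is a
`T`-module by the right antipode, and gives the inverse. -/
theorem isIso_swap_mul (Y : C) : IsIso (Z.swap b (B.mul Y)) := by
  obtain ⟨s, hs⟩ := hB.exists_rightAntipode
  have hB' := hB.isBimonad
  have hf := hB'.free Y
  exact isIso_swap_of_dual (P := T.obj Y) (Q := ᘁ(T.obj Y)) _ _
    (Z.swap_evaluation hB' hM (evLin_rightAntipode hB' hs hf))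
    (Z.coevaluation_swap hB' hM (coevLin_rightAntipode hB' hs hf))

/-- The dual `N` of a `Z_T`-module `M`, with evaluation `N ⊗ M ⟶ 𝟙`, has a structure map for which
the pairing is linear. -/
theorem exists_linear_right (N : C) [ExactPairing M N] :
    ∃ t : Z.functor.obj N ⟶ N,
      @EvLin _ _ _ Z.functor (Z.isBimonad_bimonadData hB.isBimonad).oplax _ _ _ b t ∧
      @CoevLin _ _ _ Z.functor (Z.isBimonad_bimonadData hB.isBimonad).oplax _ _ _ b t := by
  have hi := Z.isIso_swap_mul hB hM
  obtain ⟨t, ht⟩ := Z.exists_swap_eq hB.isBimonad (N := N)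
    (fun Y => rotateSwap (inv (Z.swap b (B.mul Y)))) (fun f hf => rotateSwap_naturality (by
      rw [IsIso.comp_inv_eq, Category.assoc, Z.swap_naturality b hf, IsIso.inv_hom_id_assoc]))
  refine ⟨t, Z.evLin_of_swap hB.isBimonad fun Y => ?_, Z.coevLin_of_swap hB.isBimonad fun Y => ?_⟩
  · rw [ht]
    calc _ = 𝟙 _ ⊗≫ N ◁ Z.swap b (B.mul Y) ⊗≫
          (rotateSwap (N := N) (inv (Z.swap b (B.mul Y))) ▷ M ⊗≫ T.obj Y ◁ ε_ M N) := by monoidal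
      _ = 𝟙 _ ⊗≫ N ◁ (Z.swap b (B.mul Y) ≫ inv (Z.swap b (B.mul Y))) ⊗≫ ε_ M N ▷ T.obj Y ⊗≫
          𝟙 _ := by rw [rotateSwap_evaluation]; monoidal
      _ = _ := by rw [IsIso.hom_inv_id]; monoidal
  · rw [ht]
    calc _ = (η_ M N ▷ T.obj Y ⊗≫ M ◁ rotateSwap (N := N) (inv (Z.swap b (B.mul Y)))) ⊗≫
          Z.swap b (B.mul Y) ▷ N := by monoidal
      _ = 𝟙 _ ⊗≫ T.obj Y ◁ η_ M N ⊗≫ (inv (Z.swap b (B.mul Y)) ≫ Z.swap b (B.mul Y)) ▷ N := by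
        rw [coevaluation_rotateSwap]; monoidal
      _ = _ := by rw [IsIso.inv_hom_id]; monoidal

/-- The dual `N` of a `Z_T`-module `M`, with evaluation `M ⊗ N ⟶ 𝟙`, has a structure map for which
the pairing is linear. -/
theorem exists_linear_left (N : C) [ExactPairing N M] :
    ∃ t : Z.functor.obj N ⟶ N,
      @EvLin _ _ _ Z.functor (Z.isBimonad_bimonadData hB.isBimonad).oplax _ _ _ t b ∧
      @CoevLin _ _ _ Z.functor (Z.isBimonad_bimonadData hB.isBimonad).oplax _ _ _ t b := by
  -- invertibility of the rotated morphisms is where the left antipode enters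
  have hi (Y : C) : IsIso (corotateSwap (N := N) (Z.swap b (B.mul Y))) := by
    have hf := hB.isBimonad.free Y
    exact isIso_corotateSwap (P := T.obj Y) (Q := (T.obj Y)ᘁ) _ _
      (Z.swap_evaluation hB.isBimonad hM
        (evLin_leftAntipode hB.isBimonad hB.isLeftAntipode_leftAntipode hf))
      (Z.coevaluation_swap hB.isBimonad hM
        (coevLin_leftAntipode hB.isBimonad hB.isLeftAntipode_leftAntipode hf))
  obtain ⟨t, ht⟩ := Z.exists_swap_eq hB.isBimonad (N := N)
    (fun Y => inv (corotateSwap (Z.swap b (B.mul Y)))) (fun f hf => by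
      rw [IsIso.comp_inv_eq, Category.assoc,
        corotateSwap_naturality (Z.swap_naturality b hf), IsIso.inv_hom_id_assoc])
  refine ⟨t, Z.evLin_of_swap hB.isBimonad fun Y => ?_, Z.coevLin_of_swap hB.isBimonad fun Y => ?_⟩
  · rw [ht]
    set c := Z.swap b (B.mul Y)
    calc _ = 𝟙 _ ⊗≫ M ◁ inv (corotateSwap (N := N) c) ⊗≫
          (𝟙 ((M ⊗ T.obj Y) ⊗ N) ⊗≫ c ▷ N ⊗≫ T.obj Y ◁ ε_ N M ⊗≫ 𝟙 (T.obj Y ⊗ 𝟙_ C)) := by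
            monoidal
      _ = 𝟙 _ ⊗≫ M ◁ inv (corotateSwap (N := N) c) ⊗≫
          (M ◁ corotateSwap (N := N) c ⊗≫ ε_ N M ▷ T.obj Y) ⊗≫ 𝟙 _ := by
        rw [corotateSwap_evaluation]; monoidal
      _ = 𝟙 _ ⊗≫ M ◁ (inv (corotateSwap (N := N) c) ≫ corotateSwap (N := N) c) ⊗≫
          ε_ N M ▷ T.obj Y ⊗≫ 𝟙 _ := by monoidal
      _ = _ := by rw [IsIso.inv_hom_id]; monoidal
  · rw [ht]
    set c := Z.swap b (B.mul Y)
    calc _ = 𝟙 _ ⊗≫ (T.obj Y ◁ η_ N M ⊗≫ corotateSwap (N := N) c ▷ M) ⊗≫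
          inv (corotateSwap (N := N) c) ▷ M := by rw [coevaluation_corotateSwap]; monoidal
      _ = 𝟙 _ ⊗≫ T.obj Y ◁ η_ N M ⊗≫
          (corotateSwap (N := N) c ≫ inv (corotateSwap (N := N) c)) ▷ M := by monoidal
      _ = _ := by rw [IsIso.hom_inv_id]; monoidal

end Centralizer
end LinearDualsOfHopfMonad

/-! ### The double -/

section DoubleIsQuasitriangular
variable {C : Type u} [Category.{v} C] [MonoidalCategory C] [RigidCategory C] {T : C ⥤ C}
  (Z : Centralizer T) {B : BimonadData T} (hB : B.IsHopfMonad)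

namespace Centralizer

local notation "F" => Centralizer.functor Z
local notation "ZB" => Centralizer.bimonadData Z (BimonadData.IsHopfMonad.isBimonad hB)
local notation "Ω" => Centralizer.canonicalLaw Z hB
local notation "act" => BimonadData.compositeAction B (Centralizer.canonicalLaw Z hB)

theorem isDistributiveLaw_canonicalLaw : (ZB).IsDistributiveLaw B Ω where
  naturality f := Z.law_naturality hB f
  unit_comp X := Z.unit_law hB X
  map_unit_comp X := Z.law_unit hB X
  mul_comp X := Z.law_mul_T hB X
  map_mul_comp X := Z.law_mul hB X
  comul X Y := Z.law_comul hB X Y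
  counit := Z.law_counit hB

theorem double_eq_composite : Z.double hB = (ZB).composite B Ω := by
  simp only [double, BimonadData.composite, BimonadData.compositeAction, Functor.map_comp,
    Category.assoc]

theorem isBimonad_double : (Z.double hB).IsBimonad := by
  rw [double_eq_composite]
  exact (Z.isDistributiveLaw_canonicalLaw hB).isBimonad_composite
    (Z.isBimonad_bimonadData hB.isBimonad) hB.isBimonad

theorem double_mul (X : C) :
    (Z.double hB).mul X = (F).map ((act) X) ≫ (ZB).mul (T.obj X) := by
  rw [double_eq_composite]; rfl

/-- The double is a Hopf monad: a free module of the double is a `T`-module and a `Z_T`-module, and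
its pairings with its duals are linear for both structures. -/
theorem isHopfMonad_double : (Z.double hB).IsHopfMonad := by
  have hA := Z.isBimonad_bimonadData hB.isBimonad
  have hD := Z.isBimonad_double hB
  have hl := Z.isDistributiveLaw_canonicalLaw hB
  obtain ⟨r, hr⟩ := hB.exists_rightAntipode
  refine ⟨hD, hD.exists_isLeftAntipode fun X => ?_, hD.exists_isRightAntipode fun X => ?_⟩
  · have ha := hl.isAction_compositeAction hB.isBimonad X
    obtain ⟨t, he, hc⟩ := Z.exists_linear_right hB (hA.free (T.obj X))
      (((F).obj (T.obj X))ᘁ)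
    have he' := evLin_leftAntipode hB.isBimonad hB.isLeftAntipode_leftAntipode ha
    have hc' := coevLin_leftAntipode hB.isBimonad hB.isLeftAntipode_leftAntipode ha
    rw [double_mul]
    let _ := hA.oplax
    let _ := hB.isBimonad.oplax
    exact ⟨_, EvLin.comp he' he, CoevLin.comp hc' hc⟩
  · have ha := hl.isAction_compositeAction hB.isBimonad X
    obtain ⟨t, he, hc⟩ := Z.exists_linear_left hB (hA.free (T.obj X))
      (ᘁ((F).obj (T.obj X)))
    have he' := evLin_rightAntipode hB.isBimonad hr ha
    have hc' := coevLin_rightAntipode hB.isBimonad hr ha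
    rw [double_mul]
    let _ := hA.oplax
    let _ := hB.isBimonad.oplax
    exact ⟨_, EvLin.comp he' he, CoevLin.comp hc' hc⟩

/-- The R-matrix of the double. -/
noncomputable def doubleRMatrix (X Y : C) :
    X ⊗ Y ⟶ (F).obj (T.obj Y) ⊗ (F).obj (T.obj X) :=
  Z.hb X Y ≫ ((ZB).unit (T.obj Y) ⊗ₘ (F).map (B.unit X))

/-- The product of the double, with its source and target written out. -/
noncomputable abbrev doubleMul (X : C) :
    (F).obj (T.obj ((F).obj (T.obj X))) ⟶ (F).obj (T.obj X) :=
  (Z.double hB).mul X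

/-- The coproduct of the double, with its source and target written out. -/
noncomputable abbrev doubleComul (X Y : C) :
    (F).obj (T.obj (X ⊗ Y)) ⟶ (F).obj (T.obj X) ⊗ (F).obj (T.obj Y) :=
  (Z.double hB).comul X Y

theorem unit_double_mul (X : C) :
    (ZB).unit (T.obj ((F).obj (T.obj X))) ≫ Z.doubleMul hB X = (act) X := by
  have hA := Z.isBimonad_bimonadData hB.isBimonad
  dsimp only [doubleMul]
  rw [double_mul, ← reassoc_of% (hA.unit_naturality ((act) X)), hA.unit_mul, Category.comp_id]

theorem map_unit_double_mul (X : C) :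
    (F).map (B.unit ((F).obj (T.obj X))) ≫ Z.doubleMul hB X = (ZB).mul (T.obj X) := by
  dsimp only [doubleMul]
  rw [double_mul, ← (F).map_comp_assoc, ((Z.isDistributiveLaw_canonicalLaw
    hB).isAction_compositeAction hB.isBimonad X).unit, (F).map_id, Category.id_comp]

/-- The equation `hb_law` for the action of `T` on a free module of the double in place of `Ω`. -/
theorem hb_map_comul_action (Y W : C) :
    T.map (Z.hb (T.obj Y) W) ≫ B.comul (T.obj W) ((F).obj (T.obj Y)) ≫
        B.mul W ▷ T.obj ((F).obj (T.obj Y)) ≫ T.obj W ◁ (act) Y =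
      B.comul (T.obj Y) W ≫ B.mul Y ▷ T.obj W ≫ Z.hb (T.obj Y) (T.obj W) ≫
        B.mul W ▷ (F).obj (T.obj Y) := by
  dsimp only [BimonadData.compositeAction]
  rw [whiskerLeft_comp, reassoc_of% (Z.hb_law hB (T.obj Y) W), ← whisker_exchange,
    ← reassoc_of% (Z.hb_naturality_left (B.mul Y) (T.obj W))]

/-- The compatibility of `∂` with the products and the coproduct of `Z_T` on which the linearity of
the R-matrix rests. -/
theorem comul_hb_mul (X Y : C) :
    (ZB).comul X (T.obj Y) ≫ Z.hb ((F).obj X) ((F).obj (T.obj Y)) ≫ ((act) Y ⊗ₘ (ZB).mul X) =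
      (F).map (Z.hb X (T.obj Y) ≫ (B.mul Y ≫ (ZB).unit (T.obj Y)) ▷ (F).obj X) ≫
        (ZB).comul ((F).obj (T.obj Y)) ((F).obj X) ≫ ((ZB).mul (T.obj Y) ⊗ₘ (ZB).mul X) := by
  have hA := Z.isBimonad_bimonadData hB.isBimonad
  -- the unit absorbs one of the two copies of `∂`
  have hu (W : C) : (ZB).unit (T.obj Y) ▷ T.obj W ≫ Z.hb ((F).obj (T.obj Y)) (T.obj W) ≫
      T.obj (T.obj W) ◁ (ZB).mul (T.obj Y) = Z.hb (T.obj Y) (T.obj W) := by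
    rw [reassoc_of% (Z.hb_naturality_left ((ZB).unit (T.obj Y)) (T.obj W)), ← whiskerLeft_comp,
      hA.map_unit_mul, whiskerLeft_id, Category.comp_id]
  refine Z.hom_ext fun W => ?_
  -- both sides reduce to `∂_{X, T(Y) ⊗ W}` followed by `T₂`, `μ_Y`, `∂_{T(Y), T(W)}` and `μ_W`
  have lhs : Z.hb (X ⊗ T.obj Y) W ≫ T.obj W ◁ ((ZB).comul X (T.obj Y) ≫
      Z.hb ((F).obj X) ((F).obj (T.obj Y)) ≫ ((act) Y ⊗ₘ (ZB).mul X)) =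
      𝟙 _ ⊗≫ Z.hb X (T.obj Y ⊗ W) ⊗≫ (B.comul (T.obj Y) W ≫ B.mul Y ▷ T.obj W ≫
        Z.hb (T.obj Y) (T.obj W) ≫ B.mul W ▷ (F).obj (T.obj Y)) ▷ (F).obj X ⊗≫
        𝟙 (T.obj W ⊗ (F).obj (T.obj Y) ⊗ (F).obj X) := by
    calc _ = (Z.hb (X ⊗ T.obj Y) W ⊗≫ T.obj W ◁ (ZB).comul X (T.obj Y)) ⊗≫
          T.obj W ◁ Z.hb ((F).obj X) ((F).obj (T.obj Y)) ⊗≫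
          T.obj W ◁ (T.obj ((F).obj (T.obj Y)) ◁ (ZB).mul X) ⊗≫
          T.obj W ◁ (act) Y ▷ (F).obj X ⊗≫ 𝟙 _ := by
            rw [MonoidalCategory.tensorHom_def']; monoidal
      _ = 𝟙 _ ⊗≫ X ◁ Z.hb (T.obj Y) W ⊗≫ Z.hb X (T.obj W) ▷ (F).obj (T.obj Y) ⊗≫
          (B.mul W ▷ ((F).obj X ⊗ (F).obj (T.obj Y)) ≫
            T.obj W ◁ (Z.hb ((F).obj X) ((F).obj (T.obj Y)) ≫
              T.obj ((F).obj (T.obj Y)) ◁ (ZB).mul X)) ⊗≫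
          T.obj W ◁ (act) Y ▷ (F).obj X ⊗≫ 𝟙 _ := by rw [hb_comul]; monoidal
      _ = 𝟙 _ ⊗≫ X ◁ Z.hb (T.obj Y) W ⊗≫ (Z.hb X (T.obj W) ▷ (F).obj (T.obj Y) ⊗≫
          T.obj (T.obj W) ◁ Z.hb ((F).obj X) ((F).obj (T.obj Y)) ⊗≫
          (T.obj (T.obj W) ⊗ T.obj ((F).obj (T.obj Y))) ◁ (ZB).mul X) ⊗≫
          (B.mul W ▷ T.obj ((F).obj (T.obj Y)) ≫ T.obj W ◁ (act) Y) ▷ (F).obj X ⊗≫ 𝟙 _ := by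
        rw [← whisker_exchange]; monoidal
      _ = 𝟙 _ ⊗≫ (X ◁ Z.hb (T.obj Y) W ≫ Z.hb X (T.obj W ⊗ (F).obj (T.obj Y))) ⊗≫
          (B.comul (T.obj W) ((F).obj (T.obj Y)) ≫ B.mul W ▷ T.obj ((F).obj (T.obj Y)) ≫
            T.obj W ◁ (act) Y) ▷ (F).obj X ⊗≫ 𝟙 _ := by rw [hb_mul]; monoidal
      _ = 𝟙 _ ⊗≫ Z.hb X (T.obj Y ⊗ W) ⊗≫ (T.map (Z.hb (T.obj Y) W) ≫
          B.comul (T.obj W) ((F).obj (T.obj Y)) ≫ B.mul W ▷ T.obj ((F).obj (T.obj Y)) ≫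
            T.obj W ◁ (act) Y) ▷ (F).obj X ⊗≫ 𝟙 _ := by rw [hb_naturality_right]; monoidal
      _ = _ := by rw [hb_map_comul_action]
  rw [lhs]
  symm
  calc _ = (Z.hb (X ⊗ T.obj Y) W ≫ T.obj W ◁ (F).map (Z.hb X (T.obj Y) ≫
          (B.mul Y ≫ (ZB).unit (T.obj Y)) ▷ (F).obj X)) ≫
        T.obj W ◁ (ZB).comul ((F).obj (T.obj Y)) ((F).obj X) ⊗≫
        T.obj W ◁ ((ZB).mul (T.obj Y) ▷ (F).obj ((F).obj X)) ⊗≫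
        T.obj W ◁ ((F).obj (T.obj Y) ◁ (ZB).mul X) ⊗≫ 𝟙 _ := by
          rw [MonoidalCategory.tensorHom_def]; monoidal
    _ = (Z.hb X (T.obj Y) ≫ (B.mul Y ≫ (ZB).unit (T.obj Y)) ▷ (F).obj X) ▷ W ⊗≫
        (Z.hb ((F).obj (T.obj Y) ⊗ (F).obj X) W ⊗≫
          T.obj W ◁ (ZB).comul ((F).obj (T.obj Y)) ((F).obj X)) ⊗≫
        T.obj W ◁ ((ZB).mul (T.obj Y) ▷ (F).obj ((F).obj X)) ⊗≫
        T.obj W ◁ ((F).obj (T.obj Y) ◁ (ZB).mul X) ⊗≫ 𝟙 _ := by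
      rw [← hb_naturality_left]; monoidal
    _ = 𝟙 _ ⊗≫ Z.hb X (T.obj Y) ▷ W ⊗≫ ((B.mul Y ≫ (ZB).unit (T.obj Y)) ▷ ((F).obj X ⊗ W) ≫
          (F).obj (T.obj Y) ◁ Z.hb ((F).obj X) W) ⊗≫
        Z.hb ((F).obj (T.obj Y)) (T.obj W) ▷ (F).obj ((F).obj X) ⊗≫
        (B.mul W ▷ (F).obj ((F).obj (T.obj Y)) ≫ T.obj W ◁ (ZB).mul (T.obj Y)) ▷
          (F).obj ((F).obj X) ⊗≫
        T.obj W ◁ ((F).obj (T.obj Y) ◁ (ZB).mul X) ⊗≫ 𝟙 _ := by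
      rw [hb_comul]; monoidal
    _ = 𝟙 _ ⊗≫ Z.hb X (T.obj Y) ▷ W ⊗≫ T.obj (T.obj Y) ◁ Z.hb ((F).obj X) W ⊗≫
        (B.mul Y ▷ T.obj W ≫ ((ZB).unit (T.obj Y) ▷ T.obj W ≫
          Z.hb ((F).obj (T.obj Y)) (T.obj W) ≫ T.obj (T.obj W) ◁ (ZB).mul (T.obj Y)) ≫
          B.mul W ▷ (F).obj (T.obj Y)) ▷ (F).obj ((F).obj X) ⊗≫
        (T.obj W ⊗ (F).obj (T.obj Y)) ◁ (ZB).mul X ⊗≫ 𝟙 _ := by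
      rw [← whisker_exchange, ← whisker_exchange]; monoidal
    _ = 𝟙 _ ⊗≫ Z.hb X (T.obj Y) ▷ W ⊗≫ T.obj (T.obj Y) ◁ Z.hb ((F).obj X) W ⊗≫
        ((B.mul Y ▷ T.obj W ≫ Z.hb (T.obj Y) (T.obj W) ≫
          B.mul W ▷ (F).obj (T.obj Y)) ▷ (F).obj ((F).obj X) ≫
        (T.obj W ⊗ (F).obj (T.obj Y)) ◁ (ZB).mul X) ⊗≫ 𝟙 _ := by
      rw [hu]; monoidal
    _ = 𝟙 _ ⊗≫ (Z.hb X (T.obj Y) ▷ W ⊗≫ T.obj (T.obj Y) ◁ Z.hb ((F).obj X) W ⊗≫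
        (T.obj (T.obj Y) ⊗ T.obj W) ◁ (ZB).mul X) ⊗≫
        (B.mul Y ▷ T.obj W ≫ Z.hb (T.obj Y) (T.obj W) ≫
          B.mul W ▷ (F).obj (T.obj Y)) ▷ (F).obj X ⊗≫ 𝟙 _ := by
      rw [← whisker_exchange]; monoidal
    _ = _ := by rw [hb_mul]; monoidal

/-- The action of `T` on the target of the R-matrix, applied to the R-matrix. -/
theorem map_doubleRMatrix_action (X Y : C) :
    T.map (Z.doubleRMatrix hB X Y) ≫ B.comul ((F).obj (T.obj Y)) ((F).obj (T.obj X)) ≫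
        ((act) Y ⊗ₘ (act) X) =
      B.comul X Y ≫ Z.hb (T.obj X) (T.obj Y) ≫
        (B.mul Y ≫ (ZB).unit (T.obj Y)) ▷ (F).obj (T.obj X) := by
  have hA := Z.isBimonad_bimonadData hB.isBimonad
  have hl := Z.isDistributiveLaw_canonicalLaw hB
  dsimp only [doubleRMatrix]
  rw [T.map_comp, Category.assoc, reassoc_of% (hB.isBimonad.comul_naturality
    ((ZB).unit (T.obj Y)) ((F).map (B.unit X))), tensorHom_comp_tensorHom, hl.map_unit_action hA,
    hl.map_map_unit_action hB.isBimonad, MonoidalCategory.tensorHom_def, comp_whiskerRight,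
    comp_whiskerRight, Category.assoc, ← whisker_exchange, reassoc_of% (Z.hb_law hB X Y)]

/-- Both sides are `D_T(X ⊗ Y) ⟶ D_T(Y) ⊗ D_T(X)`; after the actions of `T` have been evaluated they
agree by `comul_hb_mul`. -/
theorem linear_doubleRMatrix (X Y : C) :
    Z.doubleComul hB X Y ≫ Z.doubleRMatrix hB ((F).obj (T.obj X)) ((F).obj (T.obj Y)) ≫
        (Z.doubleMul hB Y ⊗ₘ Z.doubleMul hB X) =
      (F).map (T.map (Z.doubleRMatrix hB X Y)) ≫
        Z.doubleComul hB ((F).obj (T.obj Y)) ((F).obj (T.obj X)) ≫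
        (Z.doubleMul hB Y ⊗ₘ Z.doubleMul hB X) := by
  have hA := Z.isBimonad_bimonadData hB.isBimonad
  have h1 : Z.doubleRMatrix hB ((F).obj (T.obj X)) ((F).obj (T.obj Y)) ≫
      (Z.doubleMul hB Y ⊗ₘ Z.doubleMul hB X) =
      Z.hb ((F).obj (T.obj X)) ((F).obj (T.obj Y)) ≫ ((act) Y ⊗ₘ (ZB).mul (T.obj X)) := by
    dsimp only [doubleRMatrix]
    rw [Category.assoc, tensorHom_comp_tensorHom, unit_double_mul, map_unit_double_mul]
  rw [h1]
  dsimp only [doubleMul, doubleComul]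
  rw [double_mul, double_mul, ← tensorHom_comp_tensorHom]
  dsimp only [double]
  rw [Category.assoc, Category.assoc, comul_hb_mul, ← reassoc_of% (hA.comul_naturality ((act) Y)
    ((act) X))]
  simp only [← (F).map_comp_assoc]
  rw [map_doubleRMatrix_action]

theorem tensor_left_doubleRMatrix (X Y W : C) :
    Z.doubleRMatrix hB (X ⊗ Y) W ≫ ((F).obj (T.obj W) ◁ Z.doubleComul hB X Y) =
      (α_ X Y W).hom ≫ X ◁ Z.doubleRMatrix hB Y W ≫
        (α_ X ((F).obj (T.obj W)) ((F).obj (T.obj Y))).inv ≫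
        Z.doubleRMatrix hB X ((F).obj (T.obj W)) ▷ (F).obj (T.obj Y) ≫
        (α_ ((F).obj (T.obj ((F).obj (T.obj W)))) ((F).obj (T.obj X)) ((F).obj (T.obj Y))).hom ≫
        Z.doubleMul hB W ▷ ((F).obj (T.obj X) ⊗ (F).obj (T.obj Y)) := by
  have hA := Z.isBimonad_bimonadData hB.isBimonad
  have hl := Z.isDistributiveLaw_canonicalLaw hB
  have h1 : (F).map (B.unit (X ⊗ Y)) ≫ Z.doubleComul hB X Y =
      (ZB).comul X Y ≫ ((F).map (B.unit X) ⊗ₘ (F).map (B.unit Y)) := by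
    dsimp only [doubleComul, double]
    rw [← hA.comul_naturality, ← hB.isBimonad.unit_comul, (F).map_comp, Category.assoc]
  have h2 : T.map ((ZB).unit (T.obj W)) ≫ (ZB).unit (T.obj ((F).obj (T.obj W))) ≫
      Z.doubleMul hB W = B.mul W ≫ (ZB).unit (T.obj W) := by
    rw [unit_double_mul, hl.map_unit_action hA]
  dsimp only [doubleRMatrix] at h1 ⊢
  simp only [MonoidalCategory.tensorHom_def]
  calc _ = Z.hb (X ⊗ Y) W ≫ (ZB).unit (T.obj W) ▷ (F).obj (X ⊗ Y) ≫
        (F).obj (T.obj W) ◁ ((F).map (B.unit (X ⊗ Y)) ≫ Z.doubleComul hB X Y) := by monoidal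
    _ = Z.hb (X ⊗ Y) W ≫ ((ZB).unit (T.obj W) ▷ (F).obj (X ⊗ Y) ≫
        (F).obj (T.obj W) ◁ ((ZB).comul X Y ≫ ((F).map (B.unit X) ⊗ₘ (F).map (B.unit Y)))) := by
      rw [h1]
    _ = (Z.hb (X ⊗ Y) W ⊗≫ T.obj W ◁ (ZB).comul X Y) ⊗≫
        T.obj W ◁ ((F).map (B.unit X) ⊗ₘ (F).map (B.unit Y)) ⊗≫
        (ZB).unit (T.obj W) ▷ ((F).obj (T.obj X) ⊗ (F).obj (T.obj Y)) := by
      rw [← whisker_exchange]; monoidal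
    _ = 𝟙 _ ⊗≫ X ◁ Z.hb Y W ⊗≫ Z.hb X (T.obj W) ▷ (F).obj Y ⊗≫
        (B.mul W ▷ ((F).obj X ⊗ (F).obj Y) ≫
          T.obj W ◁ ((F).map (B.unit X) ⊗ₘ (F).map (B.unit Y))) ⊗≫
        (ZB).unit (T.obj W) ▷ ((F).obj (T.obj X) ⊗ (F).obj (T.obj Y)) := by
      rw [hb_comul]; monoidal
    _ = 𝟙 _ ⊗≫ X ◁ Z.hb Y W ⊗≫ (Z.hb X (T.obj W) ▷ (F).obj Y ≫
          (T.obj (T.obj W) ⊗ (F).obj X) ◁ (F).map (B.unit Y)) ⊗≫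
        T.obj (T.obj W) ◁ (F).map (B.unit X) ▷ (F).obj (T.obj Y) ⊗≫
        (B.mul W ≫ (ZB).unit (T.obj W)) ▷ ((F).obj (T.obj X) ⊗ (F).obj (T.obj Y)) := by
      rw [← whisker_exchange, MonoidalCategory.tensorHom_def']; monoidal
    _ = 𝟙 _ ⊗≫ X ◁ (Z.hb Y W ≫ T.obj W ◁ (F).map (B.unit Y)) ⊗≫
        Z.hb X (T.obj W) ▷ (F).obj (T.obj Y) ⊗≫
        (T.obj (T.obj W) ◁ (F).map (B.unit X) ≫ T.map ((ZB).unit (T.obj W)) ▷ (F).obj (T.obj X)) ▷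
          (F).obj (T.obj Y) ⊗≫
        ((ZB).unit (T.obj ((F).obj (T.obj W))) ≫ Z.doubleMul hB W) ▷
          ((F).obj (T.obj X) ⊗ (F).obj (T.obj Y)) := by
      rw [← whisker_exchange, ← h2]; monoidal
    _ = 𝟙 _ ⊗≫ X ◁ (Z.hb Y W ≫ T.obj W ◁ (F).map (B.unit Y)) ⊗≫
        (Z.hb X (T.obj W) ≫ T.map ((ZB).unit (T.obj W)) ▷ (F).obj X) ▷ (F).obj (T.obj Y) ⊗≫
        (T.obj ((F).obj (T.obj W)) ◁ (F).map (B.unit X) ≫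
          (ZB).unit (T.obj ((F).obj (T.obj W))) ▷ (F).obj (T.obj X)) ▷ (F).obj (T.obj Y) ⊗≫
        Z.doubleMul hB W ▷ ((F).obj (T.obj X) ⊗ (F).obj (T.obj Y)) := by
      rw [whisker_exchange]; monoidal
    _ = 𝟙 _ ⊗≫ X ◁ (Z.hb Y W ≫ (T.obj W ◁ (F).map (B.unit Y) ≫
          (ZB).unit (T.obj W) ▷ (F).obj (T.obj Y))) ⊗≫
        Z.hb X ((F).obj (T.obj W)) ▷ (F).obj (T.obj Y) ⊗≫
        ((ZB).unit (T.obj ((F).obj (T.obj W))) ▷ (F).obj X ≫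
          (F).obj (T.obj ((F).obj (T.obj W))) ◁ (F).map (B.unit X)) ▷ (F).obj (T.obj Y) ⊗≫
        Z.doubleMul hB W ▷ ((F).obj (T.obj X) ⊗ (F).obj (T.obj Y)) := by
      rw [← hb_naturality_right, whisker_exchange]; monoidal
    _ = _ := by rw [whisker_exchange]; monoidal

theorem tensor_right_doubleRMatrix (X Y W : C) :
    Z.doubleRMatrix hB X (Y ⊗ W) ≫ (Z.doubleComul hB Y W ▷ (F).obj (T.obj X)) =
      (α_ X Y W).inv ≫ Z.doubleRMatrix hB X Y ▷ W ≫
        (α_ ((F).obj (T.obj Y)) ((F).obj (T.obj X)) W).hom ≫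
        (F).obj (T.obj Y) ◁ Z.doubleRMatrix hB ((F).obj (T.obj X)) W ≫
        (α_ ((F).obj (T.obj Y)) ((F).obj (T.obj W)) ((F).obj (T.obj ((F).obj (T.obj X))))).inv ≫
        ((F).obj (T.obj Y) ⊗ (F).obj (T.obj W)) ◁ Z.doubleMul hB X := by
  have hA := Z.isBimonad_bimonadData hB.isBimonad
  have h1 : (ZB).unit (T.obj (Y ⊗ W)) ≫ Z.doubleComul hB Y W =
      B.comul Y W ≫ ((ZB).unit (T.obj Y) ⊗ₘ (ZB).unit (T.obj W)) := by
    dsimp only [doubleComul, double]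
    rw [← reassoc_of% (hA.unit_naturality (B.comul Y W)), hA.unit_comul]
  have h2 : (F).map ((F).map (B.unit X)) ≫ (F).map (B.unit ((F).obj (T.obj X))) ≫
      Z.doubleMul hB X = (ZB).mul X ≫ (F).map (B.unit X) := by
    rw [map_unit_double_mul, hA.mul_naturality]
  dsimp only [doubleRMatrix] at h1 ⊢
  simp only [MonoidalCategory.tensorHom_def'] at h1 ⊢
  calc _ = Z.hb X (Y ⊗ W) ≫ T.obj (Y ⊗ W) ◁ (F).map (B.unit X) ≫
        ((ZB).unit (T.obj (Y ⊗ W)) ≫ Z.doubleComul hB Y W) ▷ (F).obj (T.obj X) := by monoidal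
    _ = Z.hb X (Y ⊗ W) ≫ (T.obj (Y ⊗ W) ◁ (F).map (B.unit X) ≫
        B.comul Y W ▷ (F).obj (T.obj X)) ≫ (T.obj Y ◁ (ZB).unit (T.obj W) ≫
          (ZB).unit (T.obj Y) ▷ (F).obj (T.obj W)) ▷ (F).obj (T.obj X) := by rw [h1]; monoidal
    _ = 𝟙 _ ⊗≫ (𝟙 ((X ⊗ Y) ⊗ W) ⊗≫ Z.hb X (Y ⊗ W) ⊗≫ B.comul Y W ▷ (F).obj X) ⊗≫
        (T.obj Y ⊗ T.obj W) ◁ (F).map (B.unit X) ⊗≫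
        (T.obj Y ◁ (ZB).unit (T.obj W) ≫
          (ZB).unit (T.obj Y) ▷ (F).obj (T.obj W)) ▷ (F).obj (T.obj X) := by
      rw [whisker_exchange]; monoidal
    _ = 𝟙 _ ⊗≫ Z.hb X Y ▷ W ⊗≫ T.obj Y ◁ Z.hb ((F).obj X) W ⊗≫
        (T.obj Y ⊗ T.obj W) ◁ ((ZB).mul X ≫ (F).map (B.unit X)) ⊗≫
        (T.obj Y ◁ (ZB).unit (T.obj W) ≫
          (ZB).unit (T.obj Y) ▷ (F).obj (T.obj W)) ▷ (F).obj (T.obj X) := by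
      rw [← Z.hb_mul hB.isBimonad]; monoidal
    _ = 𝟙 _ ⊗≫ Z.hb X Y ▷ W ⊗≫ T.obj Y ◁ (Z.hb ((F).obj X) W ≫
          T.obj W ◁ (F).map ((F).map (B.unit X))) ⊗≫
        (T.obj Y ⊗ T.obj W) ◁ ((F).map (B.unit ((F).obj (T.obj X))) ≫ Z.doubleMul hB X) ⊗≫
        T.obj Y ◁ (ZB).unit (T.obj W) ▷ (F).obj (T.obj X) ⊗≫
        (ZB).unit (T.obj Y) ▷ ((F).obj (T.obj W) ⊗ (F).obj (T.obj X)) ⊗≫ 𝟙 _ := by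
      rw [← h2]; monoidal
    _ = 𝟙 _ ⊗≫ (Z.hb X Y ≫ T.obj Y ◁ (F).map (B.unit X)) ▷ W ⊗≫
        T.obj Y ◁ (Z.hb ((F).obj (T.obj X)) W ≫
          (T.obj W ◁ ((F).map (B.unit ((F).obj (T.obj X))) ≫ Z.doubleMul hB X) ≫
            (ZB).unit (T.obj W) ▷ (F).obj (T.obj X))) ⊗≫
        (ZB).unit (T.obj Y) ▷ ((F).obj (T.obj W) ⊗ (F).obj (T.obj X)) ⊗≫ 𝟙 _ := by
      rw [← hb_naturality_left]; monoidal
    _ = 𝟙 _ ⊗≫ (Z.hb X Y ≫ T.obj Y ◁ (F).map (B.unit X)) ▷ W ⊗≫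
        (T.obj Y ◁ (Z.hb ((F).obj (T.obj X)) W ≫ (ZB).unit (T.obj W) ▷
            (F).obj ((F).obj (T.obj X)) ≫
          (F).obj (T.obj W) ◁ ((F).map (B.unit ((F).obj (T.obj X))) ≫ Z.doubleMul hB X)) ≫
        (ZB).unit (T.obj Y) ▷ ((F).obj (T.obj W) ⊗ (F).obj (T.obj X))) ⊗≫ 𝟙 _ := by
      rw [whisker_exchange]; monoidal
    _ = 𝟙 _ ⊗≫ (Z.hb X Y ≫ T.obj Y ◁ (F).map (B.unit X) ≫
          (ZB).unit (T.obj Y) ▷ (F).obj (T.obj X)) ▷ W ⊗≫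
        (F).obj (T.obj Y) ◁ (Z.hb ((F).obj (T.obj X)) W ≫ ((ZB).unit (T.obj W) ▷
            (F).obj ((F).obj (T.obj X)) ≫
          (F).obj (T.obj W) ◁ (F).map (B.unit ((F).obj (T.obj X))))) ⊗≫
        ((F).obj (T.obj Y) ⊗ (F).obj (T.obj W)) ◁ Z.doubleMul hB X := by
      rw [whisker_exchange]; monoidal
    _ = _ := by rw [← whisker_exchange]; monoidal

theorem isRMatrix_double : (Z.double hB).IsRMatrix (Z.doubleRMatrix hB) where
  naturality f g := by
    have hA := Z.isBimonad_bimonadData hB.isBimonad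
    dsimp only [doubleRMatrix, Functor.comp_map]
    rw [reassoc_of% (Z.hb_naturality f g), tensorHom_comp_tensorHom, Category.assoc,
      tensorHom_comp_tensorHom, hA.unit_naturality, ← (F).map_comp, ← (F).map_comp,
      hB.isBimonad.unit_naturality]
  linear := Z.linear_doubleRMatrix hB
  tensor_left X Y W := Z.tensor_left_doubleRMatrix hB X Y W
  tensor_right X Y W := Z.tensor_right_doubleRMatrix hB X Y W
  unit_left X := by
    have hA := Z.isBimonad_bimonadData hB.isBimonad
    dsimp only [doubleRMatrix, double, Functor.comp_obj]
    have h1 : (F).map (B.unit (𝟙_ C)) ≫ (F).map B.counit ≫ (ZB).counit = (ZB).counit := by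
      rw [← (F).map_comp_assoc, hB.isBimonad.unit_counit, (F).map_id, Category.id_comp]
    calc _ = 𝟙 _ ⊗≫ Z.hb (𝟙_ C) X ⊗≫ ((ZB).unit (T.obj X) ▷ (F).obj (𝟙_ C) ≫
          (F).obj (T.obj X) ◁ ((F).map (B.unit (𝟙_ C)) ≫ (F).map B.counit ≫ (ZB).counit)) ⊗≫
          𝟙 _ := by rw [MonoidalCategory.tensorHom_def]; monoidal
      _ = 𝟙 _ ⊗≫ (Z.hb (𝟙_ C) X ⊗≫ T.obj X ◁ (ZB).counit) ⊗≫ (ZB).unit (T.obj X) ⊗≫ 𝟙 _ := by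
        rw [h1, ← whisker_exchange]; monoidal
      _ = _ := by rw [hb_counit]; monoidal
  unit_right X := by
    have hA := Z.isBimonad_bimonadData hB.isBimonad
    dsimp only [doubleRMatrix, double, Functor.comp_obj]
    have h1 : (ZB).unit (T.obj (𝟙_ C)) ≫ (F).map B.counit ≫ (ZB).counit = B.counit := by
      rw [← reassoc_of% (hA.unit_naturality B.counit), hA.unit_counit, Category.comp_id]
    rw [hA.unit_naturality, Z.unit_eq hB.isBimonad X]
    calc _ = 𝟙 _ ⊗≫ Z.hb X (𝟙_ C) ⊗≫ (T.obj (𝟙_ C) ◁ (F).map (B.unit X) ≫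
          ((ZB).unit (T.obj (𝟙_ C)) ≫ (F).map B.counit ≫ (ZB).counit) ▷ (F).obj (T.obj X)) ⊗≫
          𝟙 _ := by rw [MonoidalCategory.tensorHom_def']; monoidal
      _ = _ := by rw [h1, whisker_exchange]; monoidal

end Centralizer
end DoubleIsQuasitriangular

theorem mainTheorem2 {C : Type u} [Category.{v} C] [MonoidalCategory C] [RigidCategory C]
    (T : C ⥤ C) (B : BimonadData T) (hB : B.IsHopfMonad) (Z : Centralizer T) :
    (Z.double hB).IsHopfMonad ∧
      (Z.double hB).IsRMatrix (fun X Y : C =>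
        Z.hb X Y ≫
          ((Z.bimonadData hB.isBimonad).unit (T.obj Y) ⊗ₘ Z.functor.map (B.unit X))) :=
  ⟨Z.isHopfMonad_double hB, Z.isRMatrix_double hB⟩
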